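/- Let $L>0$, $\mu>0$, $E_B<0$, $M>0$, $\kappa=2\pi/L$, $\widetilde\mu=\mu/|E_B|$; all momenta lie in $\kappa\mathbb Z^2$. Let $a_k,a_k^*$ be the fermionic annihilation and creation operators of the plane waves $L^{-1}e^{ikx}$, $x \in [-L/2,L/2]^2$, and let $\mathscr H_n$ be the $n$-particle sector of the fermionic Fock space over $L^2([-L/2,L/2]^2)$. Put $T=\sum_k k^2a_k^*a_k$, $P_{\rm f}=\sum_k k\,a_k^*a_k$, $N(\mu)=|\{k:k^2\le\mu\}|$, $E_0(\mu)=\sum_{k^2\le\mu}k^2$, and $|{\rm FS}_\mu\rangle=\prod_{k^2\le\mu}a_k^*|0\rangle$. For $\tau>-\mu$ put $$G(q,\tau)=\frac1{L^2}\sum_k\Big(\frac1{(1+\frac1M)k^2-E_B}-\frac{\chi_{(\mu,\infty)}(k^2)}{\frac1M(q-k)^2+k^2+\tau}\Big),$$ and let the polaron energy $e_{\rm P}(\mu,E_B)<0$ be the lowest negative solution $e$ of $e=-\frac1{L^2}\sum_{k^2\le\mu}\frac1{G(k,-k^2-e)}$. For $p\in\kappa\mathbb Z^2$ and real $\lambda\le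 E_0(\mu)+e_{\rm P}(\mu,E_B)$, the fiber at total momentum $p$ of the Birman–Schwinger operator is the operator on $\mathscr H_{N(\mu)-1}$ $$\phi_p(\lambda)=G(p-P_{\rm f},T-\lambda)-H_p(\lambda)-X_p(\lambda)+P_p(\lambda),$$ defined on the core $\mathscr D$ of all finite linear combinations of antisymmetric products of $N(\mu)-1$ plane waves, where $$H_p(\lambda)=a(\eta)\frac1{\frac1M(p-P_{\rm f})^2+T-\lambda}a^*(\eta),\qquad X_p(\lambda)=a(\eta)A_p^*(\lambda)+A_p(\lambda)a^*(\eta),$$ $$P_p(\lambda)=\frac1{L^2}\sum_{k^2,l^2>\mu}a_l^*\frac1{\frac1M(p-P_{\rm f}-k-l)^2+T+k^2+l^2-\lambda}a_k,$$ $$a(\eta)=\frac1L\sum_{k^2\le\mu}a_k,\qquad A_p(\lambda)=\frac1L\sum_{k^2>\mu}\frac1{\frac1M(p-P_{\rm f}-k)^2+T+k^2-\lambda}a_k .$$ For $\varepsilon>0$ and $\mu>|E_B|$ let $\Pi_\varepsilon$ be the orthogonal projector in $\mathscr H_{N(\mu)-1}$ onto the closed span of all vectors $a^*_{l_1}\cdots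 a^*_{l_{m-1}}a_{k_1}\cdots a_{k_m}|{\rm FS}_\mu\rangle$ with $m\ge1$, $k_i^2\le\mu$ and $\mu<l_i^2\le\big(1+\frac1{\varepsilon\log\widetilde\mu}\big)\mu$, and let $\Pi_\varepsilon^\perp=1-\Pi_\varepsilon$. Finally let $$\Phi_p(\lambda,\varepsilon)=\Pi_\varepsilon\big(G(p-P_{\rm f},T-\lambda)-H_p(\lambda)-X_p(\lambda)-\varepsilon^{-1}\big)\Pi_\varepsilon,$$ $$\Psi_p(\lambda,\varepsilon)=\Pi_\varepsilon^\perp\big(G(p-P_{\rm f},T-\lambda)+P_p(\lambda)-K(\varepsilon,\widetilde\mu)\big)\Pi_\varepsilon^\perp,$$ $$K(\varepsilon,\widetilde\mu)=\varepsilon^{-1/2}\big(\varepsilon^{-1/2}+\sqrt{\log\widetilde\mu}+\varepsilon\log\widetilde\mu\big).$$ **Proposition.** For every $M>0$ there are constants $c_0,\varepsilon_0>0$, depending only on $M$, such that for all $L>0$, $\mu>0$ and $E_B<0$ with $L^2|E_B|\ge1$ and $\mu/|E_B|\ge c_0$, all $\varepsilon\in(0,\varepsilon_0)$, all $p\in\kappa\mathbb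 Z^2$ and all real $\lambda\le E_0(\mu)+e_{\rm P}(\mu,E_B)$, $$\phi_p(\lambda)\ \ge\ \Phi_p(\lambda,\varepsilon)+\Psi_p(\lambda,\varepsilon)$$ in the sense of quadratic forms on $\mathscr D$. -/

import Mathlib

namespace FermiPolaron

noncomputable section

/-! ### Momentum lattice -/

/-- Labels `n ∈ ℤ²` of the plane-wave modes `φ_k`, `k = (2π/L) n`, of the torus of side `L`. -/
abbrev Mode := ℤ × ℤ

/-- The momentum `k = (2π/L) n ∈ ℝ²` with label `n`. -/
def momentum (L : ℝ) (n : Mode) : EuclideanSpace ℝ (Fin 2) :=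
  !₂[2 * Real.pi / L * (n.1 : ℝ), 2 * Real.pi / L * (n.2 : ℝ)]

/-- `k²` for the momentum with label `n`. -/
def kinetic (L : ℝ) (n : Mode) : ℝ := ‖momentum L n‖ ^ 2

/-- `Λ_h`: the momenta inside the Fermi sea, `k² ≤ μ`. -/
def holeModes (L μ : ℝ) : Set Mode := {n | kinetic L n ≤ μ}

/-- `Λ_p`: the momenta outside the Fermi sea, `k² > μ`. -/
def particleModes (L μ : ℝ) : Set Mode := {n | μ < kinetic L n}

/-- `Λ_{p,ε}^≤`: the thin shell `μ < k² ≤ (1 + 1 / (ε log (μ/|E_B|))) μ`. -/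
def shellModes (L μ EB ε : ℝ) : Set Mode :=
  {n | μ < kinetic L n ∧ kinetic L n ≤ (1 + 1 / (ε * Real.log (μ / |EB|))) * μ}

/-- `N(μ)`, the number of lattice momenta with `k² ≤ μ`. -/
def particleNumber (L μ : ℝ) : ℕ := (holeModes L μ).ncard

/-- `E₀(μ) = ∑_{k² ≤ μ} k²`. -/
def fermiSeaEnergy (L μ : ℝ) : ℝ := ∑' k : holeModes L μ, kinetic L k

/-! ### The function `G` and the polaron energy -/

/-- `G(q,τ) = L⁻² ∑_k (1 / ((1+1/M) k² - E_B) - χ_{(μ,∞)}(k²) / ((q-k)²/M + k² + τ))`. -/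
def G (M L μ EB : ℝ) (q : EuclideanSpace ℝ (Fin 2)) (τ : ℝ) : ℝ :=
  1 / L ^ 2 * ∑' k : Mode,
    (1 / ((1 + 1 / M) * kinetic L k - EB) -
      (if μ < kinetic L k then
        1 / (1 / M * ‖q - momentum L k‖ ^ 2 + kinetic L k + τ) else 0))

/-- The negative solutions `e` of the polaron equation
`e = - L⁻² ∑_{k² ≤ μ} 1 / G(k, -k² - e)`. -/
def polaronSolutions (M L μ EB : ℝ) : Set ℝ :=
  {e | e < 0 ∧
    e = -(1 / L ^ 2 * ∑' k : holeModes L μ,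
      1 / G M L μ EB (momentum L k) (-kinetic L k - e))}

/-- The polaron energy `e_P(μ,E_B)`, the lowest negative solution of the polaron equation. -/
def polaronEnergy (M L μ EB : ℝ) : ℝ := sInf (polaronSolutions M L μ EB)

/-! ### Fermionic Fock space

The fermionic Fock space over `L²` of the torus is written in the occupation number
representation of the plane-wave basis. A finite set `S` of modes labels the basis vector
`φ_{k₁} ∧ … ∧ φ_{kₙ} = a*_{k₁} ⋯ a*_{kₙ} |0⟩`, where `k₁ < … < kₙ` are the elements of `S` in
lexicographic order, and a vector is given by its amplitudes in this orthonormal basis. -/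

/-- Amplitudes in the occupation number basis. -/
abbrev Amplitude := Finset Mode → ℂ

/-- The `ℓ²` inner product, conjugate linear in the first argument. -/
def braket (ψ χ : Amplitude) : ℂ := ∑' S, (starRingEnd ℂ) (ψ S) * χ S

/-- The finite linear combinations of antisymmetric products of `n` plane waves: the dense
subspace of the `n`-particle space on which the operators below are defined. -/
def domain (n : ℕ) : Submodule ℂ Amplitude where
  carrier := {ψ | (Function.support ψ).Finite ∧ ∀ S, ψ S ≠ 0 → S.card = n}
  add_mem' := by
    rintro ψ χ ⟨h1, h2⟩ ⟨h3, h4⟩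
    refine ⟨(h1.union h3).subset (Function.support_add ψ χ), fun S hS => ?_⟩
    by_cases h : ψ S = 0
    · exact h4 S (fun h' => hS (by simp [h, h']))
    · exact h2 S h
  zero_mem' := by simp
  smul_mem' := by
    rintro c ψ ⟨h1, h2⟩
    refine ⟨h1.subset (Function.support_const_smul_subset c ψ), fun S hS => h2 S ?_⟩
    intro h
    exact hS (by simp [h])

/-- The sign `(-1)^#{j ∈ S : j < k}`, with `<` the lexicographic order. -/
def fermiSign (k : Mode) (S : Finset Mode) : ℂ :=
  (-1) ^ (S.filter fun j => j.1 < k.1 ∨ (j.1 = k.1 ∧ j.2 < k.2)).card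

/-- The annihilation operator `a_k`. -/
def ann (k : Mode) (ψ : Amplitude) : Amplitude := fun S =>
  if k ∈ S then 0 else fermiSign k S * ψ (insert k S)

/-- The creation operator `a_k*`. -/
def cre (k : Mode) (ψ : Amplitude) : Amplitude := fun S =>
  if k ∈ S then fermiSign k S * ψ (S.erase k) else 0

/-- The value of `P_f = ∑_k k a_k* a_k` on the basis vector `S`. -/
def totalMomentum (L : ℝ) (S : Finset Mode) : EuclideanSpace ℝ (Fin 2) := ∑ k ∈ S, momentum L k

/-- The value of `T = ∑_k k² a_k* a_k` on the basis vector `S`. -/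
def totalKinetic (L : ℝ) (S : Finset Mode) : ℝ := ∑ k ∈ S, kinetic L k

/-- The function `f(P_f, T)` of the commuting operators `P_f` and `T`. -/
def funPT (L : ℝ) (f : EuclideanSpace ℝ (Fin 2) → ℝ → ℝ) (ψ : Amplitude) : Amplitude := fun S =>
  (f (totalMomentum L S) (totalKinetic L S) : ℂ) * ψ S

/-! ### The fibers of the Birman–Schwinger operator -/

/-- `a(η) = L⁻¹ ∑_{k² ≤ μ} a_k`. -/
def annEta (L μ : ℝ) (ψ : Amplitude) : Amplitude := fun S =>
  (1 / L : ℂ) * ∑' k : holeModes L μ, ann k ψ S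

/-- `a*(η) = L⁻¹ ∑_{k² ≤ μ} a_k*`. -/
def creEta (L μ : ℝ) (ψ : Amplitude) : Amplitude := fun S =>
  (1 / L : ℂ) * ∑' k : holeModes L μ, cre k ψ S

/-- `A_p(λ) = L⁻¹ ∑_{k² > μ} ((p - P_f - k)²/M + T + k² - λ)⁻¹ a_k`. -/
def opA (M L μ lam : ℝ) (p : Mode) (ψ : Amplitude) : Amplitude := fun S =>
  (1 / L : ℂ) * ∑' k : particleModes L μ,
    funPT L (fun P T =>
      1 / (1 / M * ‖momentum L p - P - momentum L k‖ ^ 2 + T + kinetic L k - lam)) (ann k ψ) S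

/-- `A_p*(λ) = L⁻¹ ∑_{k² > μ} a_k* ((p - P_f - k)²/M + T + k² - λ)⁻¹`. -/
def opAStar (M L μ lam : ℝ) (p : Mode) (ψ : Amplitude) : Amplitude := fun S =>
  (1 / L : ℂ) * ∑' k : particleModes L μ,
    cre k (funPT L (fun P T =>
      1 / (1 / M * ‖momentum L p - P - momentum L k‖ ^ 2 + T + kinetic L k - lam)) ψ) S

/-- `G(p - P_f, T - λ)`. -/
def opG (M L μ EB lam : ℝ) (p : Mode) (ψ : Amplitude) : Amplitude :=
  funPT L (fun P T => G M L μ EB (momentum L p - P) (T - lam)) ψ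

/-- `H_p(λ) = a(η) ((p - P_f)²/M + T - λ)⁻¹ a*(η)`. -/
def opH (M L μ lam : ℝ) (p : Mode) (ψ : Amplitude) : Amplitude :=
  annEta L μ (funPT L (fun P T => 1 / (1 / M * ‖momentum L p - P‖ ^ 2 + T - lam)) (creEta L μ ψ))

/-- `X_p(λ) = a(η) A_p*(λ) + A_p(λ) a*(η)`. -/
def opX (M L μ lam : ℝ) (p : Mode) (ψ : Amplitude) : Amplitude :=
  annEta L μ (opAStar M L μ lam p ψ) + opA M L μ lam p (creEta L μ ψ)

/-- `P_p(λ) = L⁻² ∑_{k², l² > μ} a_l* ((p - P_f - k - l)²/M + T + k² + l² - λ)⁻¹ a_k`. -/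
def opP (M L μ lam : ℝ) (p : Mode) (ψ : Amplitude) : Amplitude := fun S =>
  (1 / L ^ 2 : ℂ) * ∑' kl : particleModes L μ × particleModes L μ,
    cre kl.2 (funPT L (fun P T =>
      1 / (1 / M * ‖momentum L p - P - momentum L kl.1 - momentum L kl.2‖ ^ 2 + T
        + kinetic L kl.1 + kinetic L kl.2 - lam)) (ann kl.1 ψ)) S

/-- The fiber `φ_p(λ) = G(p - P_f, T - λ) - H_p(λ) - X_p(λ) + P_p(λ)`. -/
def phi (M L μ EB lam : ℝ) (p : Mode) (ψ : Amplitude) : Amplitude :=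
  opG M L μ EB lam p ψ - opH M L μ lam p ψ - opX M L μ lam p ψ + opP M L μ lam p ψ

/-! ### Localization -/

open Classical in
/-- The orthogonal projector `Π_ε`. On the space of `N(μ) - 1` particles the vectors
`a*_{l₁} ⋯ a*_{l_{m-1}} a_{k₁} ⋯ a_{k_m} |FS_μ⟩` with `kᵢ ∈ Λ_h` and `lᵢ ∈ Λ_{p,ε}^≤` are, up to
signs and vanishing ones, the basis vectors whose occupied modes all lie in
`Λ_h ∪ Λ_{p,ε}^≤`; `Π_ε` projects on their closed linear span. -/
def proj (L μ EB ε : ℝ) (ψ : Amplitude) : Amplitude := fun S =>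
  if ∀ k ∈ S, k ∈ holeModes L μ ∪ shellModes L μ EB ε then ψ S else 0

/-- The complementary projector `Π_ε^⊥ = 1 - Π_ε`. -/
def projPerp (L μ EB ε : ℝ) (ψ : Amplitude) : Amplitude := ψ - proj L μ EB ε ψ

/-- `K(ε,x) = ε^{-1/2} (ε^{-1/2} + (log x)^{1/2} + ε log x)`. -/
def K (ε x : ℝ) : ℝ :=
  (√ε)⁻¹ * ((√ε)⁻¹ + √(Real.log x) + ε * Real.log x)

/-- `Φ_p(λ,ε) = Π_ε (G(p - P_f, T - λ) - H_p(λ) - X_p(λ) - ε⁻¹) Π_ε`. -/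
def Phi (M L μ EB lam ε : ℝ) (p : Mode) (ψ : Amplitude) : Amplitude :=
  let χ := proj L μ EB ε ψ
  proj L μ EB ε
    (opG M L μ EB lam p χ - opH M L μ lam p χ - opX M L μ lam p χ - ((ε⁻¹ : ℝ) : ℂ) • χ)

/-- `Ψ_p(λ,ε) = Π_ε^⊥ (G(p - P_f, T - λ) + P_p(λ) - K(ε, μ/|E_B|)) Π_ε^⊥`. -/
def Psi (M L μ EB lam ε : ℝ) (p : Mode) (ψ : Amplitude) : Amplitude :=
  let χ := projPerp L μ EB ε ψ
  projPerp L μ EB ε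
    (opG M L μ EB lam p χ + opP M L μ lam p χ - ((K ε (μ / |EB|) : ℝ) : ℂ) • χ)

/-- The inequality `A ≤ B` of symmetric operators on the `n`-particle space, in the sense of
quadratic forms on the core `domain n`. -/
def OperatorLE (n : ℕ) (A B : Amplitude → Amplitude) : Prop :=
  ∀ ψ ∈ domain n, (braket ψ (A ψ)).re ≤ (braket ψ (B ψ)).re

end

end FermiPolaron

namespace FermiPolaron

noncomputable section

open Finset

/-! ### The canonical anticommutation relations -/

/-! Write ψ = χ + ξ with χ = Π_ε ψ, and put ℓ = log(μ/|E_B|). Every configuration in ξ occupies a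
momentum beyond the shell of width d = μ/(εℓ), so its excitation energy is at least d. The form of φ
- Φ - Ψ is then ε⁻¹‖χ‖² + K‖ξ‖² plus the terms that localization drops: P between χ and χ, H and X
between ξ and ξ, and the cross terms. G is diagonal and H only moves sea modes, so neither has cross
terms. The cross term of X must create a particle beyond the shell, and those of P must exchange a
shell particle for a far one.

Each dropped term is bounded in operator norm. A Laplace integral turns a resolvent into e^{-tD},
and the Gaussian in the total momentum is an average of plane waves, which factor into unitary
phases. What remains are a(f) and a*(f) with |f_k| = e^{-t(k²-μ)}, bounded by ‖f‖ through the
anticommutation relations (`norm_sum_mul_inv_le`, `norm_ip_creation_le`, `norm_ip_exchange_le`).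
Counting momenta in annuli (`card_kinetic_annulus_le`) and integrating over t gives O(μ/d) for H,
O(√(μ/d)) for X, O(1) for the cross terms of P, and s/E + d/s for the inner part of P, with E =
E₀(μ) - λ and any s at least κ√μ.

Only this last bound needs E to be quantitatively large. `exists_polaronEnergy_le` provides E ≥
c₁μ/ℓ: since G is positive and O(ℓ) there, the fixed-point map of the polaron equation exceeds its
argument at c₁μ/ℓ, and a solution lies further down. With s = μ/(√ε ℓ) the inner exchange is
O(ε^{-1/2}), small against ε⁻¹. `final_quadratic_le` absorbs everything else into K. -/

/-- The lexicographic order of the modes, as it enters `fermiSign`. -/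
def modeLT (j k : Mode) : Prop := j.1 < k.1 ∨ (j.1 = k.1 ∧ j.2 < k.2)

instance (j k : Mode) : Decidable (modeLT j k) := by unfold modeLT; infer_instance

lemma fermiSign_eq (k : Mode) (S : Finset Mode) :
    fermiSign k S = (-1) ^ (S.filter fun j => modeLT j k).card := rfl

lemma fermiSign_mul_self (k : Mode) (S : Finset Mode) : fermiSign k S * fermiSign k S = 1 := by
  rw [fermiSign_eq, ← pow_add, ← two_mul, pow_mul]; simp

lemma conj_fermiSign (k : Mode) (S : Finset Mode) :
    (starRingEnd ℂ) (fermiSign k S) = fermiSign k S := by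
  simp [fermiSign_eq]

lemma fermiSign_insert_self (k : Mode) (S : Finset Mode) :
    fermiSign k (insert k S) = fermiSign k S := by
  rw [fermiSign_eq, fermiSign_eq, filter_insert, if_neg (by simp [modeLT])]

lemma fermiSign_insert {k l : Mode} {S : Finset Mode} (h : l ∉ S) :
    fermiSign k (insert l S) = (if modeLT l k then -1 else 1) * fermiSign k S := by
  rw [fermiSign_eq, fermiSign_eq, filter_insert]
  split_ifs
  · rw [card_insert_of_notMem (by simp [h]), pow_succ]; ring
  · simp

/-- The order is total, so exactly one of the two signs is -1. This is the source of anticommutation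
for distinct modes. -/
lemma modeLT_sign_mul {k l : Mode} (h : k ≠ l) :
    (if modeLT k l then (-1 : ℂ) else 1) * (if modeLT l k then -1 else 1) = -1 := by
  have h' : ¬ (k.1 = l.1 ∧ k.2 = l.2) := fun h' => h (Prod.ext h'.1 h'.2)
  unfold modeLT
  rcases lt_trichotomy k.1 l.1 with h1 | h1 | h1 <;>
  rcases lt_trichotomy k.2 l.2 with h2 | h2 | h2 <;>
  first
  | (exfalso; exact h' ⟨h1, h2⟩)
  | simp [h1, h1.not_gt, h2, h2.not_gt, h1.ne, h1.ne']
  | simp [h1, h1.not_gt, h2, h1.ne, h1.ne']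
  | simp [h1, h2, h2.not_gt]

lemma cre_ann_add_ann_cre (k l : Mode) (ψ : Amplitude) (S : Finset Mode) :
    cre k (ann l ψ) S + ann l (cre k ψ) S = if k = l then ψ S else 0 := by
  by_cases hkl : k = l
  · subst hkl
    by_cases hk : k ∈ S
    · obtain ⟨R, hR, rfl⟩ : ∃ R, k ∉ R ∧ S = insert k R :=
        ⟨S.erase k, by simp, (insert_erase hk).symm⟩
      simp [cre, ann, hR, erase_insert hR, fermiSign_insert_self, ← mul_assoc, fermiSign_mul_self]
    · simp [cre, ann, hk, erase_insert hk, fermiSign_insert_self, ← mul_assoc, fermiSign_mul_self]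
  · rw [if_neg hkl]
    by_cases hk : k ∈ S
    · obtain ⟨R, hR, rfl⟩ : ∃ R, k ∉ R ∧ S = insert k R :=
        ⟨S.erase k, by simp, (insert_erase hk).symm⟩
      by_cases hl : l ∈ R
      · simp [cre, ann, hl, erase_insert hR]
      -- The only contributing configurations contain k but not l. Both terms then carry ψ at
      -- `insert l R`, and their signs differ by the two comparisons of k with l.
      · have hlk : l ≠ k := fun h => hkl h.symm
        have e1 : insert l (insert k R) = insert k (insert l R) := insert_comm _ _ _
        have hk' : k ∉ insert l R := by simp [hkl, hR]
        simp only [cre, ann, mem_insert_self, if_true, erase_insert hR, hl, if_false, mem_insert,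
          hlk, or_self, or_true]
        rw [e1, erase_insert hk', fermiSign_insert_self, fermiSign_insert_self, fermiSign_insert hR,
          fermiSign_insert hl]
        linear_combination (fermiSign k R * fermiSign l R * ψ (insert l R)) * modeLT_sign_mul hkl
    · simp [cre, ann, hk, hkl]

/-! ### Amplitudes over finitely many modes -/

/-- The inner product restricted to configurations of the modes in `B`. -/
def ip (B : Finset Mode) (ψ χ : Amplitude) : ℂ := ∑ S ∈ B.powerset, (starRingEnd ℂ) (ψ S) * χ S

/-- The norm restricted to configurations of the modes in `B`. -/
def nrm (B : Finset Mode) (ψ : Amplitude) : ℝ := √(∑ S ∈ B.powerset, ‖ψ S‖ ^ 2)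

lemma nrm_nonneg (B : Finset Mode) (ψ : Amplitude) : 0 ≤ nrm B ψ := Real.sqrt_nonneg _

lemma nrm_sq (B : Finset Mode) (ψ : Amplitude) : nrm B ψ ^ 2 = ∑ S ∈ B.powerset, ‖ψ S‖ ^ 2 :=
  Real.sq_sqrt (sum_nonneg fun _ _ => by positivity)

lemma ip_self (B : Finset Mode) (ψ : Amplitude) : ip B ψ ψ = ((nrm B ψ ^ 2 : ℝ) : ℂ) := by
  rw [nrm_sq, ip, Complex.ofReal_sum]
  refine sum_congr rfl fun S _ => ?_
  rw [← Complex.normSq_eq_conj_mul_self, Complex.normSq_eq_norm_sq]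

lemma norm_ip_le (B : Finset Mode) (ψ χ : Amplitude) : ‖ip B ψ χ‖ ≤ nrm B ψ * nrm B χ := by
  refine (norm_sum_le _ _).trans ?_
  simp only [norm_mul, RCLike.norm_conj]
  exact Real.sum_mul_le_sqrt_mul_sqrt _ _ _

lemma conj_ip (B : Finset Mode) (ψ χ : Amplitude) : (starRingEnd ℂ) (ip B ψ χ) = ip B χ ψ := by
  simp [ip, mul_comm]

lemma ip_add_left (B : Finset Mode) (ψ₁ ψ₂ χ : Amplitude) :
    ip B (ψ₁ + ψ₂) χ = ip B ψ₁ χ + ip B ψ₂ χ := by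
  simp [ip, add_mul, sum_add_distrib]

lemma ip_add_right (B : Finset Mode) (ψ χ₁ χ₂ : Amplitude) :
    ip B ψ (χ₁ + χ₂) = ip B ψ χ₁ + ip B ψ χ₂ := by
  simp [ip, mul_add, sum_add_distrib]

lemma ip_sub_right (B : Finset Mode) (ψ χ₁ χ₂ : Amplitude) :
    ip B ψ (χ₁ - χ₂) = ip B ψ χ₁ - ip B ψ χ₂ := by
  simp [ip, mul_sub, sum_sub_distrib]

lemma ip_smul_right (B : Finset Mode) (c : ℂ) (ψ χ : Amplitude) :
    ip B ψ (c • χ) = c * ip B ψ χ := by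
  simp only [ip, mul_sum, Pi.smul_apply, smul_eq_mul]
  exact sum_congr rfl fun S _ => by ring

lemma ip_smul_left (B : Finset Mode) (c : ℂ) (ψ χ : Amplitude) :
    ip B (c • ψ) χ = (starRingEnd ℂ) c * ip B ψ χ := by
  simp only [ip, mul_sum, Pi.smul_apply, smul_eq_mul, map_mul]
  exact sum_congr rfl fun S _ => by ring

lemma ip_sum_right {ι : Type*} (B : Finset Mode) (s : Finset ι) (ψ : Amplitude)
    (χ : ι → Amplitude) : ip B ψ (∑ i ∈ s, χ i) = ∑ i ∈ s, ip B ψ (χ i) := by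
  simp only [ip, Finset.sum_apply, mul_sum]
  exact sum_comm

lemma ip_sum_left {ι : Type*} (B : Finset Mode) (s : Finset ι) (ψ : ι → Amplitude)
    (χ : Amplitude) : ip B (∑ i ∈ s, ψ i) χ = ∑ i ∈ s, ip B (ψ i) χ := by
  simp only [ip, Finset.sum_apply, map_sum, sum_mul]
  exact sum_comm

lemma ip_congr_right {B : Finset Mode} {ψ χ χ' : Amplitude}
    (h : ∀ S ∈ B.powerset, χ S = χ' S) : ip B ψ χ = ip B ψ χ' :=
  sum_congr rfl fun S hS => by rw [h S hS]

/-- Inserting k is a bijection from configurations without k to those with k. The assumption k ∈ B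
keeps it inside `B.powerset`, so adjointness survives the restriction to finitely many modes. -/
lemma ip_ann_left {B : Finset Mode} {k : Mode} (hk : k ∈ B) (ψ χ : Amplitude) :
    ip B (ann k ψ) χ = ip B ψ (cre k χ) := by
  have h1 : ip B (ann k ψ) χ = ∑ S ∈ B.powerset.filter (fun S => k ∉ S),
      fermiSign k S * (starRingEnd ℂ) (ψ (insert k S)) * χ S := by
    rw [ip, sum_filter]
    refine sum_congr rfl fun S _ => ?_
    by_cases h : k ∈ S <;> simp [ann, h, conj_fermiSign]
  have h2 : ip B ψ (cre k χ) = ∑ S ∈ B.powerset.filter (fun S => k ∈ S),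
      fermiSign k S * (starRingEnd ℂ) (ψ S) * χ (S.erase k) := by
    rw [ip, sum_filter]
    refine sum_congr rfl fun S _ => ?_
    by_cases h : k ∈ S <;> simp [cre, h]
    ring
  rw [h1, h2]
  refine sum_bij' (fun S _ => insert k S) (fun S _ => S.erase k) ?_ ?_ ?_ ?_ ?_
  · intro S hS
    simp only [mem_filter, mem_powerset] at hS ⊢
    exact ⟨insert_subset hk hS.1, mem_insert_self _ _⟩
  · intro S hS
    simp only [mem_filter, mem_powerset] at hS ⊢
    exact ⟨(erase_subset _ _).trans hS.1, by simp⟩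
  · intro S hS
    exact erase_insert (mem_filter.1 hS).2
  · intro S hS
    exact insert_erase (mem_filter.1 hS).2
  · intro S hS
    rw [fermiSign_insert_self, erase_insert (mem_filter.1 hS).2]

lemma ip_cre_left {B : Finset Mode} {k : Mode} (hk : k ∈ B) (ψ χ : Amplitude) :
    ip B (cre k ψ) χ = ip B ψ (ann k χ) := by
  rw [← conj_ip, ← ip_ann_left hk, conj_ip]

lemma ip_ann_ann_add {B : Finset Mode} {k l : Mode} (hk : k ∈ B) (hl : l ∈ B) (ψ : Amplitude) :
    ip B (ann k ψ) (ann l ψ) + ip B (cre l ψ) (cre k ψ) =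
      if k = l then ((nrm B ψ ^ 2 : ℝ) : ℂ) else 0 := by
  rw [ip_ann_left hk, ip_cre_left hl, ← ip_add_right, ← ip_self]
  split_ifs with h
  · exact ip_congr_right fun S _ => by rw [Pi.add_apply, cre_ann_add_ann_cre, if_pos h]
  · refine sum_eq_zero fun S _ => ?_
    rw [Pi.add_apply, cre_ann_add_ann_cre, if_neg h, mul_zero]

/-- `‖a(f) ψ‖² + ‖a*(f) ψ‖² = ‖f‖² ‖ψ‖²`. -/
lemma nrm_sq_ann_add_nrm_sq_cre {B F : Finset Mode} (hF : F ⊆ B) (f : Mode → ℂ) (ψ : Amplitude) :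
    nrm B (∑ k ∈ F, f k • ann k ψ) ^ 2 + nrm B (∑ k ∈ F, (starRingEnd ℂ) (f k) • cre k ψ) ^ 2 =
      (∑ k ∈ F, ‖f k‖ ^ 2) * nrm B ψ ^ 2 := by
  have key : ip B (∑ k ∈ F, f k • ann k ψ) (∑ k ∈ F, f k • ann k ψ) +
      ip B (∑ k ∈ F, (starRingEnd ℂ) (f k) • cre k ψ)
        (∑ k ∈ F, (starRingEnd ℂ) (f k) • cre k ψ) =
      ((∑ k ∈ F, ‖f k‖ ^ 2 : ℝ) : ℂ) * ((nrm B ψ ^ 2 : ℝ) : ℂ) := by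
    have e1 : ip B (∑ k ∈ F, f k • ann k ψ) (∑ k ∈ F, f k • ann k ψ) =
        ∑ k ∈ F, ∑ l ∈ F, (starRingEnd ℂ) (f k) * f l * ip B (ann k ψ) (ann l ψ) := by
      rw [ip_sum_left]
      refine sum_congr rfl fun k _ => ?_
      rw [ip_sum_right]
      refine sum_congr rfl fun l _ => ?_
      rw [ip_smul_left, ip_smul_right]; ring
    have e2 : ip B (∑ k ∈ F, (starRingEnd ℂ) (f k) • cre k ψ)
        (∑ k ∈ F, (starRingEnd ℂ) (f k) • cre k ψ) =
        ∑ k ∈ F, ∑ l ∈ F, (starRingEnd ℂ) (f k) * f l * ip B (cre l ψ) (cre k ψ) := by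
      rw [ip_sum_right]
      refine sum_congr rfl fun k _ => ?_
      rw [ip_sum_left]
      refine sum_congr rfl fun l _ => ?_
      rw [ip_smul_left, ip_smul_right, Complex.conj_conj]; ring
    rw [e1, e2, ← sum_add_distrib, Complex.ofReal_sum, sum_mul]
    refine sum_congr rfl fun k hk => ?_
    rw [← sum_add_distrib]
    have : ∀ l ∈ F, (starRingEnd ℂ) (f k) * f l * ip B (ann k ψ) (ann l ψ) +
        (starRingEnd ℂ) (f k) * f l * ip B (cre l ψ) (cre k ψ) =
        if k = l then (starRingEnd ℂ) (f k) * f l * ((nrm B ψ ^ 2 : ℝ) : ℂ) else 0 := by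
      intro l hl
      rw [← mul_add, ip_ann_ann_add (hF hk) (hF hl), mul_ite, mul_zero]
    rw [sum_congr rfl this, sum_ite_eq, if_pos hk, ← Complex.normSq_eq_conj_mul_self,
      Complex.normSq_eq_norm_sq]
  rw [ip_self, ip_self] at key
  exact_mod_cast key

/-- Dropping the nonnegative creation term from the preceding identity gives a bound independent of
the particle number, the gain from fermionic statistics. -/
lemma nrm_ann_le {B F : Finset Mode} (hF : F ⊆ B) (f : Mode → ℂ) (ψ : Amplitude) :
    nrm B (∑ k ∈ F, f k • ann k ψ) ≤ √(∑ k ∈ F, ‖f k‖ ^ 2) * nrm B ψ := by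
  have h := nrm_sq_ann_add_nrm_sq_cre hF f ψ
  refine le_of_sq_le_sq ?_ (mul_nonneg (Real.sqrt_nonneg _) (nrm_nonneg _ _))
  rw [mul_pow, Real.sq_sqrt (sum_nonneg fun _ _ => by positivity)]
  nlinarith [sq_nonneg (nrm B (∑ k ∈ F, (starRingEnd ℂ) (f k) • cre k ψ))]

lemma nrm_cre_le {B F : Finset Mode} (hF : F ⊆ B) (f : Mode → ℂ) (ψ : Amplitude) :
    nrm B (∑ k ∈ F, f k • cre k ψ) ≤ √(∑ k ∈ F, ‖f k‖ ^ 2) * nrm B ψ := by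
  have h := nrm_sq_ann_add_nrm_sq_cre hF (fun k => (starRingEnd ℂ) (f k)) ψ
  simp only [Complex.conj_conj, RCLike.norm_conj] at h
  refine le_of_sq_le_sq ?_ (mul_nonneg (Real.sqrt_nonneg _) (nrm_nonneg _ _))
  rw [mul_pow, Real.sq_sqrt (sum_nonneg fun _ _ => by positivity)]
  nlinarith [sq_nonneg (nrm B (∑ k ∈ F, (starRingEnd ℂ) (f k) • ann k ψ))]

/-- A multiplication operator bounded by `c` has norm at most `c`. -/
lemma nrm_mul_le {B : Finset Mode} {c : ℝ} (hc : 0 ≤ c) {m : Finset Mode → ℂ} {ψ : Amplitude}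
    (h : ∀ S ∈ B.powerset, ψ S ≠ 0 → ‖m S‖ ≤ c) : nrm B (fun S => m S * ψ S) ≤ c * nrm B ψ := by
  refine le_of_sq_le_sq ?_ (mul_nonneg hc (nrm_nonneg _ _))
  rw [mul_pow, nrm_sq, nrm_sq, mul_sum]
  refine sum_le_sum fun S hS => ?_
  by_cases h0 : ψ S = 0
  · simp [h0]
  · rw [norm_mul, mul_pow]
    gcongr
    exact h S hS h0

end

noncomputable section

open MeasureTheory ProbabilityTheory Set

/-! ### Laplace and Fourier representation of the resolvents -/

lemma integrableOn_exp_neg_mul {D : ℝ} (hD : 0 < D) :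
    IntegrableOn (fun t : ℝ => Real.exp (-(t * D))) (Ioi 0) := by
  have := integrableOn_exp_mul_Ioi (a := -D) (by linarith) 0
  refine this.congr_fun (fun t _ => ?_) measurableSet_Ioi
  simp only; congr 1; ring

lemma integral_exp_neg_mul {D : ℝ} (hD : 0 < D) :
    ∫ t : ℝ in Ioi 0, Real.exp (-(t * D)) = 1 / D := by
  have := integral_exp_mul_Ioi (a := -D) (by linarith) 0
  rw [mul_zero, Real.exp_zero, neg_div_neg_eq] at this
  rw [← this]
  refine setIntegral_congr_fun measurableSet_Ioi fun t _ => ?_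
  congr 1; ring

lemma integrableOn_rpow_neg_half_mul_exp {a : ℝ} (ha : 0 < a) :
    IntegrableOn (fun t : ℝ => t ^ (-(1 / 2) : ℝ) * Real.exp (-(t * a))) (Ioi 0) := by
  have := integrableOn_rpow_mul_exp_neg_mul_rpow (p := 1) (s := -(1/2)) (b := a) (by norm_num)
    (by norm_num) ha
  refine this.congr_fun (fun t _ => ?_) measurableSet_Ioi
  simp only [Real.rpow_one]; congr 2; ring

lemma integral_rpow_neg_half_mul_exp {a : ℝ} (ha : 0 < a) :
    ∫ t : ℝ in Ioi 0, t ^ (-(1 / 2) : ℝ) * Real.exp (-(t * a)) = √(Real.pi / a) := by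
  have := Real.integral_rpow_mul_exp_neg_mul_Ioi (a := 1 / 2) (r := a) (by norm_num) ha
  rw [Real.Gamma_one_half_eq] at this
  rw [show (1 / 2 - 1 : ℝ) = -(1 / 2) by norm_num] at this
  calc _ = ∫ t : ℝ in Ioi 0, t ^ (-(1 / 2) : ℝ) * Real.exp (-(a * t)) := by simp only [mul_comm a]
    _ = _ := by
      rw [this, ← Real.sqrt_eq_rpow, ← Real.sqrt_mul (by positivity)]; congr 1; ring

/-- The Gaussian as an average of plane waves. -/
lemma exp_neg_mul_norm_sq_eq_integral {s : ℝ} (hs : 0 ≤ s) (v : EuclideanSpace ℝ (Fin 2)) :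
    Complex.exp ((-(s * ‖v‖ ^ 2) : ℝ) : ℂ) =
      ∫ y, Complex.exp ((inner ℝ (√(2 * s) • y) v : ℝ) * Complex.I)
        ∂(stdGaussian (EuclideanSpace ℝ (Fin 2))) := by
  -- The characteristic function at w is e^{-‖w‖²/2}, so w = √(2s) v produces e^{-s‖v‖²}.
  have h := charFun_stdGaussian (E := EuclideanSpace ℝ (Fin 2)) (√(2 * s) • v)
  rw [charFun_apply] at h
  simp only [real_inner_smul_left, real_inner_smul_right] at h ⊢
  rw [h, norm_smul, Real.norm_eq_abs, abs_of_nonneg (Real.sqrt_nonneg _)]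
  rw [← Complex.ofReal_pow, mul_pow, Real.sq_sqrt (by positivity)]
  congr 1
  push_cast; ring

/-- The Laplace integral in t and the Gaussian average in y replace each resolvent by a plane wave
times an exponential, both multiplicative in sums of momenta and energies. A bound uniform in y
survives averaging against a probability measure, and only the integral over t remains. -/
lemma norm_sum_mul_inv_le {ι : Type*} (s : Finset ι) (c : ι → ℂ)
    (v : ι → EuclideanSpace ℝ (Fin 2)) (b : ι → ℝ) (hb : ∀ i ∈ s, 0 < b i) {M : ℝ} (hM : 0 < M)
    {g : ℝ → ℝ} (hg : IntegrableOn g (Ioi 0))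
    (h : ∀ t > 0, ∀ y : EuclideanSpace ℝ (Fin 2),
      ‖∑ i ∈ s, c i * (Complex.exp ((inner ℝ y (v i) : ℝ) * Complex.I) *
        (Real.exp (-(t * b i)) : ℂ))‖ ≤ g t) :
    ‖∑ i ∈ s, c i * ((1 / (1 / M * ‖v i‖ ^ 2 + b i) : ℝ) : ℂ)‖ ≤ ∫ t in Ioi 0, g t := by
  have hD : ∀ i ∈ s, 0 < 1 / M * ‖v i‖ ^ 2 + b i := fun i hi => by
    have := hb i hi; positivity
  have e1 : ∑ i ∈ s, c i * ((1 / (1 / M * ‖v i‖ ^ 2 + b i) : ℝ) : ℂ) =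
      ∫ t in Ioi (0 : ℝ), ∑ i ∈ s, c i *
        ((Real.exp (-(t * (1 / M * ‖v i‖ ^ 2 + b i))) : ℝ) : ℂ) := by
    rw [integral_finsetSum]
    · refine Finset.sum_congr rfl fun i hi => ?_
      rw [integral_const_mul, ← integral_exp_neg_mul (hD i hi)]
      congr 1
      exact integral_ofReal.symm
    · intro i hi
      exact ((integrableOn_exp_neg_mul (hD i hi)).ofReal).const_mul _
  rw [e1]
  refine norm_integral_le_of_norm_le hg ((ae_restrict_iff' measurableSet_Ioi).2 (.of_forall ?_))
  intro t ht
  have ht : 0 < t := ht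
  have hs : 0 ≤ t / M := by positivity
  have hint : ∀ w : EuclideanSpace ℝ (Fin 2), Integrable
      (fun y => Complex.exp ((inner ℝ (√(2 * (t / M)) • y) w : ℝ) * Complex.I))
        (stdGaussian (EuclideanSpace ℝ (Fin 2))) := by
    intro w
    refine Integrable.of_bound (C := 1) (by fun_prop) (.of_forall fun y => ?_)
    rw [Complex.norm_exp_ofReal_mul_I]
  have e2 : ∑ i ∈ s, c i * ((Real.exp (-(t * (1 / M * ‖v i‖ ^ 2 + b i))) : ℝ) : ℂ) =
      ∫ y, ∑ i ∈ s, c i *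
        (Complex.exp ((inner ℝ (√(2 * (t / M)) • y) (v i) : ℝ) * Complex.I) *
          (Real.exp (-(t * b i)) : ℂ)) ∂(stdGaussian (EuclideanSpace ℝ (Fin 2))) := by
    rw [integral_finsetSum]
    · refine Finset.sum_congr rfl fun i hi => ?_
      rw [integral_const_mul, integral_mul_const, ← exp_neg_mul_norm_sq_eq_integral hs,
        Complex.ofReal_exp, Complex.ofReal_exp, ← Complex.exp_add]
      congr 2
      push_cast; field_simp; ring
    · intro i _
      exact ((hint _).mul_const _).const_mul _
  rw [e2]
  refine (norm_integral_le_of_norm_le_const (C := g t) (.of_forall fun y => ?_)).trans ?_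
  · exact h t ht _
  · simp

end

noncomputable section

open MeasureTheory Set

/-! ### Counting lattice momenta -/

lemma kinetic_eq (L : ℝ) (n : Mode) :
    kinetic L n = (2 * Real.pi / L) ^ 2 * ((n.1 : ℝ) ^ 2 + (n.2 : ℝ) ^ 2) := by
  rw [kinetic, EuclideanSpace.norm_sq_eq, Fin.sum_univ_two]
  simp only [momentum, Real.norm_eq_abs, sq_abs]
  simp [mul_pow]; ring

lemma kinetic_nonneg (L : ℝ) (n : Mode) : 0 ≤ kinetic L n := by rw [kinetic]; positivity

lemma card_le_of_pairwise_sub_le {T : Finset ℤ} {D : ℝ} (hD : 0 ≤ D)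
    (h : ∀ a ∈ T, ∀ b ∈ T, (a : ℝ) - b ≤ D) : (T.card : ℝ) ≤ D + 1 := by
  rcases T.eq_empty_or_nonempty with rfl | hT
  · simp; linarith
  · have hsub : T ⊆ Finset.Icc (T.min' hT) (T.min' hT + ⌊D⌋) := by
      intro a ha
      rw [Finset.mem_Icc]
      refine ⟨T.min'_le a ha, ?_⟩
      have : a - T.min' hT ≤ ⌊D⌋ := by
        rw [Int.le_floor]; push_cast; exact h a ha _ (T.min'_mem hT)
      linarith
    have h1 := Finset.card_le_card hsub
    rw [Int.card_Icc] at h1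
    have h2 : ((T.min' hT + ⌊D⌋ + 1 - T.min' hT).toNat : ℤ) = ⌊D⌋ + 1 := by
      rw [Int.toNat_of_nonneg] <;> [ring; (have := Int.floor_nonneg.2 hD; linarith)]
    have h3 : (T.card : ℤ) ≤ ⌊D⌋ + 1 := by rw [← h2]; exact_mod_cast h1
    have h4 : (T.card : ℝ) ≤ (⌊D⌋ : ℝ) + 1 := by exact_mod_cast h3
    linarith [Int.floor_le D]

lemma abs_le_sqrt_of_sq_le {a : ℤ} {r : ℝ} (h : (a : ℝ) ^ 2 ≤ r) :
    -√r ≤ (a : ℝ) ∧ (a : ℝ) ≤ √r := abs_le.1 (Real.abs_le_sqrt h)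

lemma card_le_box {F : Finset Mode} {r : ℝ}
    (h : ∀ n ∈ F, (n.1 : ℝ) ^ 2 + (n.2 : ℝ) ^ 2 ≤ r) : (F.card : ℝ) ≤ (2 * √r + 1) ^ 2 := by
  have h1 : F ⊆ F.image Prod.fst ×ˢ F.image Prod.snd := fun n hn => by
    simp only [Finset.mem_product, Finset.mem_image]
    exact ⟨⟨n, hn, rfl⟩, ⟨n, hn, rfl⟩⟩
  have h2 := Finset.card_le_card h1
  rw [Finset.card_product] at h2
  have hs : 0 ≤ 2 * √r := by positivity
  have h3 : ((F.image Prod.fst).card : ℝ) ≤ 2 * √r + 1 := by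
    refine card_le_of_pairwise_sub_le hs fun a ha b hb => ?_
    simp only [Finset.mem_image] at ha hb
    obtain ⟨m, hm, rfl⟩ := ha
    obtain ⟨m', hm', rfl⟩ := hb
    have e1 := abs_le_sqrt_of_sq_le (a := m.1) (r := r) (by nlinarith [h m hm])
    have e2 := abs_le_sqrt_of_sq_le (a := m'.1) (r := r) (by nlinarith [h m' hm'])
    linarith [e1.2, e2.1]
  have h4 : ((F.image Prod.snd).card : ℝ) ≤ 2 * √r + 1 := by
    refine card_le_of_pairwise_sub_le hs fun a ha b hb => ?_
    simp only [Finset.mem_image] at ha hb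
    obtain ⟨m, hm, rfl⟩ := ha
    obtain ⟨m', hm', rfl⟩ := hb
    have e1 := abs_le_sqrt_of_sq_le (a := m.2) (r := r) (by nlinarith [h m hm])
    have e2 := abs_le_sqrt_of_sq_le (a := m'.2) (r := r) (by nlinarith [h m' hm'])
    linarith [e1.2, e2.1]
  calc (F.card : ℝ) ≤ ((F.image Prod.fst).card : ℝ) * ((F.image Prod.snd).card : ℝ) := by
        exact_mod_cast h2
    _ ≤ (2 * √r + 1) * (2 * √r + 1) := by gcongr
    _ = _ := by ring

/-- The part of a thin annulus where the first coordinate dominates. -/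
lemma card_annulus_sector_le {F : Finset Mode} {ρ σ : ℝ} (hρ : 1 ≤ ρ) (hσ : 0 ≤ σ) (hσρ : σ ≤ ρ)
    (h : ∀ n ∈ F, ρ < (n.1 : ℝ) ^ 2 + (n.2 : ℝ) ^ 2 ∧ (n.1 : ℝ) ^ 2 + (n.2 : ℝ) ^ 2 ≤ ρ + σ)
    (h' : ∀ n ∈ F, (n.2 : ℝ) ^ 2 ≤ (n.1 : ℝ) ^ 2) : (F.card : ℝ) ≤ 6 * (σ + √ρ) := by
  have hr : 1 ≤ √ρ := Real.one_le_sqrt.2 hρ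
  have hrr : √ρ ^ 2 = ρ := Real.sq_sqrt (by linarith)
  have hD : 0 ≤ σ / √ρ := by positivity
  -- Within a fibre of f the squares of the first coordinates differ by at most σ, while the equal
  -- signs force |n₁ + n₁'| ≥ √ρ; so the first coordinates spread over at most σ/√ρ. The image is
  -- small because 2n₂² ≤ ρ + σ ≤ 2ρ.
  let f : Mode → ℤ × Bool := fun n => (n.2, decide (0 ≤ n.1))
  have himg : ((F.image f).card : ℝ) ≤ (2 * √ρ + 1) * 2 := by
    have h1 : F.image f ⊆ F.image Prod.snd ×ˢ (Finset.univ : Finset Bool) := by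
      intro x hx
      obtain ⟨n, hn, rfl⟩ := Finset.mem_image.1 hx
      simp only [Finset.mem_product, Finset.mem_univ, and_true]
      exact Finset.mem_image_of_mem _ hn
    have h2 := Finset.card_le_card h1
    rw [Finset.card_product] at h2
    have h4 : ((F.image Prod.snd).card : ℝ) ≤ 2 * √ρ + 1 := by
      refine card_le_of_pairwise_sub_le (by positivity) fun a ha b hb => ?_
      simp only [Finset.mem_image] at ha hb
      obtain ⟨m, hm, rfl⟩ := ha
      obtain ⟨m', hm', rfl⟩ := hb
      have e1 := abs_le_sqrt_of_sq_le (a := m.2) (r := ρ) (by linarith [(h m hm).2, h' m hm])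
      have e2 := abs_le_sqrt_of_sq_le (a := m'.2) (r := ρ) (by linarith [(h m' hm').2, h' m' hm'])
      linarith [e1.2, e2.1]
    calc ((F.image f).card : ℝ) ≤ ((F.image Prod.snd).card : ℝ) * 2 := by
          simpa using (by exact_mod_cast h2 :
            ((F.image f).card : ℝ) ≤ ((F.image Prod.snd).card : ℝ) * (Finset.univ : Finset Bool).card)
      _ ≤ _ := by gcongr
  have hfib : ∀ b ∈ F.image f, (F.filter fun n => f n = b).card ≤ ⌊σ / √ρ + 1⌋₊ := by
    rintro ⟨j, c⟩ _
    rw [Nat.le_floor_iff (by positivity)]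
    have hinj : Set.InjOn Prod.fst (F.filter fun n => f n = (j, c) : Set Mode) := by
      intro m hm m' hm' hmm
      simp only [Finset.coe_filter, mem_ofPred_eq, f, Prod.mk.injEq] at hm hm'
      exact Prod.ext hmm (hm.2.1.trans hm'.2.1.symm)
    rw [← Finset.card_image_of_injOn hinj]
    refine card_le_of_pairwise_sub_le hD fun a ha b hb => ?_
    simp only [Finset.mem_image, Finset.mem_filter, f, Prod.mk.injEq] at ha hb
    obtain ⟨m, ⟨hm, hm2, hmc⟩, rfl⟩ := ha
    obtain ⟨m', ⟨hm', hm2', hmc'⟩, rfl⟩ := hb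
    have hmm : (m.2 : ℝ) = m'.2 := by rw [hm2, hm2']
    have a1 := h m hm
    have a2 := h m' hm'
    have b1 := h' m hm
    have b2 := h' m' hm'
    rw [le_div_iff₀ (by linarith)]
    rw [hmm] at a1 b1
    have key : ((m.1 : ℝ) - m'.1) * (m.1 + m'.1) ≤ σ ∧ ((m'.1 : ℝ) - m.1) * (m.1 + m'.1) ≤ σ := by
      constructor <;> nlinarith
    by_cases hc : 0 ≤ m.1
    · have hc' : 0 ≤ m'.1 := by
        have : decide (0 ≤ m.1) = decide (0 ≤ m'.1) := hmc.trans hmc'.symm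
        simpa [hc] using this
      have hc1 : (0 : ℝ) ≤ m.1 := by exact_mod_cast hc
      have hc2 : (0 : ℝ) ≤ m'.1 := by exact_mod_cast hc'
      have hsum : √ρ ≤ m.1 + m'.1 := by
        refine le_of_sq_le_sq ?_ (by linarith)
        rw [hrr]; nlinarith [mul_nonneg hc1 hc2]
      rcases le_total (m.1 : ℝ) m'.1 with hle | hle
      · nlinarith
      · nlinarith [key.1, mul_le_mul_of_nonneg_left hsum (sub_nonneg.2 hle)]
    · have hc' : ¬ 0 ≤ m'.1 := by
        have : decide (0 ≤ m.1) = decide (0 ≤ m'.1) := hmc.trans hmc'.symm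
        simpa [hc] using this
      have hc1 : (m.1 : ℝ) ≤ 0 := by exact_mod_cast (not_le.1 hc).le
      have hc2 : (m'.1 : ℝ) ≤ 0 := by exact_mod_cast (not_le.1 hc').le
      have hsum : √ρ ≤ -(m.1 + m'.1) := by
        refine le_of_sq_le_sq ?_ (by linarith)
        rw [hrr]; nlinarith [mul_nonneg_of_nonpos_of_nonpos hc1 hc2]
      rcases le_total (m.1 : ℝ) m'.1 with hle | hle
      · nlinarith
      · nlinarith [key.2, mul_le_mul_of_nonneg_left hsum (sub_nonneg.2 hle)]
  have h5 := Finset.card_le_mul_card_image F _ hfib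
  have hfl : (⌊σ / √ρ + 1⌋₊ : ℝ) ≤ σ / √ρ + 1 := Nat.floor_le (by positivity)
  calc (F.card : ℝ) ≤ (⌊σ / √ρ + 1⌋₊ : ℝ) * ((F.image f).card : ℝ) := by exact_mod_cast h5
    _ ≤ (σ / √ρ + 1) * ((2 * √ρ + 1) * 2) := by gcongr
    _ ≤ (σ / √ρ + 1) * (6 * √ρ) := mul_le_mul_of_nonneg_left (by linarith) (by positivity)
    _ = 6 * (σ + √ρ) := by field_simp

lemma card_annulus_le {F : Finset Mode} {ρ σ : ℝ} (hρ : 1 ≤ ρ) (hσ : 0 ≤ σ)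
    (h : ∀ n ∈ F, ρ < (n.1 : ℝ) ^ 2 + (n.2 : ℝ) ^ 2 ∧ (n.1 : ℝ) ^ 2 + (n.2 : ℝ) ^ 2 ≤ ρ + σ) :
    (F.card : ℝ) ≤ 18 * (σ + √ρ) := by
  have hr : 1 ≤ √ρ := Real.one_le_sqrt.2 hρ
  rcases le_total σ ρ with hσρ | hσρ
  · let F1 := F.filter fun n => (n.2 : ℝ) ^ 2 ≤ (n.1 : ℝ) ^ 2
    let F2 := (F.filter fun n => ¬ (n.2 : ℝ) ^ 2 ≤ (n.1 : ℝ) ^ 2).image Prod.swap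
    have h1 : (F1.card : ℝ) ≤ 6 * (σ + √ρ) :=
      card_annulus_sector_le hρ hσ hσρ (fun n hn => h n (Finset.mem_filter.1 hn).1)
        fun n hn => (Finset.mem_filter.1 hn).2
    have h2 : (F2.card : ℝ) ≤ 6 * (σ + √ρ) := by
      refine card_annulus_sector_le hρ hσ hσρ ?_ ?_
      · intro n hn
        obtain ⟨m, hm, rfl⟩ := Finset.mem_image.1 hn
        have := h m (Finset.mem_filter.1 hm).1
        simp only [Prod.fst_swap, Prod.snd_swap]
        rwa [add_comm ((m.2 : ℝ) ^ 2)]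
      · intro n hn
        obtain ⟨m, hm, rfl⟩ := Finset.mem_image.1 hn
        exact (not_le.1 (Finset.mem_filter.1 hm).2).le
    rw [Finset.card_image_of_injective _ Prod.swap_injective] at h2
    have h3 := Finset.card_filter_add_card_filter_not (s := F)
      (fun n : Mode => (n.2 : ℝ) ^ 2 ≤ (n.1 : ℝ) ^ 2)
    have h4 := congrArg (Nat.cast : ℕ → ℝ) h3
    rw [Nat.cast_add] at h4
    rw [← h4]
    have : 0 ≤ σ + √ρ := by positivity
    linarith
  -- A thick annulus, σ ≥ ρ, is counted by the enclosing square.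
  · have h1 := card_le_box (F := F) (r := 2 * σ) fun n hn => by linarith [(h n hn).2]
    have h2 : √(2 * σ) ^ 2 = 2 * σ := Real.sq_sqrt (by linarith)
    nlinarith [sq_nonneg (√(2 * σ) - 1), Real.sqrt_nonneg (2 * σ), sq_nonneg (√(2 * σ) - 2)]

/-- Number of momenta in the annulus `μ < k² ≤ μ + s`. -/
lemma card_kinetic_annulus_le {L μ s : ℝ} (hL : 0 < L) (hμ : (2 * Real.pi / L) ^ 2 ≤ μ)
    (hs : 2 * Real.pi / L * √μ ≤ s) {F : Finset Mode}
    (h : ∀ n ∈ F, μ < kinetic L n ∧ kinetic L n ≤ μ + s) :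
    (F.card : ℝ) ≤ L ^ 2 * s := by
  have hπ := Real.pi_gt_three
  set κ := 2 * Real.pi / L with hκ
  have hκ0 : 0 < κ := by positivity
  have hs0 : 0 ≤ s := le_trans (by positivity) hs
  have h1 := card_annulus_le (F := F) (ρ := μ / κ ^ 2) (σ := s / κ ^ 2)
    (by rwa [le_div_iff₀ (by positivity), one_mul]) (by positivity) (fun n hn => by
      have := h n hn
      rw [kinetic_eq, ← hκ] at this
      rw [← add_div, div_lt_iff₀ (by positivity), le_div_iff₀ (by positivity), mul_comm _ (κ ^ 2)]
      exact this)
  have h2 : √(μ / κ ^ 2) ≤ s / κ ^ 2 := by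
    rw [Real.sqrt_div' _ (by positivity), Real.sqrt_sq hκ0.le, div_le_div_iff₀ hκ0 (by positivity)]
    nlinarith
  -- The lower bound on s makes the boundary term √ρ at most σ, whence 36 = 2 · 18; it is absorbed
  -- because κ = 2π/L and 2π > 6.
  have h3 : 36 * (s / κ ^ 2) ≤ L ^ 2 * s := by
    rw [hκ, div_pow, div_div_eq_mul_div, mul_div_assoc', div_le_iff₀ (by positivity)]
    have : (36 : ℝ) ≤ (2 * Real.pi) ^ 2 := by nlinarith
    have h4 : 0 ≤ s * L ^ 2 := by positivity
    nlinarith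
  linarith

lemma finite_kinetic_le {L : ℝ} (hL : 0 < L) (s : ℝ) : {n : Mode | kinetic L n ≤ s}.Finite := by
  have hκ0 : 0 < 2 * Real.pi / L := by positivity
  have : {n : Mode | kinetic L n ≤ s} ⊆
      Set.Icc (-⌈√(s / (2 * Real.pi / L) ^ 2)⌉) ⌈√(s / (2 * Real.pi / L) ^ 2)⌉ ×ˢ
        Set.Icc (-⌈√(s / (2 * Real.pi / L) ^ 2)⌉) ⌈√(s / (2 * Real.pi / L) ^ 2)⌉ := by
    intro n hn
    rw [mem_ofPred_eq, kinetic_eq, mul_comm, ← le_div_iff₀ (by positivity)] at hn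
    have e1 := abs_le_sqrt_of_sq_le (a := n.1) ((le_add_of_nonneg_right (sq_nonneg _)).trans hn)
    have e2 := abs_le_sqrt_of_sq_le (a := n.2) ((le_add_of_nonneg_left (sq_nonneg _)).trans hn)
    have hc := Int.le_ceil (√(s / (2 * Real.pi / L) ^ 2))
    refine ⟨⟨?_, ?_⟩, ?_, ?_⟩
    · exact_mod_cast (show (-⌈√(s / (2 * Real.pi / L) ^ 2)⌉ : ℝ) ≤ n.1 by linarith)
    · exact_mod_cast (e1.2.trans hc)
    · exact_mod_cast (show (-⌈√(s / (2 * Real.pi / L) ^ 2)⌉ : ℝ) ≤ n.2 by linarith)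
    · exact_mod_cast (e2.2.trans hc)
  exact ((Set.finite_Icc _ _).prod (Set.finite_Icc _ _)).subset this

/-- The momenta with `k² ≤ s`. -/
def modesBelow (L s : ℝ) : Finset Mode :=
  if hL : 0 < L then (finite_kinetic_le hL s).toFinset else ∅

lemma mem_modesBelow {L : ℝ} (hL : 0 < L) {s : ℝ} {n : Mode} :
    n ∈ modesBelow L s ↔ kinetic L n ≤ s := by simp [modesBelow, hL]

lemma card_kinetic_le {L s : ℝ} (hL : 0 < L) (hs : 0 ≤ s) {F : Finset Mode}
    (h : ∀ n ∈ F, kinetic L n ≤ s) : (F.card : ℝ) ≤ L ^ 2 * s + 2 := by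
  have hπ := Real.pi_gt_three
  set κ := 2 * Real.pi / L with hκ
  have hκ0 : 0 < κ := by positivity
  have h1 := card_le_box (F := F) (r := s / κ ^ 2) fun n hn => by
    have := h n hn
    rw [kinetic_eq, ← hκ] at this
    rw [le_div_iff₀ (by positivity), mul_comm _ (κ ^ 2)]
    exact this
  have h2 : √(s / κ ^ 2) ^ 2 = s / κ ^ 2 := Real.sq_sqrt (by positivity)
  have h3 : 8 * (s / κ ^ 2) ≤ L ^ 2 * s := by
    rw [hκ, div_pow, div_div_eq_mul_div, mul_div_assoc', div_le_iff₀ (by positivity)]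
    have : (8 : ℝ) ≤ (2 * Real.pi) ^ 2 := by nlinarith
    have h4 : 0 ≤ s * L ^ 2 := by positivity
    nlinarith
  nlinarith [sq_nonneg (2 * √(s / κ ^ 2) - 1)]

lemma le_card_modesBelow {L s : ℝ} (hL : 0 < L) (hs : 0 ≤ s) :
    L ^ 2 * s / 80 ≤ ((modesBelow L s).card : ℝ) := by
  have hπ0 := Real.pi_gt_three
  have hπ := Real.pi_lt_d2
  set κ := 2 * Real.pi / L with hκ
  have hκ0 : 0 < κ := by positivity
  -- With r = s/κ², the square |n₁|, |n₂| ≤ m lies in the disc since 2m² ≤ r, and it has (2m+1)² ≥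
  -- r/2 points. The constant 80 bounds 2(2π)².
  set m : ℕ := ⌊√(s / κ ^ 2 / 2)⌋₊ with hm
  have hsub : Finset.Icc (-(m : ℤ)) m ×ˢ Finset.Icc (-(m : ℤ)) m ⊆ modesBelow L s := by
    intro n hn
    simp only [Finset.mem_product, Finset.mem_Icc] at hn
    rw [mem_modesBelow hL, kinetic_eq, ← hκ, mul_comm, ← le_div_iff₀ (by positivity)]
    have hm1 : (m : ℝ) ≤ √(s / κ ^ 2 / 2) := Nat.floor_le (Real.sqrt_nonneg _)
    have hm2 : (m : ℝ) ^ 2 ≤ s / κ ^ 2 / 2 := by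
      rw [← Real.sq_sqrt (show 0 ≤ s / κ ^ 2 / 2 by positivity)]
      gcongr
    have e1 : (n.1 : ℝ) ^ 2 ≤ (m : ℝ) ^ 2 := by
      exact_mod_cast sq_le_sq' hn.1.1 hn.1.2
    have e2 : (n.2 : ℝ) ^ 2 ≤ (m : ℝ) ^ 2 := by
      exact_mod_cast sq_le_sq' hn.2.1 hn.2.2
    linarith
  have h1 := Finset.card_le_card hsub
  rw [Finset.card_product, Int.card_Icc] at h1
  have h2 : ((m : ℤ) + 1 - -(m : ℤ)).toNat = 2 * m + 1 := by omega
  rw [h2] at h1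
  have h3 : √(s / κ ^ 2 / 2) ≤ 2 * m + 1 := by
    have := Nat.lt_floor_add_one (√(s / κ ^ 2 / 2))
    rw [← hm] at this
    have h0 : (0 : ℝ) ≤ m := by positivity
    linarith
  have h4 : s / κ ^ 2 / 2 ≤ (2 * m + 1) ^ 2 := by
    rw [← Real.sq_sqrt (show 0 ≤ s / κ ^ 2 / 2 by positivity)]
    gcongr
  have h5 : L ^ 2 * s / 80 ≤ s / κ ^ 2 / 2 := by
    rw [hκ, div_pow, div_div_eq_mul_div, div_div, div_le_div_iff₀ (by positivity) (by positivity)]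
    have : (2 * Real.pi) ^ 2 * 2 ≤ 80 := by nlinarith
    have h4 : 0 ≤ s * L ^ 2 := by positivity
    nlinarith
  have h6 : ((2 * m + 1 : ℝ)) ^ 2 ≤ ((modesBelow L s).card : ℝ) := by
    rw [sq]; exact_mod_cast h1
  linarith

/-! ### Sums over lattice momenta -/

/-- Summation by layers. -/
lemma sum_integral_inter_Ioi {ι : Type*} (F : Finset ι) (y : ι → ℝ) (I : Set ℝ)
    {w : ℝ → ℝ} (hw : IntegrableOn w I) :
    IntegrableOn (fun s => ((F.filter fun k => y k < s).card : ℝ) * w s) I ∧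
    ∑ k ∈ F, ∫ s in I ∩ Ioi (y k), w s =
      ∫ s in I, ((F.filter fun k => y k < s).card : ℝ) * w s := by
  have e : (fun s => ((F.filter fun k => y k < s).card : ℝ) * w s) =
      fun s => ∑ k ∈ F, (Ioi (y k)).indicator w s := by
    funext s
    simp only [indicator, mem_Ioi]
    rw [Finset.sum_ite, Finset.sum_const_zero, add_zero, Finset.sum_const, nsmul_eq_mul]
  have hi : ∀ k ∈ F, IntegrableOn ((Ioi (y k)).indicator w) I := fun k _ =>
    hw.indicator measurableSet_Ioi
  rw [e]
  refine ⟨integrable_finsetSum _ hi, ?_⟩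
  rw [integral_finsetSum _ hi]
  exact Finset.sum_congr rfl fun k _ => (setIntegral_indicator measurableSet_Ioi).symm

/-- Upper bound by layers, for points beyond `d`. -/
lemma sum_integral_Ioi_le {ι : Type*} (F : Finset ι) (y : ι → ℝ) {d A : ℝ}
    (hy : ∀ k ∈ F, d ≤ y k) (hcard : ∀ s > d, ((F.filter fun k => y k < s).card : ℝ) ≤ A * s)
    {w W : ℝ → ℝ} (hw : IntegrableOn w (Ioi d)) (hw0 : ∀ s > d, 0 ≤ w s)
    (hW : IntegrableOn W (Ioi d)) (hwW : ∀ s > d, A * s * w s ≤ W s) :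
    ∑ k ∈ F, ∫ s in Ioi (y k), w s ≤ ∫ s in Ioi d, W s := by
  obtain ⟨h1, h2⟩ := sum_integral_inter_Ioi F y (Ioi d) hw
  have h3 : ∑ k ∈ F, ∫ s in Ioi (y k), w s = ∑ k ∈ F, ∫ s in Ioi d ∩ Ioi (y k), w s :=
    Finset.sum_congr rfl fun k hk => by
      rw [inter_eq_right.2 (Ioi_subset_Ioi (hy k hk))]
  rw [h3, h2]
  refine setIntegral_mono_on h1 hW measurableSet_Ioi fun s hs => ?_
  exact (mul_le_mul_of_nonneg_right (hcard s hs) (hw0 s hs)).trans (hwW s hs)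

lemma integral_Ioi_exp_neg_mul {D : ℝ} (hD : 0 < D) (x : ℝ) :
    IntegrableOn (fun s : ℝ => Real.exp (-(D * s))) (Ioi x) ∧
    ∫ s : ℝ in Ioi x, Real.exp (-(D * s)) = Real.exp (-(D * x)) / D := by
  have h1 := integrableOn_exp_mul_Ioi (a := -D) (by linarith) x
  have h2 := integral_exp_mul_Ioi (a := -D) (by linarith) x
  simp only [neg_mul] at h1 h2
  exact ⟨h1, by rw [h2, neg_div_neg_eq]⟩

/-- Summation by layers with weight 2t e^{-2ts}. The factor s from the linear count is absorbed by
ts e^{-ts} ≤ 1, at the price of half the decay rate. -/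
lemma sum_exp_le {ι : Type*} (F : Finset ι) (y : ι → ℝ) {d A t : ℝ} (ht : 0 < t) (hA : 0 ≤ A)
    (hy : ∀ k ∈ F, d ≤ y k) (hcard : ∀ s > d, ((F.filter fun k => y k < s).card : ℝ) ≤ A * s) :
    ∑ k ∈ F, Real.exp (-(2 * t * y k)) ≤ 2 * A / t * Real.exp (-(t * d)) := by
  have h := sum_integral_Ioi_le F y hy hcard (w := fun s => 2 * t * Real.exp (-(2 * t * s)))
    (W := fun s => 2 * A * Real.exp (-(t * s)))
    ((integral_Ioi_exp_neg_mul (by positivity) d).1.const_mul _) (fun s _ => by positivity)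
    ((integral_Ioi_exp_neg_mul ht d).1.const_mul _) (fun s _ => by
      have h1 : t * s ≤ Real.exp (t * s) := by linarith [Real.add_one_le_exp (t * s)]
      have h2 : Real.exp (-(2 * t * s)) = Real.exp (-(t * s)) * Real.exp (-(t * s)) := by
        rw [← Real.exp_add]; ring_nf
      have h3 : t * s * Real.exp (-(t * s)) ≤ 1 := by
        calc _ ≤ Real.exp (t * s) * Real.exp (-(t * s)) := by gcongr
          _ = 1 := by rw [← Real.exp_add]; simp
      calc A * s * (2 * t * Real.exp (-(2 * t * s)))
          = 2 * A * Real.exp (-(t * s)) * (t * s * Real.exp (-(t * s))) := by rw [h2]; ring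
        _ ≤ 2 * A * Real.exp (-(t * s)) * 1 := by gcongr
        _ = _ := by ring)
  rw [integral_const_mul, (integral_Ioi_exp_neg_mul ht d).2] at h
  have e : ∀ k, ∫ s in Ioi (y k), 2 * t * Real.exp (-(2 * t * s)) = Real.exp (-(2 * t * y k)) := by
    intro k
    rw [integral_const_mul, (integral_Ioi_exp_neg_mul (by positivity) (y k)).2]
    field_simp
  simp only [e] at h
  refine h.trans (le_of_eq ?_)
  ring

/-- The same with weight (3/2) s^{-5/2}. It serves the tail of `G`, whose terms decay like |k|⁻³. -/
lemma sum_rpow_le {ι : Type*} (F : Finset ι) (y : ι → ℝ) {d A : ℝ} (hd : 0 < d)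
    (hy : ∀ k ∈ F, d ≤ y k) (hcard : ∀ s > d, ((F.filter fun k => y k < s).card : ℝ) ≤ A * s) :
    ∑ k ∈ F, (y k) ^ (-(3 / 2) : ℝ) ≤ 3 * A * d ^ (-(1 / 2) : ℝ) := by
  have i1 : ∀ x : ℝ, 0 < x → ∫ s in Ioi x, (3 / 2 : ℝ) * s ^ (-(5 / 2) : ℝ) =
      x ^ (-(3 / 2) : ℝ) := by
    intro x hx
    rw [integral_const_mul, integral_Ioi_rpow_of_lt (by norm_num) hx]
    norm_num
    ring
  have h := sum_integral_Ioi_le F y hy hcard (w := fun s => (3 / 2 : ℝ) * s ^ (-(5 / 2) : ℝ))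
    (W := fun s => 3 / 2 * A * s ^ (-(3 / 2) : ℝ))
    ((integrableOn_Ioi_rpow_of_lt (by norm_num) hd).const_mul _)
    (fun s hs => by have : 0 < s := hd.trans hs; positivity)
    ((integrableOn_Ioi_rpow_of_lt (by norm_num) hd).const_mul _) (fun s hs => by
      have hs : 0 < s := hd.trans hs
      have : s ^ (-(3 / 2) : ℝ) = s * s ^ (-(5 / 2) : ℝ) := by
        rw [← Real.rpow_one_add' hs.le (by norm_num)]; norm_num
      rw [this]
      exact le_of_eq (by ring))
  rw [Finset.sum_congr rfl fun k hk => i1 (y k) (hd.trans_le (hy k hk)), integral_const_mul,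
    integral_Ioi_rpow_of_lt (by norm_num) hd] at h
  refine h.trans (le_of_eq ?_)
  norm_num
  ring

end

/-! ### Resolvent sums: two-scale and logarithmic bounds -/

noncomputable section

open MeasureTheory Set

/-- Terms with x ≤ s are at most 1/E, the others at most 1/s. Counting is needed at the scale s and
for the whole set only, so s can be kept above the lattice scale and chosen to balance s/E against
D/s. -/
lemma sum_inv_add_le {ι : Type*} (F : Finset ι) (x : ι → ℝ) {A D s E : ℝ} (hE : 0 < E)
    (hs : 0 < s) (hx : ∀ k ∈ F, 0 < x k) (hF : (F.card : ℝ) ≤ A * D)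
    (hcard : ((F.filter fun k => x k ≤ s).card : ℝ) ≤ A * s) :
    ∑ k ∈ F, 1 / (E + x k) ≤ A * (s / E + D / s) := by
  rw [← Finset.sum_filter_add_sum_filter_not F (fun k => x k ≤ s)]
  have h1 : ∑ k ∈ F.filter (fun k => x k ≤ s), 1 / (E + x k) ≤ A * s * (1 / E) := by
    refine (Finset.sum_le_card_nsmul _ _ (1 / E) fun k hk => ?_).trans ?_
    · exact one_div_le_one_div_of_le hE (by linarith [hx k (Finset.mem_filter.1 hk).1])
    · rw [nsmul_eq_mul]; gcongr
  have h2 : ∑ k ∈ F.filter (fun k => ¬ x k ≤ s), 1 / (E + x k) ≤ A * D * (1 / s) := by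
    refine (Finset.sum_le_card_nsmul _ _ (1 / s) fun k hk => ?_).trans ?_
    · exact one_div_le_one_div_of_le hs (by linarith [not_le.1 (Finset.mem_filter.1 hk).2])
    · rw [nsmul_eq_mul]
      have h3 : ((F.filter fun k => ¬ x k ≤ s).card : ℝ) ≤ F.card := by
        exact_mod_cast Finset.card_filter_le _ _
      gcongr
      exact h3.trans hF
  calc _ ≤ A * s * (1 / E) + A * D * (1 / s) := add_le_add h1 h2
    _ = _ := by ring

lemma integral_inv_sq {b y z : ℝ} (hb : 0 < b) (hy : 0 ≤ y) (hyz : y ≤ z) :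
    IntegrableOn (fun s : ℝ => 1 / (s + b) ^ 2) (Ioc y z) ∧
    ∫ s in Ioc y z, 1 / (s + b) ^ 2 = 1 / (y + b) - 1 / (z + b) := by
  have hc : ContinuousOn (fun s : ℝ => 1 / (s + b) ^ 2) (uIcc y z) := by
    refine continuousOn_const.div (by fun_prop) fun s hs => ?_
    rw [uIcc_of_le hyz] at hs
    have : 0 < s + b := by linarith [hs.1]
    positivity
  have hi := hc.intervalIntegrable (μ := volume)
  refine ⟨(intervalIntegrable_iff_integrableOn_Ioc_of_le hyz).1 hi, ?_⟩
  rw [← intervalIntegral.integral_of_le hyz,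
    intervalIntegral.integral_eq_sub_of_hasDerivAt (f := fun s => -(1 / (s + b))) _ hi]
  · ring
  · intro s hs
    rw [uIcc_of_le hyz] at hs
    have : s + b ≠ 0 := by linarith [hs.1]
    have h := (((hasDerivAt_id s).add_const b).inv this).neg
    simp only [id, one_div] at h ⊢
    convert! h using 1
    field_simp

lemma integral_inv {b y z : ℝ} (hb : 0 < b) (hy : 0 ≤ y) (hyz : y ≤ z) :
    IntegrableOn (fun s : ℝ => 1 / (s + b)) (Ioc y z) ∧
    ∫ s in Ioc y z, 1 / (s + b) = Real.log (z + b) - Real.log (y + b) := by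
  have hc : ContinuousOn (fun s : ℝ => 1 / (s + b)) (uIcc y z) := by
    refine continuousOn_const.div (by fun_prop) fun s hs => ?_
    rw [uIcc_of_le hyz] at hs
    linarith [hs.1]
  have hi := hc.intervalIntegrable (μ := volume)
  refine ⟨(intervalIntegrable_iff_integrableOn_Ioc_of_le hyz).1 hi, ?_⟩
  rw [← intervalIntegral.integral_of_le hyz,
    intervalIntegral.integral_eq_sub_of_hasDerivAt (f := fun s => Real.log (s + b)) _ hi]
  intro s hs
  rw [uIcc_of_le hyz] at hs
  exact ((hasDerivAt_id s).add_const b).log (by simp only [id]; linarith [hs.1])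

/-- Logarithmic lower bound for the sum of `1 / (k² + b)` over the Fermi sea. -/
lemma le_sum_inv_kinetic_add {L μ b : ℝ} (hL : 0 < L) (hb : 0 < b) (hbμ : b ≤ μ) :
    L ^ 2 / 640 * Real.log (μ / b) ≤ ∑ k ∈ modesBelow L μ, 1 / (kinetic L k + b) := by
  obtain ⟨h1, h2⟩ := sum_integral_inter_Ioi (modesBelow L μ) (kinetic L) (Ioc b μ)
    (integral_inv_sq hb hb.le hbμ).1
  have h3 : ∑ k ∈ modesBelow L μ, ∫ s in Ioc b μ ∩ Ioi (kinetic L k), 1 / (s + b) ^ 2 ≤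
      ∑ k ∈ modesBelow L μ, 1 / (kinetic L k + b) := by
    refine Finset.sum_le_sum fun k hk => ?_
    have hk := (mem_modesBelow hL).1 hk
    have h0 := kinetic_nonneg L k
    have e : Ioc b μ ∩ Ioi (kinetic L k) = Ioc (max b (kinetic L k)) μ := by
      ext s; simp only [mem_inter_iff, mem_Ioc, mem_Ioi, max_lt_iff]; tauto
    rw [e, (integral_inv_sq hb (hb.le.trans (le_max_left _ _)) (max_le hbμ hk)).2]
    have : 1 / (max b (kinetic L k) + b) ≤ 1 / (kinetic L k + b) :=
      one_div_le_one_div_of_le (by linarith) (by linarith [le_max_right b (kinetic L k)])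
    have : 0 ≤ 1 / (μ + b) := by have := hb.trans_le hbμ; positivity
    linarith
  refine le_trans ?_ h3
  rw [h2]
  have h4 := integral_inv_sq (b := b) hb hb.le hbμ
  have hc : ContinuousOn (fun s : ℝ => s⁻¹) (uIcc b μ) := by
    refine continuousOn_inv₀.mono fun s hs => ?_
    rw [uIcc_of_le hbμ] at hs
    exact (hb.trans_le hs.1).ne'
  have hi := (intervalIntegrable_iff_integrableOn_Ioc_of_le hbμ).1
    (hc.intervalIntegrable (μ := volume))
  have e5 : L ^ 2 / 640 * Real.log (μ / b) = ∫ s in Ioc b μ, L ^ 2 / 640 * s⁻¹ := by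
    rw [integral_const_mul, ← intervalIntegral.integral_of_le hbμ,
      integral_inv_of_pos hb (hb.trans_le hbμ)]
  rw [e5]
  refine setIntegral_mono_on (hi.const_mul _) h1 measurableSet_Ioc fun s hs => ?_
  have hs0 : 0 < s := hb.trans hs.1
  -- Halving s passes from a non-strict to a strict inequality; with s + b ≤ 2s this gives 640 = 2 ·
  -- 80 · 4.
  have hcard : L ^ 2 * (s / 2) / 80 ≤
      (((modesBelow L μ).filter fun k => kinetic L k < s).card : ℝ) := by
    refine (le_card_modesBelow hL (by positivity)).trans ?_
    refine Nat.cast_le.2 (Finset.card_le_card fun k hk => ?_)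
    rw [mem_modesBelow hL] at hk
    rw [Finset.mem_filter, mem_modesBelow hL]
    exact ⟨by linarith [hs.2], by linarith⟩
  calc L ^ 2 / 640 * s⁻¹ = L ^ 2 * (s / 2) / 80 * (1 / (s + s) ^ 2) := by field_simp; ring
    _ ≤ _ := by
      gcongr
      exact hs.1.le

/-- Logarithmic upper bound for the sum of `1 / (k² + b)`. -/
lemma sum_inv_kinetic_add_le {L z b : ℝ} (hL : 0 < L) (hb : 0 < b) (hz : 0 < z)
    (hLb : 1 ≤ L ^ 2 * b) (hLz : 1 ≤ L ^ 2 * z) :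
    ∑ k ∈ modesBelow L z, 1 / (kinetic L k + b) ≤ L ^ 2 * (5 + Real.log ((z + b) / b)) := by
  have hsq := integral_inv_sq hb le_rfl hz.le
  have hin := integral_inv hb le_rfl hz.le
  obtain ⟨h1, h2⟩ := sum_integral_inter_Ioi (modesBelow L z) (kinetic L) (Ioc 0 z) hsq.1
  have h3 : ∑ k ∈ modesBelow L z, 1 / (kinetic L k + b) =
      ∑ k ∈ modesBelow L z, (∫ s in Ioc 0 z ∩ Ioi (kinetic L k), 1 / (s + b) ^ 2) +
        (modesBelow L z).card * (1 / (z + b)) := by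
    rw [← nsmul_eq_mul, ← Finset.sum_const, ← Finset.sum_add_distrib]
    refine Finset.sum_congr rfl fun k hk => ?_
    have hk := (mem_modesBelow hL).1 hk
    have h0 := kinetic_nonneg L k
    have e : Ioc 0 z ∩ Ioi (kinetic L k) = Ioc (kinetic L k) z := by
      ext s; simp only [mem_inter_iff, mem_Ioc, mem_Ioi]
      exact ⟨fun h => ⟨h.2, h.1.2⟩, fun h => ⟨⟨h0.trans_lt h.1, h.2⟩, h.1⟩⟩
    rw [e, (integral_inv_sq hb h0 hk).2]; ring
  have h4 : ∫ s in Ioc 0 z, (((modesBelow L z).filter fun k => kinetic L k < s).card : ℝ) *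
      (1 / (s + b) ^ 2) ≤ ∫ s in Ioc 0 z, (2 * (1 / (s + b) ^ 2) + L ^ 2 * (1 / (s + b))) := by
    refine setIntegral_mono_on h1 ((hsq.1.const_mul _).add (hin.1.const_mul _)) measurableSet_Ioc
      fun s hs => ?_
    have hs0 : 0 < s := hs.1
    have hcard : (((modesBelow L z).filter fun k => kinetic L k < s).card : ℝ) ≤ L ^ 2 * s + 2 :=
      card_kinetic_le hL hs0.le fun n hn => (Finset.mem_filter.1 hn).2.le
    calc _ ≤ (L ^ 2 * s + 2) * (1 / (s + b) ^ 2) := by gcongr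
      _ ≤ (L ^ 2 * (s + b) + 2) * (1 / (s + b) ^ 2) := by gcongr; linarith
      _ = _ := by field_simp; ring
  rw [integral_add (hsq.1.const_mul _) (hin.1.const_mul _), integral_const_mul,
    integral_const_mul, hsq.2, hin.2, zero_add, ← Real.log_div (by positivity) (by positivity)] at h4
  have h5 : ((modesBelow L z).card : ℝ) * (1 / (z + b)) ≤ 3 * L ^ 2 := by
    have := card_kinetic_le hL hz.le (F := modesBelow L z) fun n hn => (mem_modesBelow hL).1 hn
    calc _ ≤ (L ^ 2 * z + 2) * (1 / z) := by gcongr; linarith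
      _ ≤ (3 * (L ^ 2 * z)) * (1 / z) := by gcongr; linarith
      _ = _ := by field_simp
  have h6 : 1 / b ≤ L ^ 2 := by rwa [div_le_iff₀ hb]
  have h7 : 0 ≤ 1 / (z + b) := by positivity
  rw [h3, h2]
  linarith

end

noncomputable section

open MeasureTheory Set

/-! ### The function `G` -/

/-- The summand in the definition of `G`. -/
def GTerm (M L μ EB : ℝ) (q : EuclideanSpace ℝ (Fin 2)) (τ : ℝ) (k : Mode) : ℝ :=
  1 / ((1 + 1 / M) * kinetic L k - EB) -
    (if μ < kinetic L k then
      1 / (1 / M * ‖q - momentum L k‖ ^ 2 + kinetic L k + τ) else 0)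

lemma G_eq (M L μ EB : ℝ) (q : EuclideanSpace ℝ (Fin 2)) (τ : ℝ) :
    G M L μ EB q τ = 1 / L ^ 2 * ∑' k, GTerm M L μ EB q τ k := rfl

/-- The comparison function for the tail of `G`. -/
def GTail (L μ : ℝ) (k : Mode) : ℝ :=
  if 2 * μ < kinetic L k then kinetic L k ^ (-(3 / 2) : ℝ) else 0

lemma GTail_nonneg (L μ : ℝ) (k : Mode) : 0 ≤ GTail L μ k := by
  have := kinetic_nonneg L k
  unfold GTail; split_ifs <;> positivity

lemma sum_GTail_le {L μ : ℝ} (hL : 0 < L) (hμ : 0 < μ) (hLμ : 1 ≤ L ^ 2 * μ) (F : Finset Mode) :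
    ∑ k ∈ F, GTail L μ k ≤ 6 * L ^ 2 / √μ := by
  simp only [GTail]
  rw [← Finset.sum_filter]
  refine (sum_rpow_le _ (kinetic L) (d := 2 * μ) (A := 2 * L ^ 2) (by positivity)
    (fun k hk => (Finset.mem_filter.1 hk).2.le) fun s hs => ?_).trans ?_
  · have h1 := card_kinetic_le hL (s := s) (by linarith)
      (F := (F.filter fun k => 2 * μ < kinetic L k).filter fun k => kinetic L k < s)
      fun n hn => (Finset.mem_filter.1 hn).2.le
    nlinarith [mul_lt_mul_of_pos_left hs (pow_pos hL 2)]
  · have h1 : (2 * μ) ^ (-(1 / 2) : ℝ) ≤ 1 / √μ := by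
      rw [Real.rpow_neg (by positivity), ← Real.sqrt_eq_rpow, ← one_div]
      exact one_div_le_one_div_of_le (Real.sqrt_pos.2 hμ) (Real.sqrt_le_sqrt (by linarith))
    calc _ ≤ 3 * (2 * L ^ 2) * (1 / √μ) := by gcongr
      _ = _ := by ring

lemma summable_GTail {L μ : ℝ} (hL : 0 < L) (hμ : 0 < μ) (hLμ : 1 ≤ L ^ 2 * μ) :
    Summable (GTail L μ) :=
  summable_of_sum_le (GTail_nonneg L μ) (sum_GTail_le hL hμ hLμ)

lemma tsum_GTail_le {L μ : ℝ} (hL : 0 < L) (hμ : 0 < μ) (hLμ : 1 ≤ L ^ 2 * μ) :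
    ∑' k, GTail L μ k ≤ 6 * L ^ 2 / √μ :=
  Real.tsum_le_of_sum_le (GTail_nonneg L μ) (sum_GTail_le hL hμ hLμ)

/-- Beyond k² = 2μ both denominators are at least k²/2, and they differ only by O(√μ |k|) because
|q| ≤ √μ ≤ |k|. The difference of the fractions is therefore O(√μ |k|⁻³), although neither fraction
is summable alone. -/
lemma abs_GTerm_le {M L μ EB E : ℝ} {q : EuclideanSpace ℝ (Fin 2)} (hM : 0 < M) (hμ : 0 < μ)
    (hEB : EB < 0) (hbμ : -EB ≤ μ) (hq : ‖q‖ ^ 2 ≤ μ) (hE : 0 ≤ E) {k : Mode}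
    (hk : 2 * μ < kinetic L k) :
    |GTerm M L μ EB q (E - ‖q‖ ^ 2) k| ≤
      2 * (3 / M + 2 + E / μ) * √μ * kinetic L k ^ (-(3 / 2) : ℝ) := by
  rw [GTerm, if_pos (by linarith)]
  set r := ‖momentum L k‖ with hr
  have hkr : kinetic L k = r ^ 2 := rfl
  rw [hkr] at hk ⊢
  have hr0 : 0 ≤ r := norm_nonneg _
  have hrp : 0 < r := by
    rcases hr0.lt_or_eq with h | h
    · exact h
    · rw [← h] at hk; norm_num at hk; linarith
  have hsμ : √μ ^ 2 = μ := Real.sq_sqrt hμ.le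
  have hsμ0 : 0 < √μ := Real.sqrt_pos.2 hμ
  have hqμ : ‖q‖ ≤ √μ := Real.le_sqrt_of_sq_le hq
  have hsr : √μ ≤ r := Real.sqrt_le_iff.2 ⟨hr0, by linarith⟩
  have hμr : μ ≤ √μ * r := by nlinarith
  have hq0 := norm_nonneg q
  set D1 := (1 + 1 / M) * r ^ 2 - EB with hD1
  set D2 := 1 / M * ‖q - momentum L k‖ ^ 2 + r ^ 2 + (E - ‖q‖ ^ 2) with hD2
  have hM' : 0 < 1 / M := by positivity
  have h1 : r ^ 2 ≤ D1 := by
    rw [hD1]; have : 0 ≤ 1 / M * r ^ 2 := by positivity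
    linarith
  have h2 : r ^ 2 / 2 ≤ D2 := by
    rw [hD2]; have : 0 ≤ 1 / M * ‖q - momentum L k‖ ^ 2 := by positivity
    linarith
  have h1p : 0 < D1 := lt_of_lt_of_le (by positivity) h1
  have h2p : 0 < D2 := lt_of_lt_of_le (by positivity) h2
  have h3 : |‖q - momentum L k‖ ^ 2 - r ^ 2| ≤ 3 * (√μ * r) := by
    have t1 : ‖q - momentum L k‖ ≤ ‖q‖ + r := norm_sub_le _ _
    have t2 : r - ‖q‖ ≤ ‖q - momentum L k‖ := by
      rw [← norm_neg (q - momentum L k), neg_sub]; exact norm_sub_norm_le _ _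
    rw [abs_le]
    constructor <;> nlinarith [norm_nonneg (q - momentum L k)]
  have h4 : |D2 - D1| ≤ (3 / M + 2 + E / μ) * (√μ * r) := by
    have e : D2 - D1 = 1 / M * (‖q - momentum L k‖ ^ 2 - r ^ 2) + (E - ‖q‖ ^ 2 + EB) := by
      rw [hD1, hD2]; ring
    have t1 : |1 / M * (‖q - momentum L k‖ ^ 2 - r ^ 2)| ≤ 1 / M * (3 * (√μ * r)) := by
      rw [abs_mul, abs_of_pos hM']; gcongr
    have t2 : |E - ‖q‖ ^ 2 + EB| ≤ E + 2 * μ := by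
      rw [abs_le]; constructor <;> nlinarith
    have t3 : E ≤ E / μ * (√μ * r) := by
      calc E = E / μ * μ := by field_simp
        _ ≤ _ := by gcongr
    rw [e]
    refine (abs_add_le _ _).trans ((add_le_add t1 t2).trans ?_)
    have : (3 / M + 2 + E / μ) * (√μ * r) =
      1 / M * (3 * (√μ * r)) + E / μ * (√μ * r) + 2 * (√μ * r) := by ring
    rw [this]; linarith
  have h5 : (r ^ 2) ^ (-(3 / 2) : ℝ) = 1 / r ^ 3 := by
    rw [← Real.rpow_natCast, ← Real.rpow_mul hr0, one_div, ← Real.rpow_natCast, ← Real.rpow_neg hr0]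
    norm_num
  have h6 : 1 / D1 - 1 / D2 = (D2 - D1) / (D1 * D2) := by field_simp
  rw [h5, h6, abs_div, abs_of_pos (mul_pos h1p h2p), div_le_iff₀ (mul_pos h1p h2p)]
  have h7 : r ^ 2 * (r ^ 2 / 2) ≤ D1 * D2 := by gcongr
  have h8 : 0 ≤ 3 / M + 2 + E / μ := by positivity
  calc |D2 - D1| ≤ (3 / M + 2 + E / μ) * (√μ * r) := h4
    _ = 2 * (3 / M + 2 + E / μ) * √μ * (1 / r ^ 3) * (r ^ 2 * (r ^ 2 / 2)) := by
      field_simp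
    _ ≤ _ := by gcongr

/-- The standing assumptions on the parameters. -/
structure Regime (M L μ EB : ℝ) : Prop where
  M_pos : 0 < M
  L_pos : 0 < L
  μ_pos : 0 < μ
  EB_neg : EB < 0
  EB_le : -EB ≤ μ
  one_le : 1 ≤ L ^ 2 * -EB

namespace Regime

variable {M L μ EB : ℝ}

lemma one_le_mul (h : Regime M L μ EB) : 1 ≤ L ^ 2 * μ :=
  h.one_le.trans (mul_le_mul_of_nonneg_left h.EB_le (by positivity))

end Regime

/-- The part of the summand of `G` with `k² > 2μ`. -/
def GHigh (M L μ EB : ℝ) (q : EuclideanSpace ℝ (Fin 2)) (τ : ℝ) (k : Mode) : ℝ :=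
  if 2 * μ < kinetic L k then GTerm M L μ EB q τ k else 0

namespace Regime

variable {M L μ EB : ℝ} {q : EuclideanSpace ℝ (Fin 2)}

lemma abs_GHigh_le (h : Regime M L μ EB) (hq : ‖q‖ ^ 2 ≤ μ) {E R : ℝ} (hE : 0 ≤ E) (hER : E ≤ R)
    (k : Mode) : ‖GHigh M L μ EB q (E - ‖q‖ ^ 2) k‖ ≤
      2 * (3 / M + 2 + R / μ) * √μ * GTail L μ k := by
  have hμ := h.μ_pos
  have h0 := kinetic_nonneg L k
  unfold GHigh GTail
  split_ifs with hk
  · refine (abs_GTerm_le h.M_pos hμ h.EB_neg h.EB_le hq hE hk).trans ?_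
    gcongr
  · simp

lemma summable_tail (h : Regime M L μ EB) (R : ℝ) :
    Summable fun k => 2 * (3 / M + 2 + R / μ) * √μ * GTail L μ k :=
  (summable_GTail h.L_pos h.μ_pos h.one_le_mul).mul_left _

lemma summable_GHigh (h : Regime M L μ EB) (hq : ‖q‖ ^ 2 ≤ μ) {E : ℝ} (hE : 0 ≤ E) :
    Summable (GHigh M L μ EB q (E - ‖q‖ ^ 2)) :=
  Summable.of_norm_bounded (h.summable_tail E) (h.abs_GHigh_le hq hE le_rfl)

lemma abs_tsum_GHigh_le (h : Regime M L μ EB) (hq : ‖q‖ ^ 2 ≤ μ) {E : ℝ} (hE : 0 ≤ E) :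
    |∑' k, GHigh M L μ EB q (E - ‖q‖ ^ 2) k| ≤ 12 * (3 / M + 2 + E / μ) * L ^ 2 := by
  have hμ := h.μ_pos
  have hM := h.M_pos
  have hsμ0 : 0 < √μ := Real.sqrt_pos.2 hμ
  refine (tsum_of_norm_bounded (h.summable_tail E).hasSum
    (h.abs_GHigh_le hq hE le_rfl)).trans ?_
  rw [tsum_mul_left]
  calc _ ≤ 2 * (3 / M + 2 + E / μ) * √μ * (6 * L ^ 2 / √μ) := by
        gcongr; exact tsum_GTail_le h.L_pos hμ h.one_le_mul
    _ = _ := by field_simp; ring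

/-- Without summability the `tsum` defining `G` would be the default value 0; this is what lets the
sum be split and compared termwise. -/
lemma summable_GTerm (h : Regime M L μ EB) (hq : ‖q‖ ^ 2 ≤ μ) {E : ℝ} (hE : 0 ≤ E) :
    Summable (GTerm M L μ EB q (E - ‖q‖ ^ 2)) := by
  have h1 : Summable fun k => GTerm M L μ EB q (E - ‖q‖ ^ 2) k -
      GHigh M L μ EB q (E - ‖q‖ ^ 2) k :=
    summable_of_ne_finset_zero (s := modesBelow L (2 * μ)) fun k hk => by
      rw [mem_modesBelow h.L_pos, not_le] at hk
      rw [GHigh, if_pos hk, sub_self]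
  simpa using h1.add (h.summable_GHigh hq hE)

lemma G_split (h : Regime M L μ EB) (hq : ‖q‖ ^ 2 ≤ μ) {E : ℝ} (hE : 0 ≤ E) :
    G M L μ EB q (E - ‖q‖ ^ 2) = 1 / L ^ 2 *
      (∑ k ∈ modesBelow L (2 * μ), GTerm M L μ EB q (E - ‖q‖ ^ 2) k +
        ∑' k, GHigh M L μ EB q (E - ‖q‖ ^ 2) k) := by
  have h1 : ∑' k, (GTerm M L μ EB q (E - ‖q‖ ^ 2) k - GHigh M L μ EB q (E - ‖q‖ ^ 2) k) =
      ∑ k ∈ modesBelow L (2 * μ), GTerm M L μ EB q (E - ‖q‖ ^ 2) k := by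
    rw [tsum_eq_sum (s := modesBelow L (2 * μ))]
    · refine Finset.sum_congr rfl fun k hk => ?_
      rw [mem_modesBelow h.L_pos] at hk
      rw [GHigh, if_neg (not_lt.2 hk), sub_zero]
    · intro k hk
      rw [mem_modesBelow h.L_pos, not_le] at hk
      rw [GHigh, if_pos hk, sub_self]
  rw [(h.summable_GTerm hq hE).tsum_sub (h.summable_GHigh hq hE)] at h1
  rw [G_eq]
  linear_combination (1 / L ^ 2) * h1

/-- For q in the sea and τ = E - q², the form in which τ enters the polaron equation, denominators
beyond the Fermi surface are positive as soon as E ≥ 0. Monotonicity, continuity and both bounds of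
`G` rest on this. -/
lemma denom_le (h : Regime M L μ EB) (hq : ‖q‖ ^ 2 ≤ μ) (E : ℝ) (k : Mode) :
    E + (kinetic L k - μ) ≤ 1 / M * ‖q - momentum L k‖ ^ 2 + kinetic L k + (E - ‖q‖ ^ 2) := by
  have hM := h.M_pos
  have : 0 ≤ 1 / M * ‖q - momentum L k‖ ^ 2 := by positivity
  linarith

lemma G_mono (h : Regime M L μ EB) (hq : ‖q‖ ^ 2 ≤ μ) {E E' : ℝ} (hE : 0 ≤ E) (hEE : E ≤ E') :
    G M L μ EB q (E - ‖q‖ ^ 2) ≤ G M L μ EB q (E' - ‖q‖ ^ 2) := by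
  rw [G_eq, G_eq]
  refine mul_le_mul_of_nonneg_left ?_ (by positivity)
  refine (h.summable_GTerm hq hE).tsum_le_tsum (fun k => ?_) (h.summable_GTerm hq (hE.trans hEE))
  unfold GTerm
  split_ifs with hk
  · have := h.denom_le hq E k
    gcongr
    linarith
  · exact le_rfl

lemma continuousOn_G (h : Regime M L μ EB) (hq : ‖q‖ ^ 2 ≤ μ) (R : ℝ) :
    ContinuousOn (fun E => G M L μ EB q (E - ‖q‖ ^ 2)) (Icc 0 R) := by
  have hterm : ∀ k, ContinuousOn (fun E => GTerm M L μ EB q (E - ‖q‖ ^ 2) k) (Icc 0 R) := by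
    intro k
    unfold GTerm
    split_ifs with hk
    · refine continuousOn_const.sub (continuousOn_const.div (by fun_prop) fun E hE => ?_)
      have := h.denom_le hq E k
      linarith [hE.1]
    · fun_prop
  have h1 : ContinuousOn (fun E => ∑' k, GHigh M L μ EB q (E - ‖q‖ ^ 2) k) (Icc 0 R) := by
    refine continuousOn_tsum (fun k => ?_) (h.summable_tail R)
      fun k E hE => h.abs_GHigh_le hq hE.1 hE.2 k
    unfold GHigh
    split_ifs
    · exact hterm k
    · fun_prop
  have h2 : ContinuousOn (fun E => 1 / L ^ 2 *
      (∑ k ∈ modesBelow L (2 * μ), GTerm M L μ EB q (E - ‖q‖ ^ 2) k +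
        ∑' k, GHigh M L μ EB q (E - ‖q‖ ^ 2) k)) (Icc 0 R) :=
    continuousOn_const.mul ((continuousOn_finsetSum (modesBelow L (2 * μ))
      fun k _ => hterm k).add h1)
  exact h2.congr fun E hE => h.G_split hq hE.1

/-- `G` is bounded by a logarithm from above. -/
lemma G_le (h : Regime M L μ EB) (hq : ‖q‖ ^ 2 ≤ μ) {E : ℝ} (hE : 0 ≤ E) :
    G M L μ EB q (E - ‖q‖ ^ 2) ≤
      5 + Real.log ((2 * μ - EB) / -EB) + 12 * (3 / M + 2 + E / μ) := by
  have hL := h.L_pos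
  have hμ := h.μ_pos
  have hEB := h.EB_neg
  have hM := h.M_pos
  have h1 : ∑ k ∈ modesBelow L (2 * μ), GTerm M L μ EB q (E - ‖q‖ ^ 2) k ≤
      L ^ 2 * (5 + Real.log ((2 * μ - EB) / -EB)) := by
    refine le_trans (Finset.sum_le_sum fun k _ => ?_) (sum_inv_kinetic_add_le (b := -EB) hL
      (by linarith) (by linarith) h.one_le (by linarith [h.one_le_mul]))
    have h0 := kinetic_nonneg L k
    have h2 : 1 / ((1 + 1 / M) * kinetic L k - EB) ≤ 1 / (kinetic L k + -EB) := by
      refine one_div_le_one_div_of_le (by linarith) ?_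
      have : 0 ≤ 1 / M * kinetic L k := by positivity
      linarith
    unfold GTerm
    split_ifs with hk
    · have := h.denom_le hq E k
      have : 0 ≤ 1 / (1 / M * ‖q - momentum L k‖ ^ 2 + kinetic L k + (E - ‖q‖ ^ 2)) := by
        apply one_div_nonneg.2; linarith
      linarith
    · linarith
  have h2 := (le_abs_self _).trans (h.abs_tsum_GHigh_le hq hE)
  rw [h.G_split hq hE]
  calc _ ≤ 1 / L ^ 2 * (L ^ 2 * (5 + Real.log ((2 * μ - EB) / -EB)) +
      12 * (3 / M + 2 + E / μ) * L ^ 2) := by gcongr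
    _ = _ := by field_simp

/-- `G` is bounded by a logarithm from below. -/
lemma le_G (h : Regime M L μ EB) (hκ : (2 * Real.pi / L) ^ 2 ≤ μ) (hq : ‖q‖ ^ 2 ≤ μ) {E s : ℝ}
    (hE : 0 < E) (hs : 2 * Real.pi / L * √μ ≤ s) (hsμ : s ≤ μ) :
    1 / (640 * (1 + 1 / M)) * Real.log (μ / -EB) - (s / E + μ / s) - 12 * (3 / M + 2 + E / μ) ≤
      G M L μ EB q (E - ‖q‖ ^ 2) := by
  have hL := h.L_pos
  have hμ := h.μ_pos
  have hEB := h.EB_neg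
  have hM := h.M_pos
  have hs0 : 0 < s := lt_of_lt_of_le (by positivity) hs
  have hsplit : (modesBelow L (2 * μ)).filter (fun k => ¬ μ < kinetic L k) = modesBelow L μ := by
    ext k
    rw [Finset.mem_filter, mem_modesBelow hL, mem_modesBelow hL, not_lt]
    constructor
    · exact fun h => h.2
    · exact fun h => ⟨by linarith, h⟩
  have h1 : L ^ 2 * (1 / (640 * (1 + 1 / M)) * Real.log (μ / -EB)) ≤
      ∑ k ∈ modesBelow L μ, GTerm M L μ EB q (E - ‖q‖ ^ 2) k := by
    have e := le_sum_inv_kinetic_add hL (b := -EB) (by linarith) h.EB_le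
    have e2 : 1 / (1 + 1 / M) * ∑ k ∈ modesBelow L μ, 1 / (kinetic L k + -EB) ≤
        ∑ k ∈ modesBelow L μ, GTerm M L μ EB q (E - ‖q‖ ^ 2) k := by
      rw [Finset.mul_sum]
      refine Finset.sum_le_sum fun k hk => ?_
      rw [mem_modesBelow hL] at hk
      have h0 := kinetic_nonneg L k
      have h3 : 0 ≤ 1 / M * kinetic L k := by positivity
      have h4 : 0 < 1 / M := by positivity
      rw [GTerm, if_neg (not_lt.2 hk), sub_zero, one_div_mul_one_div]
      refine one_div_le_one_div_of_le (by linarith) ?_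
      nlinarith
    refine le_trans (le_of_eq ?_) ((mul_le_mul_of_nonneg_left e (by positivity)).trans e2)
    field_simp
  -- Only the annulus μ < k² ≤ 2μ has small denominators. The positive fraction is dropped there,
  -- and the other is summed by the two-scale estimate with width μ.
  have h2 : -(L ^ 2 * (s / E + μ / s)) ≤
      ∑ k ∈ (modesBelow L (2 * μ)).filter (fun k => μ < kinetic L k),
        GTerm M L μ EB q (E - ‖q‖ ^ 2) k := by
    have e := sum_inv_add_le ((modesBelow L (2 * μ)).filter (fun k => μ < kinetic L k))
      (fun k => kinetic L k - μ) (A := L ^ 2) (D := μ) (s := s) (E := E) hE hs0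
      (fun k hk => by linarith [(Finset.mem_filter.1 hk).2])
      (card_kinetic_annulus_le hL hκ (hs.trans hsμ) fun k hk => by
        rw [Finset.mem_filter, mem_modesBelow hL] at hk
        exact ⟨hk.2, by linarith [hk.1]⟩)
      (card_kinetic_annulus_le hL hκ hs fun k hk => by
        rw [Finset.mem_filter, Finset.mem_filter] at hk
        exact ⟨hk.1.2, by linarith [hk.2]⟩)
    refine (neg_le_neg e).trans ?_
    rw [← Finset.sum_neg_distrib]
    refine Finset.sum_le_sum fun k hk => ?_
    have hk := (Finset.mem_filter.1 hk).2
    have h0 := kinetic_nonneg L k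
    have h3 : 0 ≤ 1 / M * kinetic L k := by positivity
    have h4 : 0 ≤ 1 / ((1 + 1 / M) * kinetic L k - EB) := one_div_nonneg.2 (by linarith)
    have h5 := one_div_le_one_div_of_le (show 0 < E + (kinetic L k - μ) by linarith)
      (h.denom_le hq E k)
    rw [GTerm, if_pos hk]
    linarith
  have h3 := (neg_abs_le _).trans' (neg_le_neg (h.abs_tsum_GHigh_le hq hE.le))
  rw [h.G_split hq hE.le,
    ← Finset.sum_filter_add_sum_filter_not (modesBelow L (2 * μ)) (fun k => μ < kinetic L k),
    hsplit]
  calc _ = 1 / L ^ 2 * (-(L ^ 2 * (s / E + μ / s)) +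
      L ^ 2 * (1 / (640 * (1 + 1 / M)) * Real.log (μ / -EB)) +
        -(12 * (3 / M + 2 + E / μ) * L ^ 2)) := by field_simp; ring
    _ ≤ _ := by gcongr

end Regime

end

noncomputable section

open MeasureTheory Set Filter

/-! ### The polaron energy -/

lemma coe_modesBelow {L : ℝ} (hL : 0 < L) (μ : ℝ) : (modesBelow L μ : Set Mode) = holeModes L μ := by
  ext k; simp [mem_modesBelow hL, holeModes]

lemma tsum_holeModes {α : Type*} [AddCommMonoid α] [TopologicalSpace α] {L : ℝ} (hL : 0 < L)
    (μ : ℝ) (f : Mode → α) :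
    ∑' k : holeModes L μ, f k = ∑ k ∈ modesBelow L μ, f k := by
  rw [← coe_modesBelow hL]
  exact Finset.tsum_subtype' _ _

/-- If the right-hand side of the polaron equation exceeds `E` at `e = -E`, then the polaron
energy is at most `-E`. -/
lemma Regime.polaronEnergy_le_neg {M L μ EB : ℝ} (h : Regime M L μ EB) {E C : ℝ} (hE : 0 < E)
    (hG : ∀ q : EuclideanSpace ℝ (Fin 2), ‖q‖ ^ 2 ≤ μ → 0 < G M L μ EB q (E - ‖q‖ ^ 2) ∧
      G M L μ EB q (E - ‖q‖ ^ 2) ≤ C)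
    (hC : E ≤ 1 / L ^ 2 * ((modesBelow L μ).card * (1 / C))) : polaronEnergy M L μ EB ≤ -E := by
  have hL := h.L_pos
  have hq : ∀ k ∈ modesBelow L μ, ‖momentum L k‖ ^ 2 ≤ μ := fun k hk => (mem_modesBelow hL).1 hk
  let f : ℝ → ℝ := fun x => 1 / L ^ 2 * ∑ k ∈ modesBelow L μ,
    1 / G M L μ EB (momentum L k) (x - ‖momentum L k‖ ^ 2)
  have hpos : ∀ x, E ≤ x → ∀ k ∈ modesBelow L μ,
      0 < G M L μ EB (momentum L k) (x - ‖momentum L k‖ ^ 2) := fun x hx k hk =>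
    (hG _ (hq k hk)).1.trans_le (h.G_mono (hq k hk) hE.le hx)
  have hanti : ∀ x, E ≤ x → f x ≤ f E := by
    intro x hx
    refine mul_le_mul_of_nonneg_left (Finset.sum_le_sum fun k hk => ?_) (by positivity)
    exact one_div_le_one_div_of_le (hG _ (hq k hk)).1 (h.G_mono (hq k hk) hE.le hx)
  have hfE : E ≤ f E := by
    refine hC.trans (mul_le_mul_of_nonneg_left ?_ (by positivity))
    rw [← nsmul_eq_mul]
    exact Finset.card_nsmul_le_sum _ _ _ fun k hk =>
      one_div_le_one_div_of_le (hG _ (hq k hk)).1 (hG _ (hq k hk)).2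
  have hsol : ∀ e : ℝ, e ∈ polaronSolutions M L μ EB ↔ e < 0 ∧ e = -f (-e) := by
    intro e
    rw [polaronSolutions, mem_ofPred_eq,
      tsum_holeModes hL μ (fun k => 1 / G M L μ EB (momentum L k) (-kinetic L k - e))]
    simp only [f, kinetic]
    have : ∀ x : ℝ, -x - e = -e - x := fun x => by ring
    simp only [this]
  have hcont : ContinuousOn (fun x => f x - x) (Icc E (f E)) := by
    refine ContinuousOn.sub (continuousOn_const.mul (continuousOn_finsetSum _ fun k hk => ?_))
      continuousOn_id
    refine continuousOn_const.div ((h.continuousOn_G (hq k hk) (f E)).mono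
      (Icc_subset_Icc_left hE.le)) fun x hx => (hpos x hx.1 k hk).ne'
  -- The function f x - x is nonnegative at E, and nonpositive at f E because f does not exceed f E
  -- beyond E.
  obtain ⟨x, hx, hx0⟩ := intermediate_value_Icc' hfE hcont
    (show (0 : ℝ) ∈ Icc (f (f E) - f E) (f E - E) from
      ⟨by linarith [hanti _ hfE], by linarith⟩)
  have hxs : -x ∈ polaronSolutions M L μ EB := by
    rw [hsol, neg_neg]
    exact ⟨by linarith [hx.1], by simp only at hx0; linarith⟩
  -- The infimum of a set unbounded below would be 0 by convention. Every solution e has -e ≤ f E: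
  -- either -e ≥ E and monotonicity applies, or -e ≤ E ≤ f E.
  have hbdd : BddBelow (polaronSolutions M L μ EB) := by
    refine ⟨-f E, fun e he => ?_⟩
    obtain ⟨-, he2⟩ := (hsol e).1 he
    rcases le_total E (-e) with hle | hle
    · linarith [hanti _ hle]
    · linarith
  exact (csInf_le hbdd hxs).trans (by linarith [hx.1])

lemma exists_log_large (A : ℝ) : ∃ c : ℝ, 40 ≤ c ∧ ∀ x ≥ c,
    40 * Real.log x ^ 2 ≤ x ∧ A ≤ Real.log x := by
  have h1 : ∀ᶠ x : ℝ in atTop, ‖Real.log x ^ 2‖ ≤ 1 / 40 * ‖id x‖ :=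
    (Real.isLittleO_pow_log_id_atTop (n := 2)).def (by norm_num)
  have h2 := Real.tendsto_log_atTop.eventually_ge_atTop A
  obtain ⟨c, hc⟩ := eventually_atTop.1 (h1.and (h2.and (eventually_ge_atTop 0)))
  refine ⟨max c 40, le_max_right _ _, fun x hx => ?_⟩
  obtain ⟨a1, a2, a3⟩ := hc x ((le_max_left _ _).trans hx)
  simp only [id, Real.norm_eq_abs, abs_of_nonneg a3, abs_of_nonneg (sq_nonneg (Real.log x))] at a1
  exact ⟨by linarith, a2⟩

lemma two_mul_add_one_le_sq {x : ℝ} (hx : 3 ≤ x) : 2 * x + 1 ≤ x ^ 2 := by nlinarith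

/-- With b = |E_B|, the condition L²b ≥ 1 gives κ² ≤ 40b, so the lattice scale is controlled by
μ/|E_B| alone, uniformly in L. -/
lemma sq_lattice_spacing_le {L μ b ℓ : ℝ} (hL : 0 < L) (hb : 0 < b) (hLb : 1 ≤ L ^ 2 * b)
    (hℓ0 : 0 ≤ ℓ) (hℓ : 40 * ℓ ≤ μ / b) : (2 * Real.pi / L) ^ 2 * ℓ ≤ μ := by
  have hπ := Real.pi_lt_d2
  have hπ0 := Real.pi_pos
  rw [le_div_iff₀ hb] at hℓ
  rw [div_pow, div_mul_eq_mul_div, div_le_iff₀ (by positivity)]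
  have h1 : (2 * Real.pi) ^ 2 ≤ 40 := by nlinarith
  calc (2 * Real.pi) ^ 2 * ℓ ≤ 40 * ℓ * 1 := by nlinarith
    _ ≤ 40 * ℓ * (L ^ 2 * b) := by gcongr
    _ = 40 * ℓ * b * L ^ 2 := by ring
    _ ≤ μ * L ^ 2 := by gcongr

lemma lattice_spacing_mul_sqrt_le {L μ b ℓ : ℝ} (hL : 0 < L) (hμ : 0 < μ) (hb : 0 < b)
    (hLb : 1 ≤ L ^ 2 * b) (hℓ0 : 0 < ℓ) (hℓ : 40 * ℓ ^ 2 ≤ μ / b) :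
    2 * Real.pi / L * √μ ≤ μ / ℓ := by
  have h := sq_lattice_spacing_le hL hb hLb (sq_nonneg ℓ) hℓ
  have hκ : 0 < 2 * Real.pi / L := by positivity
  have h1 : 2 * Real.pi / L * ℓ ≤ √μ := Real.le_sqrt_of_sq_le (by rwa [mul_pow])
  rw [le_div_iff₀ hℓ0]
  calc _ = 2 * Real.pi / L * ℓ * √μ := by ring
    _ ≤ √μ * √μ := by gcongr
    _ = μ := Real.mul_self_sqrt hμ.le

/-- The polaron energy is at most `- c μ / log (μ / |E_B|)`. -/
theorem exists_polaronEnergy_le {M : ℝ} (hM : 0 < M) : ∃ c₀ c₁ : ℝ, 0 < c₁ ∧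
    ∀ L μ EB : ℝ, 0 < L → 0 < μ → EB < 0 → 1 ≤ L ^ 2 * |EB| → c₀ ≤ μ / |EB| →
      polaronEnergy M L μ EB ≤ -(c₁ * μ / Real.log (μ / |EB|)) := by
  -- `G_le` gives G ≤ CG · ℓ for E ≤ μ and ℓ ≥ 1: here 7 = 5 + 2, the 2 coming from log((2μ +
  -- |E_B|)/|E_B|) ≤ 2ℓ. The 80 in c₁ is that of `le_card_modesBelow`, so the polaron sum is at
  -- least E = c₁μ/ℓ.
  set CG : ℝ := 7 + 12 * (3 / M + 3) with hCG
  have hCG0 : 1 ≤ CG := by have : 0 < 3 / M := by positivity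
                           linarith
  set c₁ : ℝ := 1 / (80 * CG) with hc₁
  have hc0 : 0 < c₁ := by positivity
  have hc1 : c₁ ≤ 1 := by rw [hc₁, div_le_one (by positivity)]; linarith
  set a : ℝ := 1 + 1 / M with ha
  have ha0 : 0 < a := by positivity
  set B : ℝ := 1280 * a * (1 / c₁ + 1) with hB
  set D : ℝ := 1280 * a * (12 * (3 / M + 3)) with hD
  have hB0 : 0 ≤ B := by positivity
  have hD0 : 0 ≤ D := by positivity
  -- ℓ ≥ B² and ℓ > D make the two-scale error and the tail of `G` each cost at most half of the
  -- main term ℓ/(640a), the second strictly less.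
  obtain ⟨c₀, h40, hc₀⟩ := exists_log_large (1 + B ^ 2 + D)
  refine ⟨c₀, c₁, hc0, fun L μ EB hL hμ hEB hLb hμb => ?_⟩
  rw [abs_of_neg hEB] at hLb hμb ⊢
  have hb : 0 < -EB := by linarith
  obtain ⟨hlog, hℓ⟩ := hc₀ _ hμb
  set ℓ := Real.log (μ / -EB) with hℓdef
  have hℓ1 : 1 ≤ ℓ := by nlinarith [sq_nonneg B]
  have hx40 : 40 ≤ μ / -EB := h40.trans hμb
  have h : Regime M L μ EB := ⟨hM, hL, hμ, hEB, by
    rw [le_div_iff₀ hb] at hx40; linarith, hLb⟩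
  have hκ : (2 * Real.pi / L) ^ 2 ≤ μ := by
    simpa using sq_lattice_spacing_le (ℓ := 1) hL hb hLb zero_le_one (by linarith)
  have hsℓ1 : 1 ≤ √ℓ := Real.one_le_sqrt.2 hℓ1
  have hsℓ2 : √ℓ ^ 2 = ℓ := Real.sq_sqrt (by linarith)
  have hs : 2 * Real.pi / L * √μ ≤ μ / √ℓ :=
    lattice_spacing_mul_sqrt_le hL hμ hb hLb (by linarith) (by rw [hsℓ2]; nlinarith)
  have hsμ : μ / √ℓ ≤ μ := div_le_self hμ.le hsℓ1
  have hE : 0 < c₁ * μ / ℓ := by positivity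
  have hEμ : c₁ * μ / ℓ / μ ≤ 1 := by
    rw [div_div, div_le_one (by positivity)]
    nlinarith
  have hEμ0 : 0 ≤ c₁ * μ / ℓ / μ := by positivity
  refine h.polaronEnergy_le_neg (C := CG * ℓ) hE (fun q hq => ⟨?_, ?_⟩) ?_
  · refine lt_of_lt_of_le ?_ (h.le_G hκ hq hE hs hsμ)
    -- The scale s = μ/√ℓ makes both errors of order √ℓ, below the main term of order ℓ.
    have e1 : μ / √ℓ / (c₁ * μ / ℓ) + μ / (μ / √ℓ) = √ℓ * (1 / c₁ + 1) := by
      field_simp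
      rw [hsℓ2]
      ring
    rw [e1, ← hℓdef]
    have e2 : √ℓ * (1 / c₁ + 1) ≤ ℓ / (1280 * a) := by
      rw [le_div_iff₀ (by positivity)]
      have : B ≤ √ℓ := Real.le_sqrt_of_sq_le (by linarith)
      calc _ = √ℓ * B := by rw [hB]; ring
        _ ≤ √ℓ * √ℓ := by gcongr
        _ = ℓ := Real.mul_self_sqrt (by linarith)
    have e3 : 12 * (3 / M + 3) < ℓ / (1280 * a) := by
      rw [lt_div_iff₀ (by positivity)]
      nlinarith [sq_nonneg B]
    have e4 : 1 / (640 * a) * ℓ = ℓ / (1280 * a) + ℓ / (1280 * a) := by field_simp; ring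
    linarith
  · refine (h.G_le hq hE.le).trans ?_
    have e1 : Real.log ((2 * μ - EB) / -EB) ≤ 2 * ℓ := by
      rw [hℓdef, ← Real.log_rpow (by positivity)]
      refine Real.log_le_log (by apply div_pos <;> linarith) ?_
      have : (2 * μ - EB) / -EB = 2 * (μ / -EB) + 1 := by rw [sub_eq_add_neg, add_div,
        div_self hb.ne', mul_div_assoc]
      rw [this, Real.rpow_two]
      exact two_mul_add_one_le_sq (by linarith)
    have h3M : 0 < 3 / M := by positivity
    have e2 : 5 + 12 * (3 / M + 3) ≤ (5 + 12 * (3 / M + 3)) * ℓ :=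
      le_mul_of_one_le_right (by positivity) hℓ1
    have e3 : CG * ℓ = 2 * ℓ + (5 + 12 * (3 / M + 3)) * ℓ := by rw [hCG]; ring
    linarith
  · have e1 := le_card_modesBelow hL hμ.le
    calc c₁ * μ / ℓ = 1 / L ^ 2 * (L ^ 2 * μ / 80 * (1 / (CG * ℓ))) := by
          rw [hc₁]; field_simp
      _ ≤ _ := by gcongr

end

noncomputable section

open MeasureTheory Set Filter

/-! ### Excitation energies -/

/-- The excitation energy `∑_{k ∈ S} (k² - μ) - ∑_{k² ≤ μ} (k² - μ)` of the configuration `S`. -/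
def excitation (L μ : ℝ) (S : Finset Mode) : ℝ :=
  ∑ k ∈ S, (kinetic L k - μ) - ∑ k ∈ modesBelow L μ, (kinetic L k - μ)

/-- Sea momenta missing from S contribute μ - k² ≥ 0, and occupied momenta above μ outside F
contribute positively; both may be dropped. -/
lemma sum_le_excitation {L μ : ℝ} (hL : 0 < L) {S F : Finset Mode} (hFS : F ⊆ S)
    (hF : ∀ k ∈ F, μ < kinetic L k) : ∑ k ∈ F, (kinetic L k - μ) ≤ excitation L μ S := by
  have h1 : ∑ k ∈ F, (kinetic L k - μ) ≤
      ∑ k ∈ S.filter (fun k => ¬ kinetic L k ≤ μ), (kinetic L k - μ) := by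
    refine Finset.sum_le_sum_of_subset_of_nonneg (fun k hk => ?_) fun k hk _ => ?_
    · exact Finset.mem_filter.2 ⟨hFS hk, not_le.2 (hF k hk)⟩
    · linarith [not_le.1 (Finset.mem_filter.1 hk).2]
  have h2 : ∑ k ∈ modesBelow L μ, (kinetic L k - μ) ≤
      ∑ k ∈ S.filter (fun k => kinetic L k ≤ μ), (kinetic L k - μ) := by
    have : ∑ k ∈ S.filter (fun k => kinetic L k ≤ μ), -(kinetic L k - μ) ≤
        ∑ k ∈ modesBelow L μ, -(kinetic L k - μ) := by
      refine Finset.sum_le_sum_of_subset_of_nonneg (fun k hk => ?_) fun k hk _ => ?_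
      · exact (mem_modesBelow hL).2 (Finset.mem_filter.1 hk).2
      · linarith [(mem_modesBelow hL).1 hk]
    rw [Finset.sum_neg_distrib, Finset.sum_neg_distrib] at this
    linarith
  rw [excitation, ← Finset.sum_filter_add_sum_filter_not S (fun k => kinetic L k ≤ μ)]
  linarith

lemma excitation_nonneg {L μ : ℝ} (hL : 0 < L) (S : Finset Mode) : 0 ≤ excitation L μ S := by
  simpa using sum_le_excitation (μ := μ) hL (Finset.empty_subset S) (by simp)

lemma le_excitation {L μ : ℝ} (hL : 0 < L) {S : Finset Mode} {k : Mode} (hk : k ∈ S)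
    (hkμ : μ < kinetic L k) : kinetic L k - μ ≤ excitation L μ S := by
  simpa using sum_le_excitation (F := {k}) hL (by simpa using hk) (by simpa using hkμ)

lemma particleNumber_eq {L μ : ℝ} (hL : 0 < L) : particleNumber L μ = (modesBelow L μ).card := by
  rw [particleNumber, ← coe_modesBelow hL, Set.ncard_coe_finset]

/-- Each particle short of N(μ) contributes -μ, which turns the k² of an added particle in a
resolvent into k² - μ. -/
lemma totalKinetic_eq {L μ : ℝ} (hL : 0 < L) (S : Finset Mode) :
    totalKinetic L S =
      fermiSeaEnergy L μ + excitation L μ S + ((S.card : ℝ) - particleNumber L μ) * μ := by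
  rw [particleNumber_eq hL, fermiSeaEnergy, tsum_holeModes hL μ (kinetic L), excitation,
    totalKinetic, Finset.sum_sub_distrib, Finset.sum_sub_distrib, Finset.sum_const,
    Finset.sum_const, nsmul_eq_mul, nsmul_eq_mul]
  ring

/-! ### Bounds for creation and annihilation with resolvents -/

lemma cre_funPT_eq (L : ℝ) (f : EuclideanSpace ℝ (Fin 2) → ℝ → ℝ) (B : Finset Mode)
    (ζ ψ : Amplitude) {k : Mode} (hk : k ∈ B) :
    ip B ζ (cre k (funPT L f ψ)) = ∑ S ∈ B.powerset,
      (starRingEnd ℂ) (ann k ζ S) * ψ S * ((f (totalMomentum L S) (totalKinetic L S) : ℝ) : ℂ) := by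
  rw [← ip_ann_left hk]
  refine Finset.sum_congr rfl fun S _ => ?_
  rw [funPT]; ring

lemma norm_exp_phase (y : EuclideanSpace ℝ (Fin 2)) (v : EuclideanSpace ℝ (Fin 2)) (r : ℝ) :
    ‖Complex.exp ((inner ℝ y v : ℝ) * Complex.I) * (Real.exp r : ℂ)‖ = Real.exp r := by
  rw [norm_mul, Complex.norm_exp_ofReal_mul_I, one_mul, Complex.norm_real, Real.norm_eq_abs,
    abs_of_pos (Real.exp_pos _)]

lemma sum_norm_sq_phase (L μ t : ℝ) (y : EuclideanSpace ℝ (Fin 2)) (F : Finset Mode) :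
    ∑ k ∈ F, ‖Complex.exp ((inner ℝ y (-momentum L k) : ℝ) * Complex.I) *
      (Real.exp (-(t * (kinetic L k - μ))) : ℂ)‖ ^ 2 =
      ∑ k ∈ F, Real.exp (-(2 * t * (kinetic L k - μ))) := by
  refine Finset.sum_congr rfl fun k _ => ?_
  rw [norm_exp_phase, ← Real.exp_nat_mul]
  congr 1; push_cast; ring

section

variable {M L μ lam w : ℝ} {p : Mode} {B F F' : Finset Mode} {ζ ψ ψ' : Amplitude} {g : ℝ → ℝ}

/-- The norm of the creation part `A*` is controlled by the Laplace transform of its weights. -/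
lemma norm_ip_creation_le (hM : 0 < M) (hL : 0 < L) (hlam : lam < fermiSeaEnergy L μ)
    (hF : F ⊆ B) (hFμ : ∀ k ∈ F, μ < kinetic L k)
    (hψ : ∀ S, ψ S ≠ 0 → S.card + 1 = particleNumber L μ ∧ w ≤ excitation L μ S)
    (hg : IntegrableOn g (Ioi 0))
    (hgt : ∀ t > 0, Real.exp (-(t * w)) *
      √(∑ k ∈ F, Real.exp (-(2 * t * (kinetic L k - μ)))) ≤ g t) :
    ‖ip B ζ (∑ k ∈ F, cre k (funPT L (fun P T =>
      1 / (1 / M * ‖momentum L p - P - momentum L k‖ ^ 2 + T + kinetic L k - lam)) ψ))‖ ≤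
      (∫ t in Ioi 0, g t) * (nrm B ζ * nrm B ψ) := by
  set E := fermiSeaEnergy L μ - lam with hE
  have hE0 : 0 < E := by linarith
  have e1 : ip B ζ (∑ k ∈ F, cre k (funPT L (fun P T =>
      1 / (1 / M * ‖momentum L p - P - momentum L k‖ ^ 2 + T + kinetic L k - lam)) ψ)) =
      ∑ i ∈ F ×ˢ B.powerset, (starRingEnd ℂ) (ann i.1 ζ i.2) * ψ i.2 *
        ((1 / (1 / M * ‖momentum L p - totalMomentum L i.2 - momentum L i.1‖ ^ 2 +
          (excitation L μ i.2 + (kinetic L i.1 - μ) + E)) : ℝ) : ℂ) := by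
    rw [ip_sum_right, Finset.sum_product]
    refine Finset.sum_congr rfl fun k hk => ?_
    rw [cre_funPT_eq _ _ _ _ _ (hF hk)]
    refine Finset.sum_congr rfl fun S _ => ?_
    by_cases h0 : ψ S = 0
    · simp [h0]
    · have hc : (S.card : ℝ) + 1 = particleNumber L μ := by exact_mod_cast (hψ S h0).1
      rw [totalKinetic_eq (μ := μ) hL S, ← hc, hE]
      congr 4
      ring
  rw [e1, ← integral_mul_const]
  refine norm_sum_mul_inv_le _ _ _ _ (fun i hi => ?_) hM (hg.mul_const _) fun t ht y => ?_
  · have := hFμ i.1 (Finset.mem_product.1 hi).1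
    have := excitation_nonneg (μ := μ) hL i.2
    linarith
  -- The weight now factors into f, depending on the created momentum only, and m, depending on the
  -- configuration only; the phases have modulus one.
  set f : Mode → ℂ := fun k => Complex.exp ((inner ℝ y (-momentum L k) : ℝ) * Complex.I) *
    (Real.exp (-(t * (kinetic L k - μ))) : ℂ) with hf
  set m : Finset Mode → ℂ := fun S =>
    Complex.exp ((inner ℝ y (momentum L p - totalMomentum L S) : ℝ) * Complex.I) *
    (Real.exp (-(t * (excitation L μ S + E))) : ℂ) with hm
  have e2 : ∑ i ∈ F ×ˢ B.powerset, (starRingEnd ℂ) (ann i.1 ζ i.2) * ψ i.2 *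
      (Complex.exp ((inner ℝ y (momentum L p - totalMomentum L i.2 - momentum L i.1) : ℝ) *
        Complex.I) *
        (Real.exp (-(t * (excitation L μ i.2 + (kinetic L i.1 - μ) + E))) : ℂ)) =
      ip B ζ (∑ k ∈ F, f k • cre k (fun S => m S * ψ S)) := by
    rw [ip_sum_right, Finset.sum_product]
    refine Finset.sum_congr rfl fun k hk => ?_
    rw [ip_smul_right, ← ip_ann_left (hF hk), ip, Finset.mul_sum]
    refine Finset.sum_congr rfl fun S _ => ?_
    have a1 : Complex.exp ((inner ℝ y (momentum L p - totalMomentum L S - momentum L k) : ℝ) *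
        Complex.I) = Complex.exp ((inner ℝ y (momentum L p - totalMomentum L S) : ℝ) * Complex.I) *
          Complex.exp ((inner ℝ y (-momentum L k) : ℝ) * Complex.I) := by
      rw [← Complex.exp_add, ← add_mul, ← Complex.ofReal_add, ← inner_add_right, sub_eq_add_neg _
        (momentum L k)]
    have a2 : Real.exp (-(t * (excitation L μ S + (kinetic L k - μ) + E))) =
        Real.exp (-(t * (excitation L μ S + E))) * Real.exp (-(t * (kinetic L k - μ))) := by
      rw [← Real.exp_add]; ring_nf
    rw [a1, a2, Complex.ofReal_mul, hf, hm]
    ring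
  rw [e2]
  have b1 : nrm B (fun S => m S * ψ S) ≤ Real.exp (-(t * w)) * nrm B ψ := by
    refine nrm_mul_le (Real.exp_pos _).le fun S _ hS => ?_
    rw [hm, norm_exp_phase]
    refine Real.exp_le_exp.2 (neg_le_neg (mul_le_mul_of_nonneg_left ?_ (le_of_lt ht)))
    linarith [(hψ S hS).2]
  have b2 := nrm_cre_le hF f (fun S => m S * ψ S)
  rw [hf, sum_norm_sq_phase] at b2
  have n1 := nrm_nonneg B ζ
  have n2 := nrm_nonneg B ψ
  refine (norm_ip_le _ _ _).trans ?_
  calc _ ≤ nrm B ζ * (√(∑ k ∈ F, Real.exp (-(2 * t * (kinetic L k - μ)))) *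
        (Real.exp (-(t * w)) * nrm B ψ)) := by
        refine mul_le_mul_of_nonneg_left (b2.trans ?_) n1
        gcongr
    _ = Real.exp (-(t * w)) * √(∑ k ∈ F, Real.exp (-(2 * t * (kinetic L k - μ)))) *
        (nrm B ζ * nrm B ψ) := by ring
    _ ≤ _ := mul_le_mul_of_nonneg_right (hgt t ht) (by positivity)

/-- The norm of the exchange part `P` is controlled by the Laplace transform of its weights. -/
lemma norm_ip_exchange_le (hM : 0 < M) (hL : 0 < L) (hlam : lam < fermiSeaEnergy L μ)
    (hF : F ⊆ B) (hFμ : ∀ k ∈ F, μ < kinetic L k)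
    (hF' : F' ⊆ B) (hFμ' : ∀ k ∈ F', μ < kinetic L k)
    (hψ : ∀ S, ψ S ≠ 0 → S.card + 1 = particleNumber L μ)
    (hg : IntegrableOn g (Ioi 0))
    (hgt : ∀ t > 0, Real.exp (-(t * (fermiSeaEnergy L μ - lam))) *
      (√(∑ k ∈ F', Real.exp (-(2 * t * (kinetic L k - μ)))) *
      √(∑ k ∈ F, Real.exp (-(2 * t * (kinetic L k - μ))))) ≤ g t) :
    ‖ip B ζ (∑ k ∈ F, ∑ l ∈ F', cre l (funPT L (fun P T =>
      1 / (1 / M * ‖momentum L p - P - momentum L k - momentum L l‖ ^ 2 + T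
        + kinetic L k + kinetic L l - lam)) (ann k ψ)))‖ ≤
      (∫ t in Ioi 0, g t) * (nrm B ζ * nrm B ψ) := by
  set E := fermiSeaEnergy L μ - lam with hE
  have hE0 : 0 < E := by linarith
  have e1 : ip B ζ (∑ k ∈ F, ∑ l ∈ F', cre l (funPT L (fun P T =>
      1 / (1 / M * ‖momentum L p - P - momentum L k - momentum L l‖ ^ 2 + T
        + kinetic L k + kinetic L l - lam)) (ann k ψ))) =
      ∑ i ∈ (F ×ˢ F') ×ˢ B.powerset, (starRingEnd ℂ) (ann i.1.2 ζ i.2) * ann i.1.1 ψ i.2 *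
        ((1 / (1 / M * ‖momentum L p - totalMomentum L i.2 - momentum L i.1.1 -
          momentum L i.1.2‖ ^ 2 + (excitation L μ i.2 + (kinetic L i.1.1 - μ) +
            (kinetic L i.1.2 - μ) + E)) : ℝ) : ℂ) := by
    rw [ip_sum_right, Finset.sum_product, Finset.sum_product]
    refine Finset.sum_congr rfl fun k hk => ?_
    rw [ip_sum_right]
    refine Finset.sum_congr rfl fun l hl => ?_
    rw [cre_funPT_eq _ _ _ _ _ (hF' hl)]
    refine Finset.sum_congr rfl fun S _ => ?_
    by_cases h0 : ann k ψ S = 0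
    · simp [h0]
    -- S has already lost the annihilated particle, so two chemical potentials are available, one
    -- for k and one for l.
    · have hc : (S.card : ℝ) + 2 = particleNumber L μ := by
        have hk : k ∉ S := fun hk => h0 (by simp [ann, hk])
        have h1 : ψ (insert k S) ≠ 0 := fun h => h0 (by simp [ann, h])
        have h2 := hψ _ h1
        rw [Finset.card_insert_of_notMem hk] at h2
        exact_mod_cast h2
      rw [totalKinetic_eq (μ := μ) hL S, ← hc, hE]
      congr 4
      ring
  rw [e1, ← integral_mul_const]
  refine norm_sum_mul_inv_le _ _ _ _ (fun i hi => ?_) hM (hg.mul_const _) fun t ht y => ?_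
  · have hi := Finset.mem_product.1 (Finset.mem_product.1 hi).1
    have := hFμ _ hi.1
    have := hFμ' _ hi.2
    have := excitation_nonneg (μ := μ) hL i.2
    linarith
  set f : Mode → ℂ := fun k => Complex.exp ((inner ℝ y (-momentum L k) : ℝ) * Complex.I) *
    (Real.exp (-(t * (kinetic L k - μ))) : ℂ) with hf
  set m : Finset Mode → ℂ := fun S =>
    Complex.exp ((inner ℝ y (momentum L p - totalMomentum L S) : ℝ) * Complex.I) *
    (Real.exp (-(t * (excitation L μ S + E))) : ℂ) with hm
  have e2 : ∑ i ∈ (F ×ˢ F') ×ˢ B.powerset, (starRingEnd ℂ) (ann i.1.2 ζ i.2) * ann i.1.1 ψ i.2 *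
      (Complex.exp ((inner ℝ y (momentum L p - totalMomentum L i.2 - momentum L i.1.1 -
        momentum L i.1.2) : ℝ) * Complex.I) *
        (Real.exp (-(t * (excitation L μ i.2 + (kinetic L i.1.1 - μ) +
            (kinetic L i.1.2 - μ) + E))) : ℂ)) =
      ip B (∑ l ∈ F', (starRingEnd ℂ) (f l) • ann l ζ)
        (fun S => m S * (∑ k ∈ F, f k • ann k ψ) S) := by
    rw [ip_sum_left, Finset.sum_product, Finset.sum_product, Finset.sum_comm]
    refine Finset.sum_congr rfl fun l hl => ?_
    rw [ip_smul_left, ip, Finset.mul_sum, Finset.sum_comm]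
    refine Finset.sum_congr rfl fun S _ => ?_
    rw [Finset.sum_apply, Finset.mul_sum, Finset.mul_sum, Finset.mul_sum, Complex.conj_conj]
    refine Finset.sum_congr rfl fun k hk => ?_
    have a1 : Complex.exp ((inner ℝ y (momentum L p - totalMomentum L S - momentum L k -
        momentum L l) : ℝ) * Complex.I) =
          Complex.exp ((inner ℝ y (momentum L p - totalMomentum L S) : ℝ) * Complex.I) *
          Complex.exp ((inner ℝ y (-momentum L k) : ℝ) * Complex.I) *
          Complex.exp ((inner ℝ y (-momentum L l) : ℝ) * Complex.I) := by
      rw [← Complex.exp_add, ← Complex.exp_add, ← add_mul, ← add_mul, ← Complex.ofReal_add,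
        ← Complex.ofReal_add, ← inner_add_right, ← inner_add_right, sub_eq_add_neg _ (momentum L l),
        sub_eq_add_neg _ (momentum L k)]
    have a2 : Real.exp (-(t * (excitation L μ S + (kinetic L k - μ) + (kinetic L l - μ) + E))) =
        Real.exp (-(t * (excitation L μ S + E))) * Real.exp (-(t * (kinetic L k - μ))) *
          Real.exp (-(t * (kinetic L l - μ))) := by
      rw [← Real.exp_add, ← Real.exp_add]; ring_nf
    rw [a1, a2, Complex.ofReal_mul, Complex.ofReal_mul, hf, hm, Pi.smul_apply, smul_eq_mul]
    ring
  rw [e2]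
  have b1 : nrm B (fun S => m S * (∑ k ∈ F, f k • ann k ψ) S) ≤
      Real.exp (-(t * E)) * nrm B (∑ k ∈ F, f k • ann k ψ) := by
    refine nrm_mul_le (Real.exp_pos _).le fun S _ hS => ?_
    rw [hm, norm_exp_phase]
    refine Real.exp_le_exp.2 (neg_le_neg (mul_le_mul_of_nonneg_left ?_ (le_of_lt ht)))
    linarith [excitation_nonneg (μ := μ) hL S]
  have b2 := nrm_ann_le hF f ψ
  have b3 := nrm_ann_le hF' (fun l => (starRingEnd ℂ) (f l)) ζ
  simp only [RCLike.norm_conj] at b3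
  rw [hf, sum_norm_sq_phase] at b2 b3
  have n1 := nrm_nonneg B ζ
  have n2 := nrm_nonneg B ψ
  refine (norm_ip_le _ _ _).trans ?_
  calc _ ≤ (√(∑ k ∈ F', Real.exp (-(2 * t * (kinetic L k - μ)))) * nrm B ζ) *
        (Real.exp (-(t * E)) * (√(∑ k ∈ F, Real.exp (-(2 * t * (kinetic L k - μ)))) *
          nrm B ψ)) := by
        refine mul_le_mul b3 (b1.trans ?_) (nrm_nonneg _ _) (by positivity)
        gcongr
    _ = Real.exp (-(t * E)) * (√(∑ k ∈ F', Real.exp (-(2 * t * (kinetic L k - μ)))) *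
        √(∑ k ∈ F, Real.exp (-(2 * t * (kinetic L k - μ))))) * (nrm B ζ * nrm B ψ) := by ring
    _ ≤ _ := mul_le_mul_of_nonneg_right (hgt t ht) (by positivity)

end

end

noncomputable section

open Set

/-! ### Reduction to finite sums -/

/-- The modes in `B` outside the Fermi sea. -/
def particlesIn (L μ : ℝ) (B : Finset Mode) : Finset Mode := B.filter fun k => μ < kinetic L k

lemma mem_particlesIn {L μ : ℝ} {B : Finset Mode} {k : Mode} :
    k ∈ particlesIn L μ B ↔ k ∈ B ∧ μ < kinetic L k := Finset.mem_filter

lemma tsum_particleModes {L μ : ℝ} {B : Finset Mode} {f : Mode → ℂ} (hf : ∀ k, k ∉ B → f k = 0) :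
    ∑' k : particleModes L μ, f k = ∑ k ∈ particlesIn L μ B, f k := by
  rw [tsum_subtype, tsum_eq_sum (s := B), particlesIn, Finset.sum_filter]
  · exact Finset.sum_congr rfl fun k _ => by
      by_cases h : μ < kinetic L k <;> simp [indicator, particleModes, h]
  · intro k hk
    simp [indicator, hf k hk]

lemma tsum_particleModes_prod {L μ : ℝ} {B : Finset Mode} {f : Mode → Mode → ℂ}
    (hf : ∀ k l, k ∉ B ∨ l ∉ B → f k l = 0) :
    ∑' kl : particleModes L μ × particleModes L μ, f kl.1 kl.2 =
      ∑ k ∈ particlesIn L μ B, ∑ l ∈ particlesIn L μ B, f k l := by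
  classical
  let g : particleModes L μ × particleModes L μ → Mode × Mode := Prod.map (↑) (↑)
  let f' : Mode × Mode → ℂ := fun x =>
    if μ < kinetic L x.1 ∧ μ < kinetic L x.2 then f x.1 x.2 else 0
  have hg : Function.Injective g := Subtype.val_injective.prodMap Subtype.val_injective
  have hsupp : Function.support f' ⊆ range g := by
    rintro ⟨k, l⟩ hkl
    have : μ < kinetic L k ∧ μ < kinetic L l := by
      by_contra h
      exact hkl (if_neg h)
    exact ⟨(⟨k, this.1⟩, ⟨l, this.2⟩), rfl⟩
  have h1 : ∑' kl : particleModes L μ × particleModes L μ, f kl.1 kl.2 = ∑' kl, f' (g kl) :=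
    tsum_congr fun kl => (if_pos ⟨kl.1.2, kl.2.2⟩).symm
  rw [h1, hg.tsum_eq hsupp, tsum_eq_sum (s := particlesIn L μ B ×ˢ particlesIn L μ B),
    Finset.sum_product]
  · refine Finset.sum_congr rfl fun k hk => Finset.sum_congr rfl fun l hl => ?_
    exact if_pos ⟨(mem_particlesIn.1 hk).2, (mem_particlesIn.1 hl).2⟩
  · rintro ⟨k, l⟩ hkl
    simp only [f']
    split_ifs with h
    · refine hf k l ?_
      by_contra hB
      push Not at hB
      exact hkl (Finset.mem_product.2 ⟨mem_particlesIn.2 ⟨hB.1, h.1⟩, mem_particlesIn.2 ⟨hB.2, h.2⟩⟩)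
    · rfl

/-- `ψ` only occupies modes in `B`. -/
def SupportedIn (B : Finset Mode) (ψ : Amplitude) : Prop := ∀ S, ψ S ≠ 0 → S ⊆ B

/-- Finite support of the left vector suffices. The right one may involve infinitely many modes, as
images under A* and P do. -/
lemma braket_eq_ip {B : Finset Mode} {ψ : Amplitude} (h : SupportedIn B ψ) (χ : Amplitude) :
    braket ψ χ = ip B ψ χ := by
  refine tsum_eq_sum fun S hS => ?_
  have : ψ S = 0 := by
    by_contra h0
    exact hS (Finset.mem_powerset.2 (h S h0))
  simp [this]

lemma ann_eq_zero {B : Finset Mode} {ψ : Amplitude} (h : SupportedIn B ψ) {k : Mode} (hk : k ∉ B)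
    (S : Finset Mode) : ann k ψ S = 0 := by
  have : ψ (insert k S) = 0 := by
    by_contra h0
    exact hk (h _ h0 (Finset.mem_insert_self _ _))
  simp [ann, this]

lemma annEta_eq {L : ℝ} (hL : 0 < L) (μ : ℝ) (ψ : Amplitude) :
    annEta L μ ψ = (1 / L : ℂ) • ∑ k ∈ modesBelow L μ, ann k ψ := by
  funext S
  rw [annEta, tsum_holeModes hL μ (fun k => ann k ψ S)]
  simp [Finset.sum_apply]

lemma creEta_eq {L : ℝ} (hL : 0 < L) (μ : ℝ) (ψ : Amplitude) :
    creEta L μ ψ = (1 / L : ℂ) • ∑ k ∈ modesBelow L μ, cre k ψ := by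
  funext S
  rw [creEta, tsum_holeModes hL μ (fun k => cre k ψ S)]
  simp [Finset.sum_apply]

lemma conj_one_div_ofReal (L : ℝ) : (starRingEnd ℂ) (1 / L : ℂ) = 1 / L := by
  simp

lemma ip_annEta {L μ : ℝ} (hL : 0 < L) {B : Finset Mode} (hB : modesBelow L μ ⊆ B)
    (ψ χ : Amplitude) : ip B ψ (annEta L μ χ) = ip B (creEta L μ ψ) χ := by
  rw [annEta_eq hL, creEta_eq hL, ip_smul_right, ip_smul_left, conj_one_div_ofReal, ip_sum_right,
    ip_sum_left]
  congr 1
  exact Finset.sum_congr rfl fun k hk => (ip_cre_left (hB hk) _ _).symm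

lemma creEta_apply_ne_zero {L μ : ℝ} (hL : 0 < L) {ψ : Amplitude} {S : Finset Mode}
    (h : creEta L μ ψ S ≠ 0) : ∃ k ∈ modesBelow L μ, k ∈ S ∧ ψ (S.erase k) ≠ 0 := by
  rw [creEta_eq hL, Pi.smul_apply, Finset.sum_apply] at h
  by_contra! hc
  refine h ?_
  rw [Finset.sum_eq_zero, smul_zero]
  intro k hk
  by_cases hkS : k ∈ S
  · simp [cre, hkS, hc k hk hkS]
  · simp [cre, hkS]

lemma SupportedIn.creEta {L μ : ℝ} (hL : 0 < L) {B : Finset Mode} (hB : modesBelow L μ ⊆ B)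
    {ψ : Amplitude} (h : SupportedIn B ψ) : SupportedIn B (creEta L μ ψ) := by
  intro S hS
  obtain ⟨k, hk, hkS, h0⟩ := creEta_apply_ne_zero hL hS
  rw [← Finset.insert_erase hkS]
  exact Finset.insert_subset (hB hk) (h _ h0)

/-- The part of `A*` that creates particles in `F`, without the factor `1 / L`. -/
def creationPart (M L lam : ℝ) (p : Mode) (F : Finset Mode) (ψ : Amplitude) : Amplitude :=
  ∑ k ∈ F, cre k (funPT L (fun P T =>
    1 / (1 / M * ‖momentum L p - P - momentum L k‖ ^ 2 + T + kinetic L k - lam)) ψ)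

/-- The part of `P` that moves particles from `F` to `F'`, without the factor `1 / L ^ 2`. -/
def exchangePart (M L lam : ℝ) (p : Mode) (F F' : Finset Mode) (ψ : Amplitude) : Amplitude :=
  ∑ k ∈ F, ∑ l ∈ F', cre l (funPT L (fun P T =>
    1 / (1 / M * ‖momentum L p - P - momentum L k - momentum L l‖ ^ 2 + T
      + kinetic L k + kinetic L l - lam)) (ann k ψ))

lemma ip_opAStar {M L μ lam : ℝ} {p : Mode} (B : Finset Mode) (ζ ψ : Amplitude) :
    ip B ζ (opAStar M L μ lam p ψ) =
      (1 / L : ℂ) * ip B ζ (creationPart M L lam p (particlesIn L μ B) ψ) := by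
  rw [← ip_smul_right]
  refine ip_congr_right fun S hS => ?_
  rw [opAStar, tsum_particleModes (B := B) (f := fun k => cre k (funPT L (fun P T =>
    1 / (1 / M * ‖momentum L p - P - momentum L k‖ ^ 2 + T + kinetic L k - lam)) ψ) S)]
  · simp [creationPart, Finset.sum_apply]
  · intro k hk
    have : k ∉ S := fun h => hk (Finset.mem_powerset.1 hS h)
    simp [cre, this]

lemma ip_funPT_left (L : ℝ) (f : EuclideanSpace ℝ (Fin 2) → ℝ → ℝ) (B : Finset Mode)
    (ψ χ : Amplitude) : ip B (funPT L f ψ) χ = ip B ψ (funPT L f χ) := by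
  refine Finset.sum_congr rfl fun S _ => ?_
  simp only [funPT, map_mul, Complex.conj_ofReal]
  ring

lemma ip_opA {M L μ lam : ℝ} {p : Mode} {B : Finset Mode} (ψ : Amplitude) {ζ : Amplitude}
    (hζ : SupportedIn B ζ) : ip B ψ (opA M L μ lam p ζ) =
      (starRingEnd ℂ) ((1 / L : ℂ) * ip B ζ (creationPart M L lam p (particlesIn L μ B) ψ)) := by
  have h1 : ip B ψ (opA M L μ lam p ζ) = ip B ψ ((1 / L : ℂ) • ∑ k ∈ particlesIn L μ B,
      funPT L (fun P T =>
        1 / (1 / M * ‖momentum L p - P - momentum L k‖ ^ 2 + T + kinetic L k - lam)) (ann k ζ)) := by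
    refine ip_congr_right fun S _ => ?_
    rw [opA, tsum_particleModes (B := B) (f := fun k => funPT L (fun P T =>
      1 / (1 / M * ‖momentum L p - P - momentum L k‖ ^ 2 + T + kinetic L k - lam)) (ann k ζ) S)]
    · simp [Finset.sum_apply]
    · intro k hk
      simp [funPT, ann_eq_zero hζ hk]
  rw [h1, ip_smul_right, map_mul, conj_ip, conj_one_div_ofReal, creationPart, ip_sum_right,
    ip_sum_left]
  congr 1
  refine Finset.sum_congr rfl fun k hk => ?_
  rw [ip_cre_left (mem_particlesIn.1 hk).1, ip_funPT_left]

lemma ip_opX {M L μ lam : ℝ} {p : Mode} (hL : 0 < L) {B : Finset Mode} (hB : modesBelow L μ ⊆ B)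
    (ζ : Amplitude) {ψ : Amplitude} (hψ : SupportedIn B ψ) : ip B ζ (opX M L μ lam p ψ) =
      (1 / L : ℂ) * ip B (creEta L μ ζ) (creationPart M L lam p (particlesIn L μ B) ψ) +
      (starRingEnd ℂ) ((1 / L : ℂ) *
        ip B (creEta L μ ψ) (creationPart M L lam p (particlesIn L μ B) ζ)) := by
  rw [opX, ip_add_right, ip_annEta hL hB, ip_opAStar, ip_opA _ (hψ.creEta hL hB)]

lemma ip_opH {M L μ lam : ℝ} {p : Mode} (hL : 0 < L) {B : Finset Mode} (hB : modesBelow L μ ⊆ B)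
    (ζ ψ : Amplitude) : ip B ζ (opH M L μ lam p ψ) = ip B (creEta L μ ζ)
      (funPT L (fun P T => 1 / (1 / M * ‖momentum L p - P‖ ^ 2 + T - lam)) (creEta L μ ψ)) := by
  rw [opH, ip_annEta hL hB]

lemma ip_opP {M L μ lam : ℝ} {p : Mode} {B : Finset Mode} (ζ : Amplitude) {ψ : Amplitude}
    (hψ : SupportedIn B ψ) : ip B ζ (opP M L μ lam p ψ) = (1 / L ^ 2 : ℂ) *
      ip B ζ (exchangePart M L lam p (particlesIn L μ B) (particlesIn L μ B) ψ) := by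
  rw [← ip_smul_right]
  refine ip_congr_right fun S hS => ?_
  rw [opP, tsum_particleModes_prod (B := B) (f := fun k l => cre l (funPT L (fun P T =>
      1 / (1 / M * ‖momentum L p - P - momentum L k - momentum L l‖ ^ 2 + T
        + kinetic L k + kinetic L l - lam)) (ann k ψ)) S)]
  · simp [exchangePart, Finset.sum_apply]
  · rintro k l (hk | hl)
    · simp [cre, funPT, ann_eq_zero hψ hk]
    · have : l ∉ S := fun h => hl (Finset.mem_powerset.1 hS h)
      simp [cre, this]

lemma nrm_smul (B : Finset Mode) (c : ℂ) (ψ : Amplitude) : nrm B (c • ψ) = ‖c‖ * nrm B ψ := by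
  rw [nrm, nrm, ← Real.sqrt_sq (norm_nonneg c), ← Real.sqrt_mul (by positivity), Finset.mul_sum]
  congr 1
  refine Finset.sum_congr rfl fun S _ => ?_
  rw [Pi.smul_apply, norm_smul, mul_pow]

/-- ‖η‖² is N(μ)/L², and L²μ ≥ 2 absorbs the additive 2 of the momentum count. -/
lemma nrm_creEta_le {L μ : ℝ} (hL : 0 < L) (hμ : 0 < μ) (hLμ : 2 ≤ L ^ 2 * μ) {B : Finset Mode}
    (hB : modesBelow L μ ⊆ B) (ψ : Amplitude) : nrm B (creEta L μ ψ) ≤ √(2 * μ) * nrm B ψ := by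
  have h1 := nrm_cre_le hB (fun _ => 1) ψ
  simp only [one_smul, norm_one, one_pow, Finset.sum_const, nsmul_eq_mul, mul_one] at h1
  rw [creEta_eq hL, nrm_smul]
  have h2 : ‖(1 / L : ℂ)‖ = 1 / L := by
    rw [← Complex.ofReal_one, ← Complex.ofReal_div, Complex.norm_real, Real.norm_eq_abs, abs_of_pos
      (by positivity)]
  have h3 : √((modesBelow L μ).card : ℝ) ≤ √(2 * μ) * L := by
    have e : √(2 * μ) * L = √(2 * μ * L ^ 2) := by
      rw [Real.sqrt_mul (by positivity) (L ^ 2), Real.sqrt_sq hL.le]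
    rw [e]
    refine Real.sqrt_le_sqrt ?_
    have := card_kinetic_le hL hμ.le (F := modesBelow L μ) fun n hn => (mem_modesBelow hL).1 hn
    nlinarith
  rw [h2]
  calc _ ≤ 1 / L * (√(2 * μ) * L * nrm B ψ) := by
        have := nrm_nonneg B ψ
        gcongr
        exact h1.trans (by gcongr)
    _ = _ := by field_simp

end

noncomputable section

open MeasureTheory Set

/-! ### Bounds relative to a momentum shell -/

/-- The standing assumptions on a shell of energy width `d` around the Fermi surface. -/
structure ShellRegime (M L μ lam d : ℝ) (B : Finset Mode) : Prop where
  M_pos : 0 < M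
  L_pos : 0 < L
  μ_pos : 0 < μ
  d_pos : 0 < d
  spacing_le : 2 * Real.pi / L * √μ ≤ d
  sq_spacing_le : (2 * Real.pi / L) ^ 2 ≤ μ
  two_le : 2 ≤ L ^ 2 * μ
  lam_lt : lam < fermiSeaEnergy L μ
  subset : modesBelow L μ ⊆ B

/-- The modes of `B` in the shell `μ < k² ≤ μ + d`. -/
def shellIn (L μ d : ℝ) (B : Finset Mode) : Finset Mode :=
  (particlesIn L μ B).filter fun k => kinetic L k ≤ μ + d

/-- The modes of `B` beyond the shell. -/
def farIn (L μ d : ℝ) (B : Finset Mode) : Finset Mode :=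
  (particlesIn L μ B).filter fun k => ¬ kinetic L k ≤ μ + d

/-- No mode beyond the shell is occupied. -/
def Inner (L μ d : ℝ) (S : Finset Mode) : Prop := ∀ k ∈ S, kinetic L k ≤ μ + d

lemma mem_shellIn {L μ d : ℝ} {B : Finset Mode} {k : Mode} :
    k ∈ shellIn L μ d B ↔ k ∈ particlesIn L μ B ∧ kinetic L k ≤ μ + d := Finset.mem_filter

lemma mem_farIn {L μ d : ℝ} {B : Finset Mode} {k : Mode} :
    k ∈ farIn L μ d B ↔ k ∈ particlesIn L μ B ∧ ¬ kinetic L k ≤ μ + d := Finset.mem_filter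

lemma shellIn_subset (L μ d : ℝ) (B : Finset Mode) : shellIn L μ d B ⊆ particlesIn L μ B :=
  Finset.filter_subset _ _

lemma farIn_subset (L μ d : ℝ) (B : Finset Mode) : farIn L μ d B ⊆ particlesIn L μ B :=
  Finset.filter_subset _ _

lemma particlesIn_subset (L μ : ℝ) (B : Finset Mode) : particlesIn L μ B ⊆ B :=
  Finset.filter_subset _ _

lemma ann_ne_zero {k : Mode} {ψ : Amplitude} {S : Finset Mode} (h : ann k ψ S ≠ 0) :
    k ∉ S ∧ ψ (insert k S) ≠ 0 :=
  ⟨fun hk => h (by simp [ann, hk]), fun h0 => h (by simp [ann, h0])⟩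

lemma ip_eq_zero_of_disjoint {B : Finset Mode} {ψ χ : Amplitude}
    (h : ∀ S, ψ S ≠ 0 → χ S = 0) : ip B ψ χ = 0 := by
  refine Finset.sum_eq_zero fun S _ => ?_
  by_cases h0 : ψ S = 0
  · simp [h0]
  · simp [h S h0]

namespace ShellRegime

variable {M L μ lam d : ℝ} {B : Finset Mode} {p : Mode} {ζ ψ : Amplitude}

lemma le_excitation_of_not_inner (h : ShellRegime M L μ lam d B) {S : Finset Mode}
    (hS : ¬ Inner L μ d S) : d ≤ excitation L μ S := by
  unfold Inner at hS
  push Not at hS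
  obtain ⟨k, hk, hkd⟩ := hS
  have := le_excitation (μ := μ) h.L_pos hk (by linarith [h.d_pos])
  linarith

lemma card_shellIn_le (h : ShellRegime M L μ lam d B) :
    ((shellIn L μ d B).card : ℝ) ≤ L ^ 2 * d :=
  card_kinetic_annulus_le h.L_pos h.sq_spacing_le h.spacing_le fun n hn => by
    rw [mem_shellIn, mem_particlesIn] at hn
    exact ⟨hn.1.2, hn.2⟩

lemma sqrt_shell_le (h : ShellRegime M L μ lam d B) {t : ℝ} (ht : 0 < t) :
    √(∑ k ∈ shellIn L μ d B, Real.exp (-(2 * t * (kinetic L k - μ)))) ≤ L * √d := by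
  have hL := h.L_pos
  have e : L * √d = √(L ^ 2 * d) := by rw [Real.sqrt_mul (by positivity) d, Real.sqrt_sq hL.le]
  rw [e]
  refine Real.sqrt_le_sqrt (le_trans ?_ h.card_shellIn_le)
  rw [← nsmul_one]
  refine Finset.sum_le_card_nsmul _ _ 1 fun k hk => Real.exp_le_one_iff.2 ?_
  rw [mem_shellIn, mem_particlesIn] at hk
  have : 0 ≤ 2 * t * (kinetic L k - μ) := mul_nonneg (by positivity) (by linarith [hk.1.2])
  linarith

/-- The linear count is used only at scales above d, hence `spacing_le`. The resulting t^{-1/2}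
e^{-td/2} is integrable with integral of order d^{-1/2}; against ‖a*(η)‖ ≤ √(2μ) this gives √(μ/d).
-/
lemma sqrt_far_le (h : ShellRegime M L μ lam d B) {t : ℝ} (ht : 0 < t) :
    √(∑ k ∈ farIn L μ d B, Real.exp (-(2 * t * (kinetic L k - μ)))) ≤
      L * √2 * (t ^ (-(1 / 2) : ℝ) * Real.exp (-(t * (d / 2)))) := by
  have hL := h.L_pos
  have h1 := sum_exp_le (farIn L μ d B) (fun k => kinetic L k - μ) (d := d) (A := L ^ 2) ht
    (by positivity) (fun k hk => by
      rw [mem_farIn] at hk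
      linarith [not_le.1 hk.2])
    (fun s hs => card_kinetic_annulus_le hL h.sq_spacing_le (h.spacing_le.trans hs.le)
      fun n hn => by
        rw [Finset.mem_filter, mem_farIn, mem_particlesIn] at hn
        exact ⟨hn.1.1.2, by linarith [hn.2]⟩)
  refine Real.sqrt_le_iff.2 ⟨by positivity, h1.trans (le_of_eq ?_)⟩
  have e1 : (t ^ (-(1 / 2) : ℝ)) ^ 2 = 1 / t := by
    rw [← Real.rpow_natCast, ← Real.rpow_mul ht.le,
      show (-(1 / 2) : ℝ) * ((2 : ℕ) : ℝ) = -1 by norm_num, Real.rpow_neg_one, one_div]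
  have e2 : Real.exp (-(t * (d / 2))) ^ 2 = Real.exp (-(t * d)) := by
    rw [← Real.exp_nat_mul]; congr 1; push_cast; ring
  rw [mul_pow, mul_pow, mul_pow, e1, e2, Real.sq_sqrt (by norm_num)]
  ring

lemma sqrt_two_pi_le : √(2 * Real.pi) ≤ 3 := by
  refine Real.sqrt_le_iff.2 ⟨by norm_num, ?_⟩
  nlinarith [Real.pi_lt_d2]

lemma sqrt_two_mul_mul_sqrt (h : ShellRegime M L μ lam d B) :
    √(2 * μ) * √(1 / d) = √2 * √(μ / d) := by
  have := h.μ_pos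
  have := h.d_pos
  rw [← Real.sqrt_mul (by positivity), ← Real.sqrt_mul (by positivity)]
  congr 1
  ring

lemma integral_far (h : ShellRegime M L μ lam d B) (c : ℝ) :
    IntegrableOn (fun t : ℝ => c * (t ^ (-(1 / 2) : ℝ) * Real.exp (-(t * (d / 2))))) (Ioi 0) ∧
    ∫ t in Ioi (0 : ℝ), c * (t ^ (-(1 / 2) : ℝ) * Real.exp (-(t * (d / 2)))) =
      c * (√(2 * Real.pi) * √(1 / d)) := by
  have hd := h.d_pos
  refine ⟨(integrableOn_rpow_neg_half_mul_exp (by positivity)).const_mul _, ?_⟩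
  rw [integral_const_mul, integral_rpow_neg_half_mul_exp (by positivity),
    ← Real.sqrt_mul (by positivity)]
  congr 2
  field_simp

lemma norm_one_div (hL : 0 < L) : ‖(1 / L : ℂ)‖ = 1 / L := by
  rw [← Complex.ofReal_one, ← Complex.ofReal_div, Complex.norm_real, Real.norm_eq_abs,
    abs_of_pos (by positivity)]

lemma norm_creation_far_le (h : ShellRegime M L μ lam d B)
    (hψ : ∀ S, ψ S ≠ 0 → S.card + 1 = particleNumber L μ) :
    ‖(1 / L : ℂ) * ip B (creEta L μ ζ) (creationPart M L lam p (farIn L μ d B) ψ)‖ ≤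
      6 * √(μ / d) * (nrm B ζ * nrm B ψ) := by
  have hL := h.L_pos
  have hi := h.integral_far (L * √2)
  have h1 := norm_ip_creation_le (p := p) (F := farIn L μ d B) (ζ := creEta L μ ζ) (w := 0)
    h.M_pos hL h.lam_lt ((farIn_subset _ _ _ _).trans (particlesIn_subset _ _ _))
    (fun k hk => (mem_particlesIn.1 (mem_farIn.1 hk).1).2)
    (fun S hS => ⟨hψ S hS, excitation_nonneg hL S⟩) hi.1
    (fun t ht => by simpa using h.sqrt_far_le ht)
  rw [hi.2] at h1
  have n1 := nrm_nonneg B ζ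
  have n2 := nrm_nonneg B ψ
  have h2 := nrm_creEta_le hL h.μ_pos h.two_le h.subset ζ
  rw [norm_mul, norm_one_div hL]
  calc _ ≤ 1 / L * (L * √2 * (√(2 * Real.pi) * √(1 / d)) *
        ((√(2 * μ) * nrm B ζ) * nrm B ψ)) := by
        gcongr
        exact h1.trans (by gcongr)
    _ = √2 * √(2 * Real.pi) * (√(2 * μ) * √(1 / d)) * (nrm B ζ * nrm B ψ) := by
      field_simp
    _ = √2 * √2 * √(2 * Real.pi) * √(μ / d) * (nrm B ζ * nrm B ψ) := by
      rw [h.sqrt_two_mul_mul_sqrt]; ring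
    _ ≤ 2 * 3 * √(μ / d) * (nrm B ζ * nrm B ψ) := by
      rw [Real.mul_self_sqrt (by norm_num)]
      gcongr
      exact sqrt_two_pi_le
    _ = _ := by ring

/-- A particle created in the shell yields no uniform decay in t. The factor e^{-td} comes instead
from the excitation energy of the outer configuration it is added to. -/
lemma norm_creation_shell_le (h : ShellRegime M L μ lam d B)
    (hψ : ∀ S, ψ S ≠ 0 → S.card + 1 = particleNumber L μ ∧ ¬ Inner L μ d S) :
    ‖(1 / L : ℂ) * ip B (creEta L μ ζ) (creationPart M L lam p (shellIn L μ d B) ψ)‖ ≤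
      2 * √(μ / d) * (nrm B ζ * nrm B ψ) := by
  have hL := h.L_pos
  have hd := h.d_pos
  have h1 := norm_ip_creation_le (p := p) (F := shellIn L μ d B) (ζ := creEta L μ ζ) (w := d)
    (g := fun t => L * √d * Real.exp (-(t * d)))
    h.M_pos hL h.lam_lt ((shellIn_subset _ _ _ _).trans (particlesIn_subset _ _ _))
    (fun k hk => (mem_particlesIn.1 (mem_shellIn.1 hk).1).2)
    (fun S hS => ⟨(hψ S hS).1, h.le_excitation_of_not_inner (hψ S hS).2⟩)
    ((integrableOn_exp_neg_mul hd).const_mul _)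
    (fun t ht => by
      rw [mul_comm]
      exact mul_le_mul_of_nonneg_right (h.sqrt_shell_le ht) (Real.exp_pos _).le)
  rw [integral_const_mul, integral_exp_neg_mul hd] at h1
  have n1 := nrm_nonneg B ζ
  have n2 := nrm_nonneg B ψ
  have h2 := nrm_creEta_le hL h.μ_pos h.two_le h.subset ζ
  have h3 : √d * (1 / d) = √(1 / d) := by
    rw [Real.sqrt_div' _ hd.le, Real.sqrt_one]
    field_simp
    rw [Real.sq_sqrt hd.le]
  rw [norm_mul, norm_one_div hL]
  calc _ ≤ 1 / L * (L * √d * (1 / d) * ((√(2 * μ) * nrm B ζ) * nrm B ψ)) := by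
        gcongr
        exact h1.trans (by gcongr)
    _ = √(2 * μ) * (√d * (1 / d)) * (nrm B ζ * nrm B ψ) := by
      field_simp
    _ = √2 * √(μ / d) * (nrm B ζ * nrm B ψ) := by
      rw [h3, h.sqrt_two_mul_mul_sqrt]
    _ ≤ _ := by
      gcongr
      exact Real.sqrt_le_iff.2 ⟨by norm_num, by norm_num⟩

lemma norm_one_div_sq (L : ℝ) : ‖(1 / L ^ 2 : ℂ)‖ = 1 / L ^ 2 := by
  rw [← Complex.ofReal_one, ← Complex.ofReal_pow, ← Complex.ofReal_div, Complex.norm_real,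
    Real.norm_eq_abs, abs_of_nonneg (by positivity)]

/-- The shell contributes L√d and the far modes integrate to a multiple of L d^{-1/2}, so the width
cancels. -/
lemma norm_exchange_mixed_le (h : ShellRegime M L μ lam d B) {F F' : Finset Mode}
    (hFF : F = shellIn L μ d B ∧ F' = farIn L μ d B ∨ F = farIn L μ d B ∧ F' = shellIn L μ d B)
    (hψ : ∀ S, ψ S ≠ 0 → S.card + 1 = particleNumber L μ) :
    ‖(1 / L ^ 2 : ℂ) * ip B ζ (exchangePart M L lam p F F' ψ)‖ ≤
      5 * (nrm B ζ * nrm B ψ) := by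
  have hL := h.L_pos
  have hd := h.d_pos
  have hi := h.integral_far (L * √d * (L * √2))
  have hsub : F ⊆ particlesIn L μ B ∧ F' ⊆ particlesIn L μ B := by
    rcases hFF with ⟨rfl, rfl⟩ | ⟨rfl, rfl⟩
    · exact ⟨shellIn_subset _ _ _ _, farIn_subset _ _ _ _⟩
    · exact ⟨farIn_subset _ _ _ _, shellIn_subset _ _ _ _⟩
  have h1 := norm_ip_exchange_le (p := p) (F := F) (F' := F') (ζ := ζ)
    h.M_pos hL h.lam_lt (hsub.1.trans (particlesIn_subset _ _ _))
    (fun k hk => (mem_particlesIn.1 (hsub.1 hk)).2)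
    (hsub.2.trans (particlesIn_subset _ _ _))
    (fun k hk => (mem_particlesIn.1 (hsub.2 hk)).2) hψ hi.1
    (fun t ht => by
      have a1 : Real.exp (-(t * (fermiSeaEnergy L μ - lam))) ≤ 1 := by
        have := h.lam_lt
        refine Real.exp_le_one_iff.2 (neg_nonpos.2 (mul_nonneg (le_of_lt ht) (by linarith)))
      have a2 : √(∑ k ∈ F', Real.exp (-(2 * t * (kinetic L k - μ)))) *
          √(∑ k ∈ F, Real.exp (-(2 * t * (kinetic L k - μ)))) ≤
          L * √d * (L * √2 * (t ^ (-(1 / 2) : ℝ) * Real.exp (-(t * (d / 2))))) := by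
        rcases hFF with ⟨rfl, rfl⟩ | ⟨rfl, rfl⟩
        · rw [mul_comm]
          exact mul_le_mul (h.sqrt_shell_le ht) (h.sqrt_far_le ht) (Real.sqrt_nonneg _)
            (by positivity)
        · exact mul_le_mul (h.sqrt_shell_le ht) (h.sqrt_far_le ht) (Real.sqrt_nonneg _)
            (by positivity)
      refine (mul_le_of_le_one_left (by positivity) a1).trans (a2.trans (le_of_eq (by ring))))
  rw [hi.2] at h1
  have n1 := nrm_nonneg B ζ
  have n2 := nrm_nonneg B ψ
  have h3 : √d * √(1 / d) = 1 := by
    rw [← Real.sqrt_mul hd.le, mul_one_div_cancel hd.ne', Real.sqrt_one]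
  have h4 : √2 * √(2 * Real.pi) ≤ 5 := by
    rw [← Real.sqrt_mul (by norm_num)]
    exact Real.sqrt_le_iff.2 ⟨by norm_num, by nlinarith [Real.pi_lt_d2]⟩
  rw [norm_mul, norm_one_div_sq]
  calc _ ≤ 1 / L ^ 2 * (L * √d * (L * √2) * (√(2 * Real.pi) * √(1 / d)) *
        (nrm B ζ * nrm B ψ)) := by
        gcongr
        exact h1
    _ = √2 * √(2 * Real.pi) * (√d * √(1 / d)) * (nrm B ζ * nrm B ψ) := by
      field_simp
    _ ≤ _ := by
      rw [h3, mul_one]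
      gcongr

/-- With F = F' the two square roots multiply to a plain sum of exponentials, whose Laplace integral
is a resolvent sum. No excitation energy is guaranteed here, so only E₀(μ) - λ regularizes it: this
is where the quantitative polaron energy is needed. -/
lemma norm_exchange_shell_le (h : ShellRegime M L μ lam d B) {s : ℝ}
    (hs : 2 * Real.pi / L * √μ ≤ s)
    (hψ : ∀ S, ψ S ≠ 0 → S.card + 1 = particleNumber L μ) :
    ‖(1 / L ^ 2 : ℂ) * ip B ζ (exchangePart M L lam p (shellIn L μ d B) (shellIn L μ d B) ψ)‖ ≤
      (s / (fermiSeaEnergy L μ - lam) + d / s) * (nrm B ζ * nrm B ψ) := by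
  have hL := h.L_pos
  have hd := h.d_pos
  have hμ := h.μ_pos
  have hE : 0 < fermiSeaEnergy L μ - lam := by linarith [h.lam_lt]
  have hs0 : 0 < s := lt_of_lt_of_le (by positivity) hs
  have hx : ∀ k ∈ shellIn L μ d B, 0 < kinetic L k - μ := fun k hk => by
    linarith [(mem_particlesIn.1 (mem_shellIn.1 hk).1).2]
  have hD : ∀ k ∈ shellIn L μ d B,
      0 < fermiSeaEnergy L μ - lam + 2 * (kinetic L k - μ) := fun k hk => by
    linarith [hx k hk]
  have hsub := (shellIn_subset L μ d B).trans (particlesIn_subset _ _ _)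
  have h1 := norm_ip_exchange_le (p := p) (F := shellIn L μ d B) (F' := shellIn L μ d B) (ζ := ζ)
    (g := fun t => ∑ k ∈ shellIn L μ d B,
      Real.exp (-(t * (fermiSeaEnergy L μ - lam + 2 * (kinetic L k - μ)))))
    h.M_pos hL h.lam_lt hsub (fun k hk => (mem_particlesIn.1 (mem_shellIn.1 hk).1).2)
    hsub (fun k hk => (mem_particlesIn.1 (mem_shellIn.1 hk).1).2) hψ
    (integrable_finsetSum _ fun k hk => integrableOn_exp_neg_mul (hD k hk))
    (fun t ht => by
      rw [Real.mul_self_sqrt (Finset.sum_nonneg fun _ _ => (Real.exp_pos _).le), Finset.mul_sum]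
      refine le_of_eq (Finset.sum_congr rfl fun k _ => ?_)
      rw [← Real.exp_add]; ring_nf)
  rw [integral_finsetSum _ fun k hk => integrableOn_exp_neg_mul (hD k hk),
    Finset.sum_congr rfl fun k hk => integral_exp_neg_mul (hD k hk)] at h1
  have h2 := sum_inv_add_le (shellIn L μ d B) (fun k => kinetic L k - μ) (A := L ^ 2) (D := d)
    hE hs0 hx h.card_shellIn_le (card_kinetic_annulus_le hL h.sq_spacing_le hs fun n hn => by
      rw [Finset.mem_filter, mem_shellIn, mem_particlesIn] at hn
      exact ⟨hn.1.1.2, by linarith [hn.2]⟩)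
  have h3 : ∑ k ∈ shellIn L μ d B, 1 / (fermiSeaEnergy L μ - lam + 2 * (kinetic L k - μ)) ≤
      ∑ k ∈ shellIn L μ d B, 1 / (fermiSeaEnergy L μ - lam + (kinetic L k - μ)) :=
    Finset.sum_le_sum fun k hk => one_div_le_one_div_of_le (by linarith [hx k hk])
      (by linarith [hx k hk])
  have n1 := nrm_nonneg B ζ
  have n2 := nrm_nonneg B ψ
  rw [norm_mul, norm_one_div_sq]
  calc _ ≤ 1 / L ^ 2 * (L ^ 2 * (s / (fermiSeaEnergy L μ - lam) + d / s) *
        (nrm B ζ * nrm B ψ)) := by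
        gcongr
        exact h1.trans (by gcongr; exact h3.trans h2)
    _ = _ := by field_simp

/-- After a*(η) there are N(μ) particles, so no chemical potential is left over, and the far
particle is still present; the resolvent is at most 1/d. -/
lemma norm_hole_le (h : ShellRegime M L μ lam d B)
    (hψ : ∀ S, ψ S ≠ 0 → S.card + 1 = particleNumber L μ ∧ ¬ Inner L μ d S) :
    ‖ip B (creEta L μ ψ) (funPT L (fun P T => 1 / (1 / M * ‖momentum L p - P‖ ^ 2 + T - lam))
      (creEta L μ ψ))‖ ≤ 2 * (μ / d) * nrm B ψ ^ 2 := by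
  have hL := h.L_pos
  have hd := h.d_pos
  have hM := h.M_pos
  have hμ := h.μ_pos
  have n2 := nrm_nonneg B ψ
  have h2 := nrm_creEta_le hL hμ h.two_le h.subset ψ
  have h3 : nrm B (funPT L (fun P T => 1 / (1 / M * ‖momentum L p - P‖ ^ 2 + T - lam))
      (creEta L μ ψ)) ≤ 1 / d * nrm B (creEta L μ ψ) := by
    refine nrm_mul_le (by positivity) fun S _ hS => ?_
    obtain ⟨k, hk, hkS, h0⟩ := creEta_apply_ne_zero hL hS
    obtain ⟨hc, hin⟩ := hψ _ h0
    rw [Finset.card_erase_add_one hkS] at hc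
    have hin' : ¬ Inner L μ d S := fun hS => hin fun l hl => hS l (Finset.mem_of_mem_erase hl)
    have hex := h.le_excitation_of_not_inner hin'
    have hD : d ≤ 1 / M * ‖momentum L p - totalMomentum L S‖ ^ 2 + totalKinetic L S - lam := by
      rw [totalKinetic_eq (μ := μ) hL, hc, sub_self, zero_mul, add_zero]
      have : 0 ≤ 1 / M * ‖momentum L p - totalMomentum L S‖ ^ 2 := by positivity
      linarith [h.lam_lt]
    rw [Complex.norm_real, Real.norm_eq_abs, abs_of_nonneg (one_div_nonneg.2 (hd.le.trans hD))]
    exact one_div_le_one_div_of_le hd hD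
  refine (norm_ip_le _ _ _).trans ?_
  have n3 := nrm_nonneg B (creEta L μ ψ)
  calc _ ≤ nrm B (creEta L μ ψ) * (1 / d * nrm B (creEta L μ ψ)) := by gcongr
    _ = 1 / d * nrm B (creEta L μ ψ) ^ 2 := by ring
    _ ≤ 1 / d * (√(2 * μ) * nrm B ψ) ^ 2 := by gcongr
    _ = _ := by rw [mul_pow, Real.sq_sqrt (by positivity)]; ring

end ShellRegime

end

noncomputable section

open MeasureTheory Set

/-! ### Vanishing of forms between inner and outer configurations -/

section

variable {M L μ lam d : ℝ} {B F F' : Finset Mode} {p : Mode} {ζ ψ χ ξ : Amplitude}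

lemma ip_cre_funPT_eq_zero {f : EuclideanSpace ℝ (Fin 2) → ℝ → ℝ} {k : Mode} (hk : k ∈ B)
    (h : ∀ S, ann k ζ S ≠ 0 → ψ S = 0) : ip B ζ (cre k (funPT L f ψ)) = 0 := by
  rw [cre_funPT_eq _ _ _ _ _ hk]
  refine Finset.sum_eq_zero fun S _ => ?_
  by_cases h0 : ann k ζ S = 0
  · simp [h0]
  · simp [h S h0]

lemma ip_creationPart_subset (hF : F ⊆ F') (hB : F' ⊆ B)
    (h : ∀ k ∈ F', k ∉ F → ∀ S, ann k ζ S ≠ 0 → ψ S = 0) :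
    ip B ζ (creationPart M L lam p F' ψ) = ip B ζ (creationPart M L lam p F ψ) := by
  rw [creationPart, creationPart, ip_sum_right, ip_sum_right]
  refine (Finset.sum_subset hF fun k hk hk' => ?_).symm
  exact ip_cre_funPT_eq_zero (hB hk) (h k hk hk')

lemma ip_exchangePart_subset {B F F' K : Finset Mode} (hF : F ⊆ K) (hF' : F' ⊆ K) (hB : K ⊆ B)
    (h : ∀ k ∈ K, ∀ l ∈ K, ¬ (k ∈ F ∧ l ∈ F') → ∀ S, ann l ζ S ≠ 0 → ann k ψ S = 0) :
    ip B ζ (exchangePart M L lam p K K ψ) = ip B ζ (exchangePart M L lam p F F' ψ) := by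
  simp only [exchangePart, ip_sum_right]
  rw [← Finset.sum_product', ← Finset.sum_product']
  refine (Finset.sum_subset (Finset.product_subset_product hF hF') fun x hx hx' => ?_).symm
  rw [Finset.mem_product] at hx hx'
  exact ip_cre_funPT_eq_zero (hB hx.2) (h _ hx.1 _ hx.2 hx')

lemma inner_insert {k : Mode} {S : Finset Mode} :
    Inner L μ d (insert k S) ↔ kinetic L k ≤ μ + d ∧ Inner L μ d S := by
  simp [Inner]

/-- Adding a sea momentum cannot change whether a mode beyond the shell is occupied. -/
lemma creEta_inner_iff (hL : 0 < L) (hd : 0 < d) {S : Finset Mode} (h : creEta L μ ψ S ≠ 0) :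
    ∃ S', ψ S' ≠ 0 ∧ (Inner L μ d S ↔ Inner L μ d S') := by
  obtain ⟨k, hk, hkS, h0⟩ := creEta_apply_ne_zero hL h
  refine ⟨_, h0, ?_⟩
  have hk := (mem_modesBelow hL).1 hk
  conv_lhs => rw [← Finset.insert_erase hkS]
  rw [inner_insert, and_iff_right (by linarith)]

namespace ShellRegime

lemma hole_cross (h : ShellRegime M L μ lam d B) (hχ : ∀ S, χ S ≠ 0 → Inner L μ d S)
    (hξ : ∀ S, ξ S ≠ 0 → ¬ Inner L μ d S) (f : EuclideanSpace ℝ (Fin 2) → ℝ → ℝ) :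
    ip B (creEta L μ χ) (funPT L f (creEta L μ ξ)) = 0 := by
  refine ip_eq_zero_of_disjoint fun S hS => ?_
  obtain ⟨S', h1, h2⟩ := creEta_inner_iff (d := d) h.L_pos h.d_pos hS
  have : creEta L μ ξ S = 0 := by
    by_contra hc
    obtain ⟨S'', h3, h4⟩ := creEta_inner_iff (d := d) h.L_pos h.d_pos hc
    exact hξ _ h3 (h4.1 (h2.2 (hχ _ h1)))
  simp [funPT, this]

/-- Creation cannot empty a mode beyond the shell, so A* never leads from outer to inner
configurations. In the opposite direction, treated next, the created mode must itself be far. -/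
lemma creation_cross_inner (h : ShellRegime M L μ lam d B) (hχ : ∀ S, χ S ≠ 0 → Inner L μ d S)
    (hξ : ∀ S, ξ S ≠ 0 → ¬ Inner L μ d S) :
    ip B (creEta L μ χ) (creationPart M L lam p (particlesIn L μ B) ξ) = 0 := by
  rw [ip_creationPart_subset (Finset.empty_subset _) (particlesIn_subset _ _ _)]
  · simp [creationPart, ip]
  · intro k _ _ S hS
    obtain ⟨hkS, h0⟩ := ann_ne_zero hS
    obtain ⟨S', h1, h2⟩ := creEta_inner_iff (d := d) h.L_pos h.d_pos h0
    by_contra hc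
    exact hξ _ hc (inner_insert.1 (h2.2 (hχ _ h1))).2

lemma creation_cross_outer (h : ShellRegime M L μ lam d B) (hχ : ∀ S, χ S ≠ 0 → Inner L μ d S)
    (hξ : ∀ S, ξ S ≠ 0 → ¬ Inner L μ d S) :
    ip B (creEta L μ ξ) (creationPart M L lam p (particlesIn L μ B) χ) =
      ip B (creEta L μ ξ) (creationPart M L lam p (farIn L μ d B) χ) := by
  refine ip_creationPart_subset (farIn_subset _ _ _ _) (particlesIn_subset _ _ _) ?_
  intro k hk hkF S hS
  obtain ⟨hkS, h0⟩ := ann_ne_zero hS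
  obtain ⟨S', h1, h2⟩ := creEta_inner_iff (d := d) h.L_pos h.d_pos h0
  by_contra hc
  have hkd : kinetic L k ≤ μ + d := by
    by_contra hkd
    exact hkF (mem_farIn.2 ⟨hk, hkd⟩)
  exact hξ _ h1 (h2.1 (inner_insert.2 ⟨hkd, hχ _ hc⟩))

lemma creation_split (ζ ψ : Amplitude) :
    ip B ζ (creationPart M L lam p (particlesIn L μ B) ψ) =
      ip B ζ (creationPart M L lam p (shellIn L μ d B) ψ) +
        ip B ζ (creationPart M L lam p (farIn L μ d B) ψ) := by
  rw [← ip_add_right, creationPart, creationPart, creationPart, shellIn, farIn,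
    Finset.sum_filter_add_sum_filter_not]

lemma exchange_inner_inner (hχ : ∀ S, χ S ≠ 0 → Inner L μ d S) :
    ip B χ (exchangePart M L lam p (particlesIn L μ B) (particlesIn L μ B) χ) =
      ip B χ (exchangePart M L lam p (shellIn L μ d B) (shellIn L μ d B) χ) := by
  refine ip_exchangePart_subset (shellIn_subset _ _ _ _) (shellIn_subset _ _ _ _)
    (particlesIn_subset _ _ _) fun k hk l hl hkl S hS => ?_
  by_contra hc
  have h1 := inner_insert.1 (hχ _ (ann_ne_zero hS).2)
  have h2 := inner_insert.1 (hχ _ (ann_ne_zero hc).2)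
  exact hkl ⟨mem_shellIn.2 ⟨hk, h2.1⟩, mem_shellIn.2 ⟨hl, h1.1⟩⟩

/-- Passing from outer to inner by one exchange means removing the only far particle and creating
one in the shell; the next lemma is the reverse passage. -/
lemma exchange_inner_outer (hχ : ∀ S, χ S ≠ 0 → Inner L μ d S)
    (hξ : ∀ S, ξ S ≠ 0 → ¬ Inner L μ d S) :
    ip B χ (exchangePart M L lam p (particlesIn L μ B) (particlesIn L μ B) ξ) =
      ip B χ (exchangePart M L lam p (farIn L μ d B) (shellIn L μ d B) ξ) := by
  refine ip_exchangePart_subset (farIn_subset _ _ _ _) (shellIn_subset _ _ _ _)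
    (particlesIn_subset _ _ _) fun k hk l hl hkl S hS => ?_
  by_contra hc
  have h1 := inner_insert.1 (hχ _ (ann_ne_zero hS).2)
  have h2 := hξ _ (ann_ne_zero hc).2
  exact hkl ⟨mem_farIn.2 ⟨hk, fun hkd => h2 (inner_insert.2 ⟨hkd, h1.2⟩)⟩,
    mem_shellIn.2 ⟨hl, h1.1⟩⟩

lemma exchange_outer_inner (hχ : ∀ S, χ S ≠ 0 → Inner L μ d S)
    (hξ : ∀ S, ξ S ≠ 0 → ¬ Inner L μ d S) :
    ip B ξ (exchangePart M L lam p (particlesIn L μ B) (particlesIn L μ B) χ) =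
      ip B ξ (exchangePart M L lam p (shellIn L μ d B) (farIn L μ d B) χ) := by
  refine ip_exchangePart_subset (shellIn_subset _ _ _ _) (farIn_subset _ _ _ _)
    (particlesIn_subset _ _ _) fun k hk l hl hkl S hS => ?_
  by_contra hc
  have h1 := hξ _ (ann_ne_zero hS).2
  have h2 := inner_insert.1 (hχ _ (ann_ne_zero hc).2)
  exact hkl ⟨mem_shellIn.2 ⟨hk, h2.1⟩,
    mem_farIn.2 ⟨hl, fun hld => h1 (inner_insert.2 ⟨hld, h2.2⟩)⟩⟩

end ShellRegime

/-! ### Linearity -/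

lemma cre_add (k : Mode) (ψ χ : Amplitude) : cre k (ψ + χ) = cre k ψ + cre k χ := by
  funext S
  simp only [cre, Pi.add_apply]
  split_ifs <;> ring

lemma ann_add (k : Mode) (ψ χ : Amplitude) : ann k (ψ + χ) = ann k ψ + ann k χ := by
  funext S
  simp only [ann, Pi.add_apply]
  split_ifs <;> ring

lemma funPT_add (L : ℝ) (f : EuclideanSpace ℝ (Fin 2) → ℝ → ℝ) (ψ χ : Amplitude) :
    funPT L f (ψ + χ) = funPT L f ψ + funPT L f χ := by
  funext S
  simp only [funPT, Pi.add_apply]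
  ring

lemma creEta_add (hL : 0 < L) (ψ χ : Amplitude) :
    creEta L μ (ψ + χ) = creEta L μ ψ + creEta L μ χ := by
  simp only [creEta_eq hL, cre_add, Finset.sum_add_distrib, smul_add]

lemma creationPart_add (ψ χ : Amplitude) : creationPart M L lam p F (ψ + χ) =
    creationPart M L lam p F ψ + creationPart M L lam p F χ := by
  simp only [creationPart, funPT_add, cre_add, Finset.sum_add_distrib]

lemma exchangePart_add (ψ χ : Amplitude) : exchangePart M L lam p F F' (ψ + χ) =
    exchangePart M L lam p F F' ψ + exchangePart M L lam p F F' χ := by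
  simp only [exchangePart, funPT_add, cre_add, ann_add, Finset.sum_add_distrib]

end

/-! ### The form inequality -/

lemma re_add_conj (z : ℂ) : (z + (starRingEnd ℂ) z).re = 2 * z.re := by
  rw [Complex.add_re, Complex.conj_re]; ring

/-- The localized forms differ from the full form by the controlled terms. -/
lemma ShellRegime.form_le {M L μ EB lam d s cχ cξ : ℝ} {B : Finset Mode} {p : Mode}
    {χ ξ : Amplitude} (h : ShellRegime M L μ lam d B)
    (hs : 2 * Real.pi / L * √μ ≤ s)
    (hχB : SupportedIn B χ) (hξB : SupportedIn B ξ)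
    (hχ : ∀ S, χ S ≠ 0 → S.card + 1 = particleNumber L μ ∧ Inner L μ d S)
    (hξ : ∀ S, ξ S ≠ 0 → S.card + 1 = particleNumber L μ ∧ ¬ Inner L μ d S)
    (hfin : ∀ x y : ℝ, 0 ≤ x → 0 ≤ y →
      2 * (μ / d) * y ^ 2 + 2 * (6 * √(μ / d) * (x * y)) + 2 * (8 * √(μ / d) * y ^ 2) +
        (s / (fermiSeaEnergy L μ - lam) + d / s) * x ^ 2 + 10 * (x * y) ≤
        cχ * x ^ 2 + cξ * y ^ 2) :
    (ip B χ (opG M L μ EB lam p χ - opH M L μ lam p χ - opX M L μ lam p χ - (cχ : ℂ) • χ)).re +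
      (ip B ξ (opG M L μ EB lam p ξ + opP M L μ lam p ξ - (cξ : ℂ) • ξ)).re ≤
      (ip B (χ + ξ) (phi M L μ EB lam p (χ + ξ))).re := by
  have hL := h.L_pos
  have hχi : ∀ S, χ S ≠ 0 → Inner L μ d S := fun S hS => (hχ S hS).2
  have hξi : ∀ S, ξ S ≠ 0 → ¬ Inner L μ d S := fun S hS => (hξ S hS).2
  have hχc : ∀ S, χ S ≠ 0 → S.card + 1 = particleNumber L μ := fun S hS => (hχ S hS).1
  have hξc : ∀ S, ξ S ≠ 0 → S.card + 1 = particleNumber L μ := fun S hS => (hξ S hS).1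
  have hsum : SupportedIn B (χ + ξ) := by
    intro S hS
    by_cases h0 : χ S = 0
    · exact hξB S fun h1 => hS (by simp [h0, h1])
    · exact hχB S h0
  -- the diagonal part
  have g1 : ip B χ (opG M L μ EB lam p ξ) = 0 := ip_eq_zero_of_disjoint fun S hS => by
    have : ξ S = 0 := by
      by_contra hc
      exact hξi S hc (hχi S hS)
    simp [opG, funPT, this]
  have g2 : ip B ξ (opG M L μ EB lam p χ) = 0 := ip_eq_zero_of_disjoint fun S hS => by
    have : χ S = 0 := by
      by_contra hc
      exact hξi S hS (hχi S hc)
    simp [opG, funPT, this]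
  have G : ip B (χ + ξ) (opG M L μ EB lam p (χ + ξ)) =
      ip B χ (opG M L μ EB lam p χ) + ip B ξ (opG M L μ EB lam p ξ) := by
    have e : opG M L μ EB lam p (χ + ξ) = opG M L μ EB lam p χ + opG M L μ EB lam p ξ :=
      funPT_add _ _ _ _
    rw [e, ip_add_left, ip_add_right, ip_add_right, g1, g2]; ring
  -- the hole part
  have H : ip B (χ + ξ) (opH M L μ lam p (χ + ξ)) =
      ip B χ (opH M L μ lam p χ) + ip B ξ (opH M L μ lam p ξ) := by
    have H0 : ∀ f, ip B (creEta L μ ξ) (funPT L f (creEta L μ χ)) = 0 := fun f => by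
      rw [← ip_funPT_left, ← conj_ip, h.hole_cross hχi hξi, map_zero]
    rw [ip_opH hL h.subset, ip_opH hL h.subset, ip_opH hL h.subset, creEta_add hL, funPT_add,
      ip_add_left, ip_add_right, ip_add_right, h.hole_cross hχi hξi, H0]
    ring
  have H' := h.norm_hole_le (p := p) hξ
  rw [← ip_opH hL h.subset] at H'
  -- the mixed part
  set X : Amplitude → Amplitude → ℂ := fun a b => (1 / L : ℂ) *
    ip B (creEta L μ a) (creationPart M L lam p (particlesIn L μ B) b) with hX
  have X1 : ∀ a, SupportedIn B a → (ip B a (opX M L μ lam p a)).re = 2 * (X a a).re := by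
    intro a ha
    rw [ip_opX hL h.subset _ ha, re_add_conj]
  have X2 : X (χ + ξ) (χ + ξ) = X χ χ + X ξ χ + X ξ ξ := by
    have : X χ ξ = 0 := by
      simp only [hX, h.creation_cross_inner hχi hξi, mul_zero]
    have e : X (χ + ξ) (χ + ξ) = X χ χ + X χ ξ + X ξ χ + X ξ ξ := by
      simp only [hX, creEta_add hL, creationPart_add, ip_add_left, ip_add_right]
      ring
    rw [e, this, add_zero]
  have X3 : ‖X ξ χ‖ ≤ 6 * √(μ / d) * (nrm B ξ * nrm B χ) := by
    simp only [hX, h.creation_cross_outer hχi hξi]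
    exact h.norm_creation_far_le hχc
  have X4 : ‖X ξ ξ‖ ≤ 8 * √(μ / d) * (nrm B ξ * nrm B ξ) := by
    simp only [hX, ShellRegime.creation_split (d := d), mul_add]
    refine (norm_add_le _ _).trans ((add_le_add (h.norm_creation_shell_le hξ)
      (h.norm_creation_far_le hξc)).trans (le_of_eq (by ring)))
  -- the exchange part
  set P : Amplitude → Amplitude → ℂ := fun a b => (1 / L ^ 2 : ℂ) *
    ip B a (exchangePart M L lam p (particlesIn L μ B) (particlesIn L μ B) b) with hP
  have P1 : ∀ a b, SupportedIn B b → ip B a (opP M L μ lam p b) = P a b := fun a b hb =>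
    ip_opP a hb
  have P2 : P (χ + ξ) (χ + ξ) = P χ χ + P χ ξ + P ξ χ + P ξ ξ := by
    simp only [hP, exchangePart_add, ip_add_left, ip_add_right]
    ring
  have P3 : ‖P χ χ‖ ≤ (s / (fermiSeaEnergy L μ - lam) + d / s) * (nrm B χ * nrm B χ) := by
    simp only [hP, ShellRegime.exchange_inner_inner hχi]
    exact h.norm_exchange_shell_le hs hχc
  have P4 : ‖P χ ξ‖ ≤ 5 * (nrm B χ * nrm B ξ) := by
    simp only [hP, ShellRegime.exchange_inner_outer hχi hξi]
    exact h.norm_exchange_mixed_le (Or.inr ⟨rfl, rfl⟩) hξc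
  have P5 : ‖P ξ χ‖ ≤ 5 * (nrm B ξ * nrm B χ) := by
    simp only [hP, ShellRegime.exchange_outer_inner hχi hξi]
    exact h.norm_exchange_mixed_le (Or.inl ⟨rfl, rfl⟩) hχc
  -- P between ξ and ξ stays in the localized form, so it needs no bound; `hfin` absorbs all the
  -- others.
  have f1 := hfin (nrm B χ) (nrm B ξ) (nrm_nonneg _ _) (nrm_nonneg _ _)
  have r1 := Complex.abs_re_le_norm (ip B ξ (opH M L μ lam p ξ))
  have r2 := Complex.abs_re_le_norm (X ξ χ)
  have r3 := Complex.abs_re_le_norm (X ξ ξ)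
  have r4 := Complex.abs_re_le_norm (P χ χ)
  have r5 := Complex.abs_re_le_norm (P χ ξ)
  have r6 := Complex.abs_re_le_norm (P ξ χ)
  rw [abs_le] at r1 r2 r3 r4 r5 r6
  have x1 := X1 _ hsum
  rw [X2] at x1
  simp only [phi, ip_sub_right, ip_add_right, Complex.sub_re, Complex.add_re, ip_smul_right,
    ip_self, P1 _ _ hsum, P1 _ _ hξB, G, H, P2, x1, X1 _ hχB, ← Complex.ofReal_mul,
    Complex.ofReal_re]
  linarith [r1.2, r2.2, r3.2, r4.1, r5.1, r6.1]

end

noncomputable section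

/-! ### Localization -/

/-- Here u = √ε, a = ε^{-1/2} and v = √ℓ, so the coefficients on the right are ε⁻¹ and K. In X =
x/√ε the budget X² is spent as 1/4 + 1/4 on the mixed terms, by Young's inequality, and 1/2 on the
inner exchange. The y² terms match the three summands of K. -/
lemma final_quadratic_le {u a v C x y : ℝ} (hu : 0 < u) (hua : u * a = 1) (hv : 0 ≤ v)
    (hu10 : u ≤ 1 / 10) (hC : u * C ≤ 1 / 2) :
    2 * (u ^ 2 * v ^ 2) * y ^ 2 + 2 * (6 * (u * v) * (x * y)) + 2 * (8 * (u * v) * y ^ 2) +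
      a * C * x ^ 2 + 10 * (x * y) ≤ a ^ 2 * x ^ 2 + a * (a + v + u ^ 2 * v ^ 2) * y ^ 2 := by
  have ha : 0 < a := by
    rcases lt_trichotomy a 0 with h | h | h
    · nlinarith
    · subst h; norm_num at hua
    · exact h
  have ha10 : 10 ≤ a := by nlinarith
  have hx : x = u * (a * x) := by rw [← mul_assoc, hua, one_mul]
  set X := a * x with hX
  have e1 : 2 * (6 * (u * v) * (x * y)) ≤ X ^ 2 / 4 + 144 * u ^ 4 * v ^ 2 * y ^ 2 := by
    rw [hx]; nlinarith [sq_nonneg (X / 2 - 12 * u ^ 2 * v * y)]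
  have e2 : 10 * (x * y) ≤ X ^ 2 / 4 + 100 * u ^ 2 * y ^ 2 := by
    rw [hx]; nlinarith [sq_nonneg (X / 2 - 10 * u * y)]
  have e3 : a * C * x ^ 2 ≤ X ^ 2 / 2 := by
    have : a * C * x ^ 2 = u * C * X ^ 2 := by rw [hX]; linear_combination (-a * C * x ^ 2) * hua
    rw [this]; nlinarith [sq_nonneg X]
  have e4 : a * (u ^ 2 * v ^ 2) = u * v ^ 2 := by linear_combination (u * v ^ 2) * hua
  have e5 : a ^ 2 * x ^ 2 = X ^ 2 := by rw [hX]; ring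
  have c1 : 2 * u ^ 2 + 144 * u ^ 4 ≤ u := by
    have : u ^ 2 ≤ u / 10 := by nlinarith
    have : u ^ 4 ≤ u / 1000 := by
      calc u ^ 4 = u ^ 2 * u ^ 2 := by ring
        _ ≤ (u / 10) * (u / 10) := by gcongr
        _ = u ^ 2 / 100 := by ring
        _ ≤ u / 1000 := by linarith
    linarith
  have c2 : 16 * u ≤ a := by linarith
  have c3 : 100 * u ^ 2 ≤ a ^ 2 := by nlinarith
  have d1 : (2 * u ^ 2 + 144 * u ^ 4) * (v ^ 2 * y ^ 2) ≤ u * (v ^ 2 * y ^ 2) := by gcongr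
  have d2 : 16 * u * (v * y ^ 2) ≤ a * (v * y ^ 2) := by gcongr
  have d3 : 100 * u ^ 2 * y ^ 2 ≤ a ^ 2 * y ^ 2 := by gcongr
  have e6 : a * (a + v + u ^ 2 * v ^ 2) * y ^ 2 =
      a ^ 2 * y ^ 2 + a * (v * y ^ 2) + u * (v ^ 2 * y ^ 2) := by
    linear_combination y ^ 2 * e4
  rw [e5, e6]
  linarith

variable {L μ EB ε : ℝ}

lemma mem_hole_union_shell_iff {d : ℝ} (hd : 0 < d)
    (hshell : (1 + 1 / (ε * Real.log (μ / |EB|))) * μ = μ + d) {k : Mode} :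
    k ∈ holeModes L μ ∪ shellModes L μ EB ε ↔ kinetic L k ≤ μ + d := by
  simp only [Set.mem_union, holeModes, shellModes, Set.mem_ofPred_eq, hshell]
  constructor
  · rintro (h | h)
    · linarith
    · exact h.2
  · intro h
    rcases le_or_gt (kinetic L k) μ with h' | h'
    · exact Or.inl h'
    · exact Or.inr ⟨h', h⟩

lemma proj_apply {d : ℝ} (hd : 0 < d)
    (hshell : (1 + 1 / (ε * Real.log (μ / |EB|))) * μ = μ + d) (ψ : Amplitude) (S : Finset Mode) :
    (Inner L μ d S → proj L μ EB ε ψ S = ψ S) ∧ (¬ Inner L μ d S → proj L μ EB ε ψ S = 0) := by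
  have h : (∀ k ∈ S, k ∈ holeModes L μ ∪ shellModes L μ EB ε) ↔ Inner L μ d S :=
    forall₂_congr fun k _ => mem_hole_union_shell_iff hd hshell
  exact ⟨fun hS => if_pos (h.2 hS), fun hS => if_neg fun hc => hS (h.1 hc)⟩

lemma ip_proj_right (B : Finset Mode) (ψ v : Amplitude) :
    ip B ψ (proj L μ EB ε v) = ip B (proj L μ EB ε ψ) v := by
  refine Finset.sum_congr rfl fun S _ => ?_
  simp only [proj]
  split_ifs <;> simp

lemma ip_projPerp_right (B : Finset Mode) (ψ v : Amplitude) :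
    ip B ψ (projPerp L μ EB ε v) = ip B (projPerp L μ EB ε ψ) v := by
  refine Finset.sum_congr rfl fun S _ => ?_
  simp only [projPerp, proj, Pi.sub_apply]
  split_ifs <;> simp

end

end FermiPolaron

/-! ### Choice of constants and conclusion -/

open FermiPolaron in
theorem mainTheorem2 (M : ℝ) (hM : 0 < M) :
    ∃ c₀ ε₀ : ℝ, 0 < c₀ ∧ 0 < ε₀ ∧
      ∀ L μ EB : ℝ, 0 < L → 0 < μ → EB < 0 → 1 ≤ L ^ 2 * |EB| → c₀ ≤ μ / |EB| →
        ∀ ε : ℝ, 0 < ε → ε < ε₀ →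
          ∀ p : FermiPolaron.Mode, ∀ lam : ℝ,
            lam ≤ FermiPolaron.fermiSeaEnergy L μ + FermiPolaron.polaronEnergy M L μ EB →
            FermiPolaron.OperatorLE (FermiPolaron.particleNumber L μ - 1)
              (fun ψ => FermiPolaron.Phi M L μ EB lam ε p ψ + FermiPolaron.Psi M L μ EB lam ε p ψ)
              (fun ψ => FermiPolaron.phi M L μ EB lam p ψ) := by
  obtain ⟨c₂, c₁, hc₁, hpol⟩ := exists_polaronEnergy_le hM
  obtain ⟨c₃, h40, hlarge⟩ := exists_log_large 1
  set C : ℝ := 1 / c₁ + 1 with hC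
  have hC0 : 0 < C := by positivity
  -- The 100 ensures √ε ≤ 1/10 and the 4C² ensures √ε C ≤ 1/2, the two smallness conditions of
  -- `final_quadratic_le`.
  refine ⟨max c₂ c₃, 1 / (100 + 4 * C ^ 2), lt_of_lt_of_le (by linarith) (le_max_right _ _),
    by positivity, ?_⟩
  intro L μ EB hL hμ hEB hLb hμb ε hε hεlt p lam hlam ψ hψ
  have hpe := hpol L μ EB hL hμ hEB hLb ((le_max_left _ _).trans hμb)
  have hx := (le_max_right _ _).trans hμb
  obtain ⟨hlog, hℓ⟩ := hlarge _ hx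
  have hb : 0 < |EB| := abs_pos.2 hEB.ne
  set ℓ := Real.log (μ / |EB|) with hℓdef
  have hℓ0 : 0 < ℓ := by linarith
  rw [lt_div_iff₀ (by positivity)] at hεlt
  set u := √ε with hu
  have hu0 : 0 < u := Real.sqrt_pos.2 hε
  have huu : u ^ 2 = ε := Real.sq_sqrt hε.le
  have hu10 : u ≤ 1 / 10 := Real.sqrt_le_iff.2 ⟨by norm_num, by nlinarith [sq_nonneg C]⟩
  have huC : u * C ≤ 1 / 2 := by
    refine le_of_sq_le_sq ?_ (by norm_num)
    rw [mul_pow, huu]; nlinarith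
  have hε1 : ε ≤ 1 := by nlinarith
  set d := μ / (ε * ℓ) with hd
  -- The geometric mean of d and μ/ℓ: with E ≥ c₁μ/ℓ both s/E and d/s are O(ε^{-1/2}).
  set s := μ / (u * ℓ) with hs
  have hd0 : 0 < d := by positivity
  have hshell : (1 + 1 / (ε * ℓ)) * μ = μ + d := by rw [hd]; ring
  set N := particleNumber L μ with hN
  -- The zero momentum lies in the sea, so the natural-number subtraction N(μ) - 1 does not
  -- truncate.
  have hN1 : 1 ≤ N := by
    rw [hN, particleNumber_eq hL, Nat.one_le_iff_ne_zero, Finset.card_ne_zero]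
    refine ⟨(0, 0), (mem_modesBelow hL).2 ?_⟩
    rw [kinetic_eq]; simp [hμ.le]
  obtain ⟨hfinite, hcard⟩ := hψ
  set B : Finset Mode := modesBelow L μ ∪ hfinite.toFinset.biUnion id with hB
  have hψB : SupportedIn B ψ := fun S hS => by
    refine Finset.subset_union_right.trans' ?_
    exact Finset.subset_biUnion_of_mem id (by simpa using hS)
  have hψN : ∀ S, ψ S ≠ 0 → S.card + 1 = N := fun S hS => by
    rw [hcard S hS]; omega
  have hspace : ∀ r : ℝ, 0 < r → r ≤ 1 → 2 * Real.pi / L * √μ ≤ μ / (r * ℓ) := fun r hr hr1 => by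
    refine lattice_spacing_mul_sqrt_le hL hμ hb hLb (by positivity) (le_trans ?_ hlog)
    rw [mul_pow]
    have : r ^ 2 ≤ 1 := by nlinarith
    nlinarith [sq_nonneg ℓ]
  have hE : c₁ * μ / ℓ ≤ fermiSeaEnergy L μ - lam := by linarith
  have hE0 : 0 < c₁ * μ / ℓ := by positivity
  have h : ShellRegime M L μ lam d B :=
    { M_pos := hM
      L_pos := hL
      μ_pos := hμ
      d_pos := hd0
      spacing_le := hspace ε hε hε1
      sq_spacing_le := by
        simpa using sq_lattice_spacing_le (ℓ := 1) hL hb hLb zero_le_one (by linarith)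
      two_le := by
        have : 40 * |EB| ≤ μ := by rw [← le_div_iff₀ hb]; linarith
        nlinarith [mul_le_mul_of_nonneg_left this (sq_nonneg L)]
      lam_lt := by linarith
      subset := Finset.subset_union_left }
  set χ := proj L μ EB ε ψ with hχ
  set ξ := projPerp L μ EB ε ψ with hξ
  have hχS : ∀ S, χ S ≠ 0 → ψ S ≠ 0 ∧ Inner L μ d S := fun S hS => by
    by_cases hin : Inner L μ d S
    · exact ⟨by rwa [← (proj_apply hd0 hshell ψ S).1 hin], hin⟩
    · exact absurd ((proj_apply hd0 hshell ψ S).2 hin) hS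
  have hξS : ∀ S, ξ S ≠ 0 → ψ S ≠ 0 ∧ ¬ Inner L μ d S := fun S hS => by
    by_cases hin : Inner L μ d S
    · refine absurd ?_ hS
      rw [hξ, projPerp, Pi.sub_apply, (proj_apply hd0 hshell ψ S).1 hin, sub_self]
    · refine ⟨?_, hin⟩
      rwa [hξ, projPerp, Pi.sub_apply, (proj_apply hd0 hshell ψ S).2 hin, sub_zero] at hS
  have hψsum : ψ = χ + ξ := by rw [hχ, hξ, projPerp]; abel
  have hμd : μ / d = u ^ 2 * √ℓ ^ 2 := by
    rw [huu, Real.sq_sqrt hℓ0.le, hd]; field_simp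
  have hμd' : √(μ / d) = u * √ℓ := by
    rw [hμd, ← mul_pow, Real.sqrt_sq (by positivity)]
  have hsd : s / (fermiSeaEnergy L μ - lam) + d / s ≤ u⁻¹ * C := by
    have e1 : s / (fermiSeaEnergy L μ - lam) ≤ s / (c₁ * μ / ℓ) := by
      gcongr
    have e2 : s / (c₁ * μ / ℓ) = u⁻¹ * (1 / c₁) := by rw [hs]; field_simp
    have e3 : d / s = u⁻¹ := by
      rw [hd, hs, ← huu]; field_simp
    rw [hC]; linarith
  have key := h.form_le (EB := EB) (p := p) (χ := χ) (ξ := ξ) (s := s) (cχ := ε⁻¹)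
    (cξ := K ε (μ / |EB|)) (hspace u hu0 (by linarith))
    (fun S hS => hψB S (hχS S hS).1) (fun S hS => hψB S (hξS S hS).1)
    (fun S hS => ⟨hψN S (hχS S hS).1, (hχS S hS).2⟩)
    (fun S hS => ⟨hψN S (hξS S hS).1, (hξS S hS).2⟩)
    (fun x y hx0 hy0 => by
      have f := final_quadratic_le (u := u) (a := u⁻¹) (v := √ℓ) (C := C) (x := x) (y := y) hu0
        (mul_inv_cancel₀ hu0.ne') (Real.sqrt_nonneg _) hu10 huC
      have e1 : ε⁻¹ = u⁻¹ ^ 2 := by rw [inv_pow, huu]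
      have e2 : K ε (μ / |EB|) = u⁻¹ * (u⁻¹ + √ℓ + u ^ 2 * √ℓ ^ 2) := by
        rw [K, ← hℓdef, ← hu, huu, Real.sq_sqrt hℓ0.le]
      rw [e1, e2, hμd', hμd]
      refine le_trans ?_ f
      have := mul_le_mul_of_nonneg_right hsd (sq_nonneg x)
      linarith)
  have eL : braket ψ (Phi M L μ EB lam ε p ψ + Psi M L μ EB lam ε p ψ) =
      ip B χ (opG M L μ EB lam p χ - opH M L μ lam p χ - opX M L μ lam p χ -
        ((ε⁻¹ : ℝ) : ℂ) • χ) +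
      ip B ξ (opG M L μ EB lam p ξ + opP M L μ lam p ξ - ((K ε (μ / |EB|) : ℝ) : ℂ) • ξ) := by
    rw [braket_eq_ip hψB, ip_add_right, Phi, Psi, ip_proj_right, ip_projPerp_right]
  change (braket ψ (Phi M L μ EB lam ε p ψ + Psi M L μ EB lam ε p ψ)).re ≤
    (braket ψ (phi M L μ EB lam p ψ)).re
  rw [eL, braket_eq_ip hψB, Complex.add_re]
  rw [← hψsum] at key
  exact key
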